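/- Let $d\ge1$, $\beta\in\mathbb R$, $\gamma>\max\{0,-\beta\}$, and $\eta\in(-\gamma,\gamma)$ with $\eta\ge-\beta$. Write $\langle v\rangle=\sqrt{1+|v|^2}$, $F(v)=c_\gamma\langle v\rangle^{-d-\gamma}$ on $\mathbb R^d$ with $c_\gamma=\pi^{-d/2}\,\Gamma(\frac{d+\gamma}2)/\Gamma(\frac\gamma2)$ (so that $\int F\,dv=1$), $d\mu=F^{-1}dv$, $\langle f,g\rangle=\int\bar f\,g\,d\mu$, $\|g\|_k^2=\int|g|^2\langle v\rangle^k\,d\mu$, $\|g\|=\|g\|_0$, and $\Pi g=\big(\int g\,dv\big)F$. Let $\mathsf L$ be one of the following operators acting on functions of $v$ (Assumption (H)). 1. $\mathsf L f=\nabla\cdot\big(F\,\nabla(F^{-1}f)\big)$, with $\beta=2$. 2. $\mathsf L f(v)=\int b(v,v')\big(f(v')F(v)-f(v)F(v')\big)dv'$, where $b$ is measurable, the collision frequency $\nu(v)=\int b(v,v')F(v')\,dv'$ is positive, locally bounded and $\nu(v)\sim|v|^{-\beta}$ as $|v|\to\infty$; $\int\big(b(v,v')-b(v',v)\big)F(v')\,dv'=0$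 for all $v$; for some $Z>0$, $b(v,v')\ge Z^{-1}\langle v\rangle^{-\beta}\langle v'\rangle^{-\beta}$ for every $v$ and almost every $v'$; $\sup_v\langle v\rangle^\beta\int b(v',v)\langle v'\rangle^kF(v')\,dv'<\infty$ for every $k\in(0,\gamma+\beta)$; and $\iint\frac{b(v',v)^2}{\nu(v')\nu(v)}F(v)F(v')\,dv\,dv'<\infty$. 3. $\mathsf L f=\Delta^{\sigma/2}f+\nabla\cdot(E f)$, with $0<\sigma<2$, $\Delta^{\sigma/2}=-(-\Delta)^{\sigma/2}$, $\beta=\sigma-\gamma$, and $E$ a locally integrable radial vector field, $E(v)=e(|v|)\,v$, which solves $\Delta^{\sigma/2}F+\nabla\cdot(EF)=0$ in the sense of distributions. For $\xi\in\mathbb R^d$ let $$\mathsf A_\xi g=\frac1{\langle v\rangle^2}\,\Pi\left(\frac{(-i\,v\cdot\xi)\,\langle v\rangle^\beta}{1+\langle v\rangle^{2|1+\beta|}|\xi|^2}\,g\right),$$ let $\alpha=\frac{\gamma+\beta}{1+\beta}$ if $\gamma<2+\beta$ and $\alpha=2$ if $\gamma\ge2+\beta$, and let $$\mathcal L(\xi)=\frac{|\xi|^\alpha}{\langle\xi\rangle^\alpha}\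 \text{ if }\gamma\ne2+\beta,\qquad \mathcal L(\xi)=\frac{|\xi|^2\,\big|\log|\xi|\big|}{1+|\xi|^2\log|\xi|}\ \text{ if }\gamma=2+\beta$$ (with $\mathcal L(0)=0$). For fixed $\xi$, a weak solution of the mode equation $\partial_t\hat f+i\,(v\cdot\xi)\,\hat f=\mathsf L\hat f$ on $t\ge0$ is a measurable function $\hat f(t,v)$, locally bounded in $t\in[0,\infty)$ with values in $\mathrm L^2(d\mu)$, that satisfies the equation in the sense of distributions in $v$ and integrated in time: for every smooth compactly supported $\zeta$ and all $0\le s\le t$, $$\int\zeta\,\hat f(t)\,dv-\int\zeta\,\hat f(s)\,dv=\int_s^t\!\int\big(\mathsf L^\dagger\zeta-i\,(v\cdot\xi)\,\zeta\big)\hat f\,dv\,dr,$$ with an absolutely convergent right-hand side, where $\mathsf L^\dagger$ is the formal adjoint of $\mathsf L$ in $\mathrm L^2(dv)$. This is the equation satisfied, mode by mode, by the Fourier transform in $x$ of a solution of $\partial_tf+v\cdot\nabla_xf=\mathsf Lf$. For such a solution put $\mathsf R_\xi[\hat f](t)=-\frac{d}{dt}\mathrm{Re}\,\langle\mathsf A_\xi\hat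 f(t),\hat f(t)\rangle$. Then there exist a constant $c>0$ and a positive bounded function $\mathcal K:\mathbb R^d\to\mathbb R$, both depending only on $d,\gamma,\beta,\eta$ and $\mathsf L$, such that for every $\xi\in\mathbb R^d$ and every weak solution $\hat f$ of the mode equation, the estimate $$\mathsf R_\xi[\hat f](t)\ \ge\ c\,\Big(\mathcal L(\xi)\,\|\Pi\hat f(t)\|^2-\mathcal K(\xi)\,\|(1-\Pi)\hat f(t)\|_\eta^2\Big)\qquad(*)$$ holds in the following sense. (a) If $0\le a<b$ and $\int_a^b\|(1-\Pi)\hat f(t)\|_\eta^2\,dt<\infty$, then $t\mapsto\mathrm{Re}\,\langle\mathsf A_\xi\hat f(t),\hat f(t)\rangle$ is absolutely continuous on $[a,b]$ and, for almost every $t\in(a,b)$, it is differentiable at $t$ and $(*)$ holds. (b) If $t>0$, $\|(1-\Pi)\hat f(t)\|_\eta<\infty$ and $\|\hat f(s)-\hat f(t)\|_\eta\to0$ as $s\to t$, then this function is differentiable at $t$ and $(*)$ holds at $t$. -/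

import Mathlib

open MeasureTheory Set Filter Topology
open scoped ENNReal ContDiff

noncomputable section

namespace FracHypo

/-- Velocity space (and Fourier space): `ℝ^d` with its Euclidean norm. -/
abbrev Vel (d : ℕ) : Type := EuclideanSpace ℝ (Fin d)

/-- The bracket `⟨v⟩ = √(1 + |v|²)`. -/
def jap {d : ℕ} (v : Vel d) : ℝ := Real.sqrt (1 + ‖v‖ ^ 2)

/-- The normalization constant `c_γ = π^{-d/2} Γ((d+γ)/2) / Γ(γ/2)`. -/
def cGamma (d : ℕ) (γ : ℝ) : ℝ :=
  Real.pi ^ (-((d : ℝ) / 2)) * Real.Gamma (((d : ℝ) + γ) / 2) / Real.Gamma (γ / 2)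

/-- The fat tailed local equilibrium `F(v) = c_γ ⟨v⟩^{-(d+γ)}`. -/
def equil {d : ℕ} (γ : ℝ) (v : Vel d) : ℝ := cGamma d γ * jap v ^ (-((d : ℝ) + γ))

/-- The scalar product `⟨f, g⟩ = ∫ conj f · g dμ`, where `dμ = F⁻¹ dv`. -/
def innerMu {d : ℕ} (γ : ℝ) (f g : Vel d → ℂ) : ℂ :=
  ∫ v, starRingEnd ℂ (f v) * g v * (((equil γ v)⁻¹ : ℝ) : ℂ)

/-- The squared weighted norm `‖g‖_k² = ∫ |g|² ⟨v⟩^k dμ`, with values in `[0, ∞]`. -/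
def normSq {d : ℕ} (γ k : ℝ) (g : Vel d → ℂ) : ℝ≥0∞ :=
  ∫⁻ v, ‖g v‖ₑ ^ 2 * ENNReal.ofReal (jap v ^ k * (equil γ v)⁻¹)

/-- The projection `Π g = ρ_g F` with `ρ_g = ∫ g dv`. -/
def proj {d : ℕ} (γ : ℝ) (g : Vel d → ℂ) : Vel d → ℂ :=
  fun v => (∫ w, g w) * ((equil γ v : ℝ) : ℂ)

/-- `φ(ξ, v) = ⟨v⟩^β / (1 + ⟨v⟩^{2|1+β|} |ξ|²)`. -/
def phi {d : ℕ} (β : ℝ) (ξ v : Vel d) : ℝ :=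
  jap v ^ β / (1 + jap v ^ (2 * |1 + β|) * ‖ξ‖ ^ 2)

/-- The operator `A_ξ g = ⟨v⟩^{-2} Π ( (-i v·ξ) φ(ξ, v) g )`. -/
def opA {d : ℕ} (γ β : ℝ) (ξ : Vel d) (g : Vel d → ℂ) : Vel d → ℂ :=
  fun v => ((jap v ^ (-2 : ℝ) : ℝ) : ℂ) *
    proj γ (fun w => -Complex.I * ((inner ℝ w ξ : ℝ) : ℂ) * ((phi β ξ w : ℝ) : ℂ) * g w) v

/-- The correction term `Re ⟨A_ξ g, g⟩`. -/
def corrector {d : ℕ} (γ β : ℝ) (ξ : Vel d) (g : Vel d → ℂ) : ℝ :=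
  (innerMu γ (opA γ β ξ g) g).re

/-- `R_ξ[f](t) = - d/dt Re ⟨A_ξ f(t), f(t)⟩`. -/
def corrDissip {d : ℕ} (γ β : ℝ) (ξ : Vel d) (f : ℝ → Vel d → ℂ) (t : ℝ) : ℝ :=
  -deriv (fun s => corrector γ β ξ (f s)) t

/-- The exponent `α`. -/
def alphaExp (γ β : ℝ) : ℝ :=
  open Classical in if γ < 2 + β then (γ + β) / (1 + β) else 2

/-- The symbol `𝓛(ξ)`. -/
def symbolL {d : ℕ} (γ β : ℝ) (ξ : Vel d) : ℝ :=
  open Classical in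
  if γ = 2 + β then
    ‖ξ‖ ^ 2 * |Real.log ‖ξ‖| / (1 + ‖ξ‖ ^ 2 * Real.log ‖ξ‖)
  else ‖ξ‖ ^ alphaExp γ β / jap ξ ^ alphaExp γ β

/-- Smooth compactly supported real test functions. -/
def IsTest {d : ℕ} (ζ : Vel d → ℝ) : Prop := ContDiff ℝ ∞ ζ ∧ HasCompactSupport ζ

/-- The divergence of a vector field. -/
def diverg {d : ℕ} (X : Vel d → Vel d) (v : Vel d) : ℝ :=
  ∑ i : Fin d, fderiv ℝ (fun w => X w i) v (EuclideanSpace.single i (1 : ℝ))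

/-- The constant `C_{d,σ} = - 2^σ π^{-d/2} Γ((d+σ)/2) / Γ(-σ/2)`, positive for `0 < σ < 2`. -/
def cFrac (d : ℕ) (σ : ℝ) : ℝ :=
  -(2 ^ σ / Real.pi ^ ((d : ℝ) / 2) * Real.Gamma (((d : ℝ) + σ) / 2) / Real.Gamma (-(σ / 2)))

/-- The fractional Laplacian `Δ^{σ/2} = -(-Δ)^{σ/2}`, that is,
`C_{d,σ} p.v. ∫ (u(v') - u(v)) |v' - v|^{-d-σ} dv'`; the principal value is written as an
absolutely convergent integral by symmetrizing in `h = v' - v`. -/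
def fracLap {d : ℕ} (σ : ℝ) (u : Vel d → ℝ) (v : Vel d) : ℝ :=
  cFrac d σ / 2 * ∫ h : Vel d, (u (v + h) + u (v - h) - 2 * u v) / ‖h‖ ^ ((d : ℝ) + σ)

/-- The three families of collision operators:
* `fokkerPlanck`: `L f = ∇·(F ∇(F⁻¹ f))`;
* `scattering b`: `L f (v) = ∫ b(v,v') (f(v') F(v) - f(v) F(v')) dv'`;
* `fracFokkerPlanck σ E`: `L f = Δ^{σ/2} f + ∇·(E f)`. -/
inductive Collision (d : ℕ) : Type
  | fokkerPlanck : Collision d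
  | scattering (b : Vel d → Vel d → ℝ) : Collision d
  | fracFokkerPlanck (σ : ℝ) (E : Vel d → Vel d) : Collision d

/-- The collision frequency `ν(v) = ∫ b(v,v') F(v') dv'`. -/
def collFreq {d : ℕ} (γ : ℝ) (b : Vel d → Vel d → ℝ) (v : Vel d) : ℝ :=
  ∫ w, b v w * equil γ w

/-- The assumptions on the kernel `b` of a scattering operator. -/
structure ScatteringAssumption {d : ℕ} (γ β : ℝ) (b : Vel d → Vel d → ℝ) : Prop where
  measurable : Measurable (fun p : Vel d × Vel d => b p.1 p.2)
  integrable_left : ∀ v, Integrable (fun w => b v w * equil γ w)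
  integrable_right : ∀ v, Integrable (fun w => b w v * equil γ w)
  /-- the collision frequency is positive, locally bounded, and `ν(v) ∼ |v|^{-β}` at infinity -/
  freq_pos : ∀ v, 0 < collFreq γ b v
  freq_locBdd : ∀ r : ℝ, ∃ C : ℝ, ∀ v, ‖v‖ ≤ r → collFreq γ b v ≤ C
  freq_equiv : Asymptotics.IsEquivalent (cocompact (Vel d)) (collFreq γ b)
    (fun v => ‖v‖ ^ (-β))
  /-- local mass conservation -/
  mass : ∀ v, ∫ w, (b v w - b w v) * equil γ w = 0
  /-- lower bound (kernels such as `|v - v'|^{-β}` are undefined on the diagonal, hence the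
  null set) -/
  lower : ∃ Z : ℝ, 0 < Z ∧ ∀ v, ∀ᵐ w, 1 / Z * jap v ^ (-β) * jap w ^ (-β) ≤ b v w
  /-- moment bounds -/
  moment : ∀ k : ℝ, 0 < k → k < γ + β → ∃ C : ℝ, ∀ v,
    Integrable (fun w => b w v * jap w ^ k * equil γ w) ∧
      jap v ^ β * ∫ w, b w v * jap w ^ k * equil γ w ≤ C
  /-- square integrability of the kernel -/
  square : Integrable (fun p : Vel d × Vel d =>
    b p.2 p.1 ^ 2 / (collFreq γ b p.2 * collFreq γ b p.1) * equil γ p.1 * equil γ p.2)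

/-- `E` is a radial friction force which solves `Δ^{σ/2} F + ∇·(E F) = 0` in the sense of
distributions. -/
structure IsFriction {d : ℕ} (γ σ : ℝ) (E : Vel d → Vel d) : Prop where
  locInt : LocallyIntegrable E
  radial : ∃ e : ℝ → ℝ, ∀ v, E v = e ‖v‖ • v
  equation : ∀ ζ : Vel d → ℝ, IsTest ζ →
    ∫ v, fracLap σ (equil γ) v * ζ v = ∫ v, equil γ v * inner ℝ (E v) (gradient ζ v)

/-- Assumption (H): one of the three cases, with the associated parameter `β`. -/
def AssumptionH {d : ℕ} (γ β : ℝ) : Collision d → Prop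
  | .fokkerPlanck => β = 2
  | .scattering b => ScatteringAssumption γ β b
  | .fracFokkerPlanck σ E => 0 < σ ∧ σ < 2 ∧ β = σ - γ ∧ IsFriction γ σ E

/-- The formal adjoint of the collision operator with respect to `dv`, acting on real functions:
`∫ ζ (L f) dv = ∫ (L.adj ζ) f dv`. Equivalently `L.adj ζ = F⁻¹ L* (ζ F)`, with `L*` the dual of
`L` in `L²(dμ)`. -/
def Collision.adj {d : ℕ} (γ : ℝ) : Collision d → (Vel d → ℝ) → Vel d → ℝ
  | .fokkerPlanck, ζ, v => (equil γ v)⁻¹ * diverg (fun w => equil γ w • gradient ζ w) v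
  | .scattering b, ζ, v => (∫ w, b w v * ζ w * equil γ w) - collFreq γ b v * ζ v
  | .fracFokkerPlanck σ E, ζ, v => fracLap σ ζ v - inner ℝ (E v) (gradient ζ v)

/-- `L.adj ζ - i (v·ξ) ζ`: the formal adjoint of `L - i v·ξ`. -/
def Collision.modeAdj {d : ℕ} (γ : ℝ) (L : Collision d) (ξ : Vel d) (ζ : Vel d → ℝ)
    (v : Vel d) : ℂ :=
  ((L.adj γ ζ v : ℝ) : ℂ) - Complex.I * ((inner ℝ v ξ : ℝ) : ℂ) * ((ζ v : ℝ) : ℂ)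

/-- Weak solutions, on `t ≥ 0`, of `∂_t f + i (v·ξ) f = L f`, the kinetic equation
`∂_t f + v·∇_x f = L f` in the Fourier mode `ξ` with respect to `x`: `f` is locally bounded in
time with values in `L²(dμ)` and the equation holds in the sense of distributions in `v`,
integrated in time. -/
structure IsModeSolution {d : ℕ} (γ : ℝ) (L : Collision d) (ξ : Vel d)
    (f : ℝ → Vel d → ℂ) : Prop where
  meas : AEStronglyMeasurable (fun p : ℝ × Vel d => f p.1 p.2)
    ((volume.restrict (Ici (0 : ℝ))).prod volume)
  meas_at : ∀ t, 0 ≤ t → AEStronglyMeasurable (f t) volume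
  locBdd : ∀ T : ℝ, ∃ C : ℝ, ∀ t, 0 ≤ t → t ≤ T → normSq γ 0 (f t) ≤ ENNReal.ofReal C
  integrable : ∀ ζ : Vel d → ℝ, IsTest ζ → ∀ T : ℝ,
    Integrable (fun p : ℝ × Vel d => L.modeAdj γ ξ ζ p.2 * f p.1 p.2)
      ((volume.restrict (Icc 0 T)).prod volume)
  equation : ∀ ζ : Vel d → ℝ, IsTest ζ → ∀ s t : ℝ, 0 ≤ s → s ≤ t →
    (∫ v, ((ζ v : ℝ) : ℂ) * f t v) - ∫ v, ((ζ v : ℝ) : ℂ) * f s v =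
      ∫ r in s..t, ∫ v, L.modeAdj γ ξ ζ v * f r v

/-- The micro part `(1 - Π) g`. -/
def micro {d : ℕ} (γ : ℝ) (g : Vel d → ℂ) : Vel d → ℂ := fun v => g v - proj γ g v

end FracHypo

end

open FracHypo

noncomputable section

namespace FracHypo

section Basics

section Bracket

variable {d : ℕ}

lemma jap_sq (v : Vel d) : jap v ^ 2 = 1 + ‖v‖ ^ 2 := Real.sq_sqrt (by positivity)

lemma one_le_jap (v : Vel d) : 1 ≤ jap v :=
  Real.one_le_sqrt.mpr (by nlinarith [sq_nonneg ‖v‖])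

lemma jap_pos (v : Vel d) : 0 < jap v := zero_lt_one.trans_le (one_le_jap v)

lemma norm_le_jap (v : Vel d) : ‖v‖ ≤ jap v :=
  Real.le_sqrt_of_sq_le (by linarith)

lemma jap_le_one_add_norm (v : Vel d) : jap v ≤ 1 + ‖v‖ := sqrt_one_add_norm_sq_le v

lemma jap_add_le (v h : Vel d) : jap (v + h) ≤ jap v + ‖h‖ := by
  have h1 := jap_pos v
  refine Real.sqrt_le_iff.mpr ⟨by positivity, ?_⟩
  have h2 := norm_add_le v h
  have h3 := jap_sq v
  have h4 := norm_le_jap v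
  have : ‖v + h‖ ^ 2 ≤ (‖v‖ + ‖h‖) ^ 2 := by gcongr
  nlinarith [mul_nonneg (sub_nonneg.mpr h4) (norm_nonneg h)]

lemma jap_neg (v : Vel d) : jap (-v) = jap v := by simp [jap]

lemma jap_eq_rpow (v : Vel d) (p : ℝ) : jap v ^ p = (1 + ‖v‖ ^ 2) ^ (p / 2) := by
  rw [jap, Real.sqrt_eq_rpow, ← Real.rpow_mul (by positivity)]
  congr 1
  ring

lemma continuous_jap : Continuous (jap : Vel d → ℝ) := by
  unfold jap
  fun_prop

lemma continuous_jap_rpow (p : ℝ) : Continuous (fun v : Vel d => jap v ^ p) :=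
  continuous_jap.rpow_const fun v => Or.inl (jap_pos v).ne'

@[fun_prop]
lemma measurable_jap : Measurable (jap : Vel d → ℝ) := continuous_jap.measurable

lemma jap_rpow_pos (v : Vel d) (p : ℝ) : 0 < jap v ^ p := Real.rpow_pos_of_pos (jap_pos v) p

lemma jap_rpow_le_one (v : Vel d) {p : ℝ} (hp : p ≤ 0) : jap v ^ p ≤ 1 :=
  Real.rpow_le_one_of_one_le_of_nonpos (one_le_jap v) hp

lemma jap_rpow_mono (v : Vel d) {p q : ℝ} (h : p ≤ q) : jap v ^ p ≤ jap v ^ q :=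
  Real.rpow_le_rpow_of_exponent_le (one_le_jap v) h

lemma lintegral_jap_rpow_lt_top {s : ℝ} (hs : 0 < s) :
    ∫⁻ v : Vel d, ENNReal.ofReal (jap v ^ (-((d : ℝ) + s))) < ⊤ := by
  have h : Integrable (fun v : Vel d => (1 + ‖v‖ ^ 2) ^ (-((d : ℝ) + s) / 2)) :=
    integrable_rpow_neg_one_add_norm_sq (by simp; linarith)
  have := h.lintegral_lt_top
  simpa only [jap_eq_rpow] using this

/-- The bracket varies slowly: it is comparable to itself on the ball of radius `⟨v⟩/2`. -/
lemma jap_add_le_two_mul {v h : Vel d} (hh : ‖h‖ ≤ jap v / 2) : jap (v + h) ≤ 2 * jap v := by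
  have := jap_add_le v h
  have := jap_pos v
  linarith

lemma jap_le_two_mul_add {v h : Vel d} (hh : ‖h‖ ≤ jap v / 2) : jap v ≤ 2 * jap (v + h) := by
  have := jap_add_le (v + h) (-h)
  rw [add_neg_cancel_right, norm_neg] at this
  linarith

lemma rpow_le_of_comparable {x y : ℝ} (hx : 0 < x) (hy : 0 < y) (h1 : x ≤ 2 * y) (h2 : y ≤ 2 * x)
    (p : ℝ) : x ^ p ≤ 2 ^ |p| * y ^ p := by
  rcases le_total 0 p with hp | hp
  · rw [abs_of_nonneg hp, ← Real.mul_rpow (by norm_num) hy.le]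
    exact Real.rpow_le_rpow hx.le h1 hp
  · rw [abs_of_nonpos hp]
    have : (2 * x) ^ p ≤ y ^ p := Real.rpow_le_rpow_of_nonpos hy h2 hp
    rw [Real.mul_rpow (by norm_num) hx.le] at this
    calc x ^ p = 2 ^ (-p) * (2 ^ p * x ^ p) := by
          rw [← mul_assoc, ← Real.rpow_add (by norm_num)]; simp
      _ ≤ _ := by gcongr

end Bracket

section Equilibrium

variable {d : ℕ}

lemma cGamma_pos (hd : 1 ≤ d) {γ : ℝ} (hγ : 0 < γ) : 0 < cGamma d γ := by
  unfold cGamma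
  have h1 : 0 < Real.Gamma (((d : ℝ) + γ) / 2) := Real.Gamma_pos_of_pos (by positivity)
  have h2 : 0 < Real.Gamma (γ / 2) := Real.Gamma_pos_of_pos (by positivity)
  positivity

lemma equil_pos (hd : 1 ≤ d) {γ : ℝ} (hγ : 0 < γ) (v : Vel d) : 0 < equil γ v :=
  mul_pos (cGamma_pos hd hγ) (jap_rpow_pos v _)

lemma continuous_equil (γ : ℝ) : Continuous (equil γ : Vel d → ℝ) :=
  continuous_const.mul (continuous_jap_rpow _)

@[fun_prop]
lemma measurable_equil (γ : ℝ) : Measurable (equil γ : Vel d → ℝ) :=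
  (continuous_equil γ).measurable

lemma equil_neg (γ : ℝ) (v : Vel d) : equil γ (-v) = equil γ v := by
  simp [equil, jap_neg]

/-- The weight `⟨v⟩^k F`, as an extended nonnegative function. -/
def wtF (γ k : ℝ) (v : Vel d) : ℝ≥0∞ := ENNReal.ofReal (jap v ^ k * equil γ v)

@[fun_prop]
lemma measurable_wtF (γ k : ℝ) : Measurable (wtF γ k : Vel d → ℝ≥0∞) :=
  ((continuous_jap_rpow k).mul (continuous_equil γ)).measurable.ennreal_ofReal

lemma wtF_eq (hd : 1 ≤ d) {γ : ℝ} (hγ : 0 < γ) (k : ℝ) (v : Vel d) :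
    wtF γ k v = ENNReal.ofReal (cGamma d γ) * ENNReal.ofReal (jap v ^ (-((d : ℝ) + (γ - k)))) := by
  rw [wtF, equil, ← ENNReal.ofReal_mul (cGamma_pos hd hγ).le]
  congr 1
  rw [mul_left_comm, ← Real.rpow_add (jap_pos v)]
  congr 2
  ring

lemma lintegral_wtF_lt_top (hd : 1 ≤ d) {γ k : ℝ} (hγ : 0 < γ) (hk : k < γ) :
    ∫⁻ v : Vel d, wtF γ k v < ⊤ := by
  simp_rw [wtF_eq hd hγ]
  rw [lintegral_const_mul _ (continuous_jap_rpow _).measurable.ennreal_ofReal]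
  exact ENNReal.mul_lt_top ENNReal.ofReal_lt_top (lintegral_jap_rpow_lt_top (by linarith))

lemma integrable_jap_rpow_mul_equil (hd : 1 ≤ d) {γ k : ℝ} (hγ : 0 < γ) (hk : k < γ) :
    Integrable (fun v : Vel d => jap v ^ k * equil γ v) := by
  refine ⟨((continuous_jap_rpow k).mul (continuous_equil γ)).aestronglyMeasurable, ?_⟩
  rw [hasFiniteIntegral_iff_ofReal
    (ae_of_all _ fun v => (mul_pos (jap_rpow_pos v k) (equil_pos hd hγ v)).le)]
  exact lintegral_wtF_lt_top hd hγ hk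

lemma integrable_equil (hd : 1 ≤ d) {γ : ℝ} (hγ : 0 < γ) :
    Integrable (equil γ : Vel d → ℝ) := by
  simpa using integrable_jap_rpow_mul_equil (d := d) (k := 0) hd hγ hγ

end Equilibrium

section Kernel

variable {d : ℕ}

lemma lintegral_comp_inv_smul (f : Vel d → ℝ≥0∞) {R : ℝ} (hR : 0 < R) :
    ∫⁻ x, f (R⁻¹ • x) = ENNReal.ofReal (R ^ (d : ℝ)) * ∫⁻ x, f x := by
  have hR' : R⁻¹ ≠ 0 := by positivity
  have h1 : MeasurableEmbedding (fun x : Vel d => R⁻¹ • x) :=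
    (Homeomorph.smulOfNeZero R⁻¹ hR').measurableEmbedding
  rw [← h1.lintegral_map f, Measure.map_addHaar_smul _ hR', lintegral_smul_measure]
  congr 2
  simp [abs_of_pos hR]

/-- The kernel `|h|^{-d-σ}` of the fractional Laplacian, with values in `[0, ∞]`. -/
def fracKer (σ : ℝ) (h : Vel d) : ℝ≥0∞ := ENNReal.ofReal (1 / ‖h‖ ^ ((d : ℝ) + σ))

@[fun_prop]
lemma measurable_fracKer (σ : ℝ) : Measurable (fracKer σ : Vel d → ℝ≥0∞) := by
  unfold fracKer
  fun_prop

lemma fracKer_neg (σ : ℝ) (h : Vel d) : fracKer σ (-h) = fracKer σ h := by simp [fracKer]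

lemma fracKer_smul (σ : ℝ) {R : ℝ} (hR : 0 < R) (h : Vel d) :
    fracKer σ h = ENNReal.ofReal (R ^ (-((d : ℝ) + σ))) * fracKer σ (R⁻¹ • h) := by
  rw [fracKer, fracKer, ← ENNReal.ofReal_mul (by positivity), norm_smul, norm_inv,
    Real.norm_of_nonneg hR.le, Real.mul_rpow (by positivity) (by positivity),
    Real.inv_rpow hR.le, Real.rpow_neg hR.le]
  congr 1
  have : R ^ ((d : ℝ) + σ) ≠ 0 := by positivity
  field_simp

lemma exists_lintegral_fracKer_far {σ : ℝ} (hσ : 0 < σ) :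
    ∃ C : ℝ, 0 < C ∧ ∀ R : ℝ, 0 < R →
      ∫⁻ h in {h : Vel d | R ≤ ‖h‖}, fracKer σ h ≤ ENNReal.ofReal (C * R ^ (-σ)) := by
  set I : ℝ≥0∞ := ∫⁻ h in {h : Vel d | 1 ≤ ‖h‖}, fracKer σ h with hI
  have hm : ∀ R : ℝ, MeasurableSet {h : Vel d | R ≤ ‖h‖} := fun R =>
    measurableSet_le measurable_const measurable_norm
  have hfin : I < ⊤ := by
    have h1 : I ≤ ENNReal.ofReal (2 ^ ((d : ℝ) + σ)) *
        ∫⁻ v : Vel d, ENNReal.ofReal (jap v ^ (-((d : ℝ) + σ))) := by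
      rw [← lintegral_const_mul _ (continuous_jap_rpow _).measurable.ennreal_ofReal]
      refine (setLIntegral_mono' (hm 1) fun h (hh : 1 ≤ ‖h‖) => ?_).trans
        (setLIntegral_le_lintegral _ _)
      rw [fracKer, ← ENNReal.ofReal_mul (by positivity)]
      refine ENNReal.ofReal_le_ofReal ?_
      have h2 : jap h ≤ 2 * ‖h‖ := (jap_le_one_add_norm h).trans (by linarith)
      rw [Real.rpow_neg (jap_pos h).le, div_le_iff₀ (by positivity), mul_assoc,
        ← div_eq_inv_mul, ← mul_div_assoc, le_div_iff₀ (by have := jap_pos h; positivity), one_mul,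
        ← Real.mul_rpow (by norm_num) (by positivity)]
      exact Real.rpow_le_rpow (jap_pos h).le h2 (by positivity)
    exact h1.trans_lt (ENNReal.mul_lt_top ENNReal.ofReal_lt_top (lintegral_jap_rpow_lt_top hσ))
  refine ⟨I.toReal + 1, by positivity, fun R hR => ?_⟩
  have h3 : ∫⁻ h in {h : Vel d | R ≤ ‖h‖}, fracKer σ h
      = ENNReal.ofReal (R ^ (-σ)) * I := by
    rw [hI, ← lintegral_indicator (hm R), ← lintegral_indicator (hm 1)]
    have : ∀ h : Vel d, {h : Vel d | R ≤ ‖h‖}.indicator (fracKer σ) h =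
        ENNReal.ofReal (R ^ (-((d : ℝ) + σ))) *
          {h : Vel d | 1 ≤ ‖h‖}.indicator (fracKer σ) (R⁻¹ • h) := by
      intro h
      have : (R ≤ ‖h‖) ↔ 1 ≤ ‖R⁻¹ • h‖ := by
        rw [norm_smul, norm_inv, Real.norm_of_nonneg hR.le, ← div_eq_inv_mul, one_le_div hR]
      by_cases hh : R ≤ ‖h‖
      · rw [indicator_of_mem (by exact hh), indicator_of_mem (by exact this.mp hh)]
        exact fracKer_smul σ hR h
      · rw [indicator_of_notMem (by exact hh),
          indicator_of_notMem (by exact fun h' => hh (this.mpr h')), mul_zero]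
    simp_rw [this]
    rw [lintegral_const_mul _ (by
      have := (measurable_fracKer (d := d) σ).indicator (hm 1)
      exact this.comp (measurable_const_smul _)),
      lintegral_comp_inv_smul _ hR, ← mul_assoc, ← ENNReal.ofReal_mul (by positivity),
      ← Real.rpow_add hR]
    congr 3
    ring
  rw [h3, mul_comm, ENNReal.ofReal_mul (by positivity)]
  gcongr
  rw [ENNReal.le_ofReal_iff_toReal_le hfin.ne (by positivity)]
  linarith

lemma exists_lintegral_fracKer_near (hd : 1 ≤ d) {σ : ℝ} (hσ : σ < 2) :
    ∃ C : ℝ, 0 < C ∧ ∀ R : ℝ, 0 < R →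
      ∫⁻ h in {h : Vel d | ‖h‖ < R}, ENNReal.ofReal (‖h‖ ^ 2) * fracKer σ h
        ≤ ENNReal.ofReal (C * R ^ (2 - σ)) := by
  set g : Vel d → ℝ≥0∞ := fun h => ENNReal.ofReal (‖h‖ ^ 2) * fracKer σ h with hg
  set I : ℝ≥0∞ := ∫⁻ h in {h : Vel d | ‖h‖ < 1}, g h with hI
  have hgm : Measurable g := by fun_prop
  have hm : ∀ R : ℝ, MeasurableSet {h : Vel d | ‖h‖ < R} := fun R =>
    measurableSet_lt measurable_norm measurable_const
  have hfin : I < ⊤ := by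
    have h1 : IntegrableOn (fun h : Vel d => ‖h‖ ^ (-((d : ℝ) + σ - 2))) (Metric.ball 0 1) := by
      refine integrableOn_ball_of_norm_le_rpow (C := 1) (α := (d : ℝ) + σ - 2) (by simpa using hd)
        (by simp; linarith) (ae_of_all _ fun h => ?_)
        (measurable_norm.pow_const _).aestronglyMeasurable
      rw [Real.norm_of_nonneg (by positivity), one_mul]
    have h2 := h1.lintegral_lt_top
    have h3 : Metric.ball (0 : Vel d) 1 = {h : Vel d | ‖h‖ < 1} := by ext; simp
    rw [h3] at h2
    refine (lintegral_congr_ae ?_).trans_lt h2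
    have h0 : ∀ᵐ h : Vel d, h ≠ 0 := by
      have : Nontrivial (Vel d) := Module.nontrivial_of_finrank_pos (R := ℝ) (by simp; omega)
      simp [ae_iff]
    filter_upwards [ae_restrict_of_ae h0] with h hh
    have hpos : 0 < ‖h‖ := norm_pos_iff.mpr hh
    simp only [hg, fracKer]
    rw [← ENNReal.ofReal_mul (by positivity)]
    congr 1
    rw [neg_sub, Real.rpow_sub hpos, Real.rpow_two]
    ring
  refine ⟨I.toReal + 1, by positivity, fun R hR => ?_⟩
  have h3 : ∫⁻ h in {h : Vel d | ‖h‖ < R}, g h = ENNReal.ofReal (R ^ (2 - σ)) * I := by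
    rw [hI, ← lintegral_indicator (hm R), ← lintegral_indicator (hm 1)]
    have : ∀ h : Vel d, {h : Vel d | ‖h‖ < R}.indicator g h =
        ENNReal.ofReal (R ^ (2 - ((d : ℝ) + σ))) *
          {h : Vel d | ‖h‖ < 1}.indicator g (R⁻¹ • h) := by
      intro h
      have h4 : ‖R⁻¹ • h‖ = R⁻¹ * ‖h‖ := by
        rw [norm_smul, norm_inv, Real.norm_of_nonneg hR.le]
      have : (‖h‖ < R) ↔ ‖R⁻¹ • h‖ < 1 := by
        rw [h4, ← div_eq_inv_mul, div_lt_one hR]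
      by_cases hh : ‖h‖ < R
      · rw [indicator_of_mem (by exact hh), indicator_of_mem (by exact this.mp hh)]
        simp only [hg]
        rw [fracKer_smul σ hR h, h4, ← mul_assoc, ← mul_assoc, ← ENNReal.ofReal_mul (by positivity),
          ← ENNReal.ofReal_mul (by positivity)]
        congr 2
        rw [sub_eq_add_neg, Real.rpow_add hR, Real.rpow_two]
        field_simp
      · rw [indicator_of_notMem (by exact hh),
          indicator_of_notMem (by exact fun h' => hh (this.mpr h')), mul_zero]
    simp_rw [this]
    rw [lintegral_const_mul _ (by exact (hgm.indicator (hm 1)).comp (measurable_const_smul _)),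
      lintegral_comp_inv_smul _ hR, ← mul_assoc, ← ENNReal.ofReal_mul (by positivity),
      ← Real.rpow_add hR]
    congr 3
    ring
  rw [h3, mul_comm, ENNReal.ofReal_mul (by positivity)]
  gcongr
  rw [ENNReal.le_ofReal_iff_toReal_le hfin.ne (by positivity)]
  linarith

end Kernel

section CauchySchwarz

lemma lintegral_mul_sq_le {α : Type*} [MeasurableSpace α] (μ : Measure α) {f g : α → ℝ≥0∞}
    (hf : AEMeasurable f μ) (hg : AEMeasurable g μ) :
    (∫⁻ x, f x * g x ∂μ) ^ 2 ≤ (∫⁻ x, f x ^ 2 ∂μ) * ∫⁻ x, g x ^ 2 ∂μ := by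
  have h := ENNReal.lintegral_mul_le_Lp_mul_Lq μ (Real.HolderConjugate.two_two) hf hg
  have h2 := ENNReal.rpow_le_rpow h (z := 2) (by norm_num)
  rw [ENNReal.mul_rpow_of_nonneg _ _ (by norm_num : (0 : ℝ) ≤ 2), ← ENNReal.rpow_mul,
    ← ENNReal.rpow_mul] at h2
  simpa using h2

end CauchySchwarz

end Basics

section Symbols

variable {d : ℕ}

/-- Smooth functions of size `m` whose derivatives up to order two gain powers of `⟨v⟩⁻¹`. -/
structure SymBound (m : Vel d → ℝ) (C : ℝ) (ψ : Vel d → ℝ) : Prop where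
  smooth : ContDiff ℝ ∞ ψ
  bound : ∀ v, |ψ v| ≤ C * m v
  bound_fderiv : ∀ v, ‖fderiv ℝ ψ v‖ ≤ C * m v / jap v
  bound_fderiv2 : ∀ v, ‖fderiv ℝ (fderiv ℝ ψ) v‖ ≤ C * m v / jap v ^ 2

/-- Bounded, continuous, slowly varying weights. -/
structure Envelope (m : Vel d → ℝ) (A : ℝ) : Prop where
  continuous : Continuous m
  nonneg : ∀ v, 0 ≤ m v
  le : ∀ v, m v ≤ A
  slow : ∀ v h, ‖h‖ ≤ jap v / 2 → m (v + h) ≤ A * m v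

/-- The real inner product as a continuous bilinear map. -/
def innerCLM (d : ℕ) : Vel d →L[ℝ] Vel d →L[ℝ] ℝ :=
  (innerₗ (Vel d)).mkContinuous₂ 1 fun v w => by
    rw [one_mul]
    exact norm_inner_le_norm (𝕜 := ℝ) v w

lemma norm_innerCLM_apply (v : Vel d) : ‖innerCLM d v‖ = ‖v‖ := innerSL_apply_norm ℝ v

lemma norm_innerCLM_le : ‖innerCLM d‖ ≤ 1 :=
  ContinuousLinearMap.opNorm_le_bound _ zero_le_one fun w => by simp [norm_innerCLM_apply]

lemma norm_smul_add_smulRight_le (a : ℝ) (L : Vel d →L[ℝ] Vel d →L[ℝ] ℝ) (p q : Vel d →L[ℝ] ℝ) :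
    ‖a • L + p.smulRight q‖ ≤ |a| * ‖L‖ + ‖p‖ * ‖q‖ := by
  refine (ContinuousLinearMap.opNorm_add_le _ _).trans (add_le_add ?_ ?_)
  · exact ContinuousLinearMap.opNorm_smul_le a L
  · rw [ContinuousLinearMap.norm_smulRight_apply]

namespace SymBound

variable {m m₁ m₂ : Vel d → ℝ} {C C₁ C₂ : ℝ} {ψ f g : Vel d → ℝ}

lemma nonneg (h : SymBound m C ψ) (v : Vel d) : 0 ≤ C * m v := (abs_nonneg _).trans (h.bound v)

lemma differentiable (h : SymBound m C ψ) : Differentiable ℝ ψ := h.smooth.differentiable (by simp)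

lemma differentiable_fderiv (h : SymBound m C ψ) : Differentiable ℝ (fderiv ℝ ψ) :=
  (h.smooth.fderiv_right (m := ∞) (by simp)).differentiable (by simp)

lemma mul (hf : SymBound m₁ C₁ f) (hg : SymBound m₂ C₂ g) :
    SymBound (fun v => m₁ v * m₂ v) (4 * (C₁ * C₂)) (fun v => f v * g v) := by
  have e1 : fderiv ℝ (fun v => f v * g v) = fun v => f v • fderiv ℝ g v + g v • fderiv ℝ f v :=
    funext fun v => fderiv_fun_mul (hf.differentiable v) (hg.differentiable v)
  have key : ∀ v, 0 ≤ C₁ * C₂ * (m₁ v * m₂ v) := fun v => by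
    have := mul_nonneg (hf.nonneg v) (hg.nonneg v); nlinarith
  refine ⟨hf.smooth.mul hg.smooth, fun v => ?_, fun v => ?_, fun v => ?_⟩
  · rw [abs_mul]
    have := mul_le_mul (hf.bound v) (hg.bound v) (abs_nonneg _) (hf.nonneg v)
    nlinarith [key v]
  · rw [e1]
    have hj := jap_pos v
    calc ‖f v • fderiv ℝ g v + g v • fderiv ℝ f v‖
        ≤ |f v| * ‖fderiv ℝ g v‖ + |g v| * ‖fderiv ℝ f v‖ := by
          refine (norm_add_le _ _).trans ?_
          rw [norm_smul, norm_smul, Real.norm_eq_abs, Real.norm_eq_abs]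
      _ ≤ (C₁ * m₁ v) * (C₂ * m₂ v / jap v) + (C₂ * m₂ v) * (C₁ * m₁ v / jap v) := by
          gcongr
          · exact hf.nonneg v
          · exact hf.bound v
          · exact hg.bound_fderiv v
          · exact hg.nonneg v
          · exact hg.bound v
          · exact hf.bound_fderiv v
      _ = 2 * (C₁ * C₂ * (m₁ v * m₂ v)) / jap v := by ring
      _ ≤ _ := by
          refine div_le_div_of_nonneg_right ?_ hj.le
          nlinarith [key v]
  · rw [e1]
    have hj := jap_pos v
    have h1 : HasFDerivAt (fun v => f v • fderiv ℝ g v + g v • fderiv ℝ f v)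
        ((f v • fderiv ℝ (fderiv ℝ g) v + (fderiv ℝ f v).smulRight (fderiv ℝ g v)) +
          (g v • fderiv ℝ (fderiv ℝ f) v + (fderiv ℝ g v).smulRight (fderiv ℝ f v))) v :=
      ((hf.differentiable v).hasFDerivAt.smul (hg.differentiable_fderiv v).hasFDerivAt).add
        ((hg.differentiable v).hasFDerivAt.smul (hf.differentiable_fderiv v).hasFDerivAt)
    rw [h1.fderiv]
    calc _ ≤ (|f v| * ‖fderiv ℝ (fderiv ℝ g) v‖ + ‖fderiv ℝ f v‖ * ‖fderiv ℝ g v‖) +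
          (|g v| * ‖fderiv ℝ (fderiv ℝ f) v‖ + ‖fderiv ℝ g v‖ * ‖fderiv ℝ f v‖) := by
          exact (ContinuousLinearMap.opNorm_add_le _ _).trans
            (add_le_add (norm_smul_add_smulRight_le _ _ _ _) (norm_smul_add_smulRight_le _ _ _ _))
      _ ≤ ((C₁ * m₁ v) * (C₂ * m₂ v / jap v ^ 2) + (C₁ * m₁ v / jap v) * (C₂ * m₂ v / jap v)) +
          ((C₂ * m₂ v) * (C₁ * m₁ v / jap v ^ 2) + (C₂ * m₂ v / jap v) * (C₁ * m₁ v / jap v)) := by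
          have := hf.bound v
          have := hg.bound v
          have := hf.bound_fderiv v
          have := hg.bound_fderiv v
          have := hf.bound_fderiv2 v
          have := hg.bound_fderiv2 v
          have := hf.nonneg v
          have := hg.nonneg v
          gcongr
      _ = 4 * (C₁ * C₂) * (m₁ v * m₂ v) / jap v ^ 2 := by
          field_simp
          ring

lemma mono (h : SymBound m₁ C₁ ψ) (hm : ∀ v, C₁ * m₁ v ≤ C₂ * m₂ v) : SymBound m₂ C₂ ψ where
  smooth := h.smooth
  bound v := (h.bound v).trans (hm v)
  bound_fderiv v := (h.bound_fderiv v).trans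
    (div_le_div_of_nonneg_right (hm v) (jap_pos v).le)
  bound_fderiv2 v := (h.bound_fderiv2 v).trans
    (div_le_div_of_nonneg_right (hm v) (by positivity))

/-- Radial symbols, from one-variable bounds in `s = ⟨v⟩²`. -/
lemma radial {Φ Φ₁ Φ₂ : ℝ → ℝ} (hsm : ∀ s, 0 < s → ContDiffAt ℝ ∞ Φ s)
    (h1 : ∀ s, 0 < s → HasDerivAt Φ (Φ₁ s) s) (h2 : ∀ s, 0 < s → HasDerivAt Φ₁ (Φ₂ s) s)
    (b0 : ∀ v : Vel d, |Φ (1 + ‖v‖ ^ 2)| ≤ C * m v)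
    (b1 : ∀ v : Vel d, (1 + ‖v‖ ^ 2) * |Φ₁ (1 + ‖v‖ ^ 2)| ≤ C * m v)
    (b2 : ∀ v : Vel d, (1 + ‖v‖ ^ 2) ^ 2 * |Φ₂ (1 + ‖v‖ ^ 2)| ≤ C * m v) :
    SymBound m (6 * C) (fun v => Φ (1 + ‖v‖ ^ 2)) := by
  have hs : ∀ v : Vel d, 0 < 1 + ‖v‖ ^ 2 := fun v => by positivity
  have hn : ∀ v : Vel d, HasFDerivAt (fun v : Vel d => 1 + ‖v‖ ^ 2) (2 • innerCLM d v) v := fun v =>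
    (hasStrictFDerivAt_norm_sq v).hasFDerivAt.const_add 1
  have d1 : ∀ v : Vel d, HasFDerivAt (fun v : Vel d => Φ (1 + ‖v‖ ^ 2))
      ((2 * Φ₁ (1 + ‖v‖ ^ 2)) • innerCLM d v) v := fun v => by
    convert! (h1 _ (hs v)).comp_hasFDerivAt v (hn v) using 1
    ext w
    simp
    ring
  have e1 : fderiv ℝ (fun v : Vel d => Φ (1 + ‖v‖ ^ 2)) =
      fun v => (2 * Φ₁ (1 + ‖v‖ ^ 2)) • innerCLM d v := funext fun v => (d1 v).fderiv
  have nn : ∀ v, 0 ≤ C * m v := fun v => (abs_nonneg _).trans (b0 v)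
  refine ⟨?_, fun v => ?_, fun v => ?_, fun v => ?_⟩
  · refine contDiff_iff_contDiffAt.mpr fun v => ?_
    exact (hsm _ (hs v)).comp v (contDiff_const.add (contDiff_norm_sq ℝ)).contDiffAt
  · linarith [b0 v, nn v]
  · rw [e1]
    have hj := jap_pos v
    rw [norm_smul, norm_innerCLM_apply, le_div_iff₀ hj, Real.norm_eq_abs, abs_mul, abs_two]
    have h3 := norm_le_jap v
    have h4 : ‖v‖ * jap v ≤ 1 + ‖v‖ ^ 2 := by rw [← jap_sq]; nlinarith
    calc 2 * |Φ₁ (1 + ‖v‖ ^ 2)| * ‖v‖ * jap v = 2 * ((‖v‖ * jap v) * |Φ₁ (1 + ‖v‖ ^ 2)|) := by ring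
      _ ≤ 2 * ((1 + ‖v‖ ^ 2) * |Φ₁ (1 + ‖v‖ ^ 2)|) := by gcongr
      _ ≤ _ := by linarith [b1 v, nn v]
  · rw [e1]
    have d2 : HasFDerivAt (fun v : Vel d => (2 * Φ₁ (1 + ‖v‖ ^ 2)) • innerCLM d v)
        ((2 * Φ₁ (1 + ‖v‖ ^ 2)) • innerCLM d +
          ((4 * Φ₂ (1 + ‖v‖ ^ 2)) • innerCLM d v).smulRight (innerCLM d v)) v := by
      have := ((h2 _ (hs v)).comp_hasFDerivAt v (hn v)).const_mul 2
      convert! this.smul (innerCLM d).hasFDerivAt (x := v) using 2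
      ext w x
      simp
      left
      ring
    rw [d2.fderiv, jap_sq, le_div_iff₀ (hs v)]
    have h3 : ‖innerCLM d‖ ≤ 1 := norm_innerCLM_le
    calc _ ≤ (2 * |Φ₁ (1 + ‖v‖ ^ 2)| * 1 + 4 * |Φ₂ (1 + ‖v‖ ^ 2)| * ‖v‖ * ‖v‖) * (1 + ‖v‖ ^ 2) := by
          gcongr
          refine (norm_smul_add_smulRight_le _ _ _ _).trans ?_
          rw [norm_smul, norm_innerCLM_apply, Real.norm_eq_abs, abs_mul, abs_mul, abs_two,
            abs_of_pos (by norm_num : (0 : ℝ) < 4)]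
          gcongr
      _ ≤ 2 * ((1 + ‖v‖ ^ 2) * |Φ₁ (1 + ‖v‖ ^ 2)|) +
          4 * ((1 + ‖v‖ ^ 2) ^ 2 * |Φ₂ (1 + ‖v‖ ^ 2)|) := by
          have : 0 ≤ |Φ₂ (1 + ‖v‖ ^ 2)| * (1 + ‖v‖ ^ 2) := by positivity
          nlinarith
      _ ≤ _ := by linarith [b1 v, b2 v]

lemma jap_rpow (p : ℝ) :
    SymBound (fun v : Vel d => jap v ^ p) (6 * ((1 + |p|) ^ 2)) (fun v => jap v ^ p) := by
  simp_rw [jap_eq_rpow]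
  have hs : ∀ v : Vel d, 0 < 1 + ‖v‖ ^ 2 := fun v => by positivity
  have hp : 0 ≤ |p| := abs_nonneg p
  refine radial (Φ := fun s => s ^ (p / 2)) (Φ₁ := fun s => p / 2 * s ^ (p / 2 - 1))
    (Φ₂ := fun s => p / 2 * ((p / 2 - 1) * s ^ (p / 2 - 1 - 1)))
    (fun s hs => Real.contDiffAt_rpow_const_of_ne hs.ne')
    (fun s hs => Real.hasDerivAt_rpow_const (Or.inl hs.ne'))
    (fun s hs => (Real.hasDerivAt_rpow_const (Or.inl hs.ne')).const_mul _)
    (fun v => ?_) (fun v => ?_) (fun v => ?_)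
  · rw [abs_of_pos (Real.rpow_pos_of_pos (hs v) _)]
    have := (Real.rpow_pos_of_pos (hs v) (p / 2)).le
    exact le_mul_of_one_le_left this (by nlinarith)
  · have := Real.rpow_pos_of_pos (hs v) (p / 2)
    rw [Real.rpow_sub_one (hs v).ne', abs_mul, abs_div, abs_div, abs_of_pos this,
      abs_of_pos (hs v), abs_two]
    have e : (1 + ‖v‖ ^ 2) * (|p| / 2 * ((1 + ‖v‖ ^ 2) ^ (p / 2) / (1 + ‖v‖ ^ 2)))
      = |p| / 2 * (1 + ‖v‖ ^ 2) ^ (p / 2) := by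
      have := (hs v).ne'
      field_simp
    rw [e]
    gcongr
    nlinarith
  · have := Real.rpow_pos_of_pos (hs v) (p / 2)
    rw [Real.rpow_sub_one (hs v).ne', Real.rpow_sub_one (hs v).ne', abs_mul, abs_mul, abs_div,
      abs_div, abs_div, abs_of_pos this, abs_of_pos (hs v), abs_two]
    have e : (1 + ‖v‖ ^ 2) ^ 2 * (|p| / 2 * (|p / 2 - 1| *
        ((1 + ‖v‖ ^ 2) ^ (p / 2) / (1 + ‖v‖ ^ 2) / (1 + ‖v‖ ^ 2))))
      = |p| / 2 * |p / 2 - 1| * (1 + ‖v‖ ^ 2) ^ (p / 2) := by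
      have := (hs v).ne'
      field_simp
    rw [e]
    have h2 : |p / 2 - 1| ≤ |p| / 2 + 1 := by
      refine (abs_sub _ _).trans ?_
      rw [abs_div, abs_two, abs_one]
    gcongr
    nlinarith [abs_nonneg (p / 2 - 1)]

lemma inner_left (ξ : Vel d) :
    SymBound (fun v : Vel d => ‖ξ‖ * jap v) 1 (fun v => inner ℝ v ξ) := by
  have e : (fun v : Vel d => (inner ℝ v ξ : ℝ)) = innerSL ℝ ξ := by
    ext v; simp [real_inner_comm]
  have e1 : fderiv ℝ (fun v : Vel d => (inner ℝ v ξ : ℝ)) = fun _ => innerSL ℝ ξ := by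
    rw [e]; ext1 v; exact (innerSL ℝ ξ).fderiv
  refine ⟨by rw [e]; exact (innerSL ℝ ξ).contDiff, fun v => ?_, fun v => ?_, fun v => ?_⟩
  · have := norm_le_jap v
    have h2 := abs_real_inner_le_norm v ξ
    nlinarith [norm_nonneg ξ]
  · rw [e1, innerSL_apply_norm, one_mul, mul_div_assoc, div_self (jap_pos v).ne', mul_one]
  · rw [e1]
    have := jap_pos v
    rw [show fderiv ℝ (fun _ : Vel d => innerSL ℝ ξ) v = 0 by simp, ContinuousLinearMap.opNorm_zero]
    positivity

end SymBound

section Phi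

lemma phi_denom_pos (β : ℝ) (ξ v : Vel d) : 0 < 1 + jap v ^ (2 * |1 + β|) * ‖ξ‖ ^ 2 := by
  have := jap_rpow_pos v (2 * |1 + β|)
  positivity

lemma phi_pos (β : ℝ) (ξ v : Vel d) : 0 < phi β ξ v :=
  div_pos (jap_rpow_pos v β) (phi_denom_pos β ξ v)

lemma phi_le (β : ℝ) (ξ v : Vel d) : phi β ξ v ≤ jap v ^ β := by
  refine div_le_self (jap_rpow_pos v β).le ?_
  have := jap_rpow_pos v (2 * |1 + β|)
  nlinarith [sq_nonneg ‖ξ‖, mul_nonneg this.le (sq_nonneg ‖ξ‖)]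

lemma phi_neg (β : ℝ) (ξ v : Vel d) : phi β ξ (-v) = phi β ξ v := by simp [phi, jap_neg]

lemma continuous_phi (β : ℝ) (ξ : Vel d) : Continuous (phi β ξ) :=
  (continuous_jap_rpow β).div₀ (continuous_const.add
    ((continuous_jap_rpow _).mul continuous_const)) fun v => (phi_denom_pos β ξ v).ne'

/-- `|ξ|² ⟨v⟩² φ ≤ ⟨v⟩^{-β}`. -/
lemma norm_sq_mul_phi_le (β : ℝ) (ξ v : Vel d) :
    ‖ξ‖ ^ 2 * jap v ^ (2 : ℝ) * phi β ξ v ≤ jap v ^ (-β) := by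
  have hD := phi_denom_pos β ξ v
  rw [phi, ← mul_div_assoc, div_le_iff₀ hD]
  have h1 : jap v ^ (2 : ℝ) * jap v ^ β ≤ jap v ^ (-β) * jap v ^ (2 * |1 + β|) := by
    rw [← Real.rpow_add (jap_pos v), ← Real.rpow_add (jap_pos v)]
    refine jap_rpow_mono v ?_
    have := le_abs_self (1 + β)
    linarith
  have := jap_rpow_pos v (-β)
  nlinarith [sq_nonneg ‖ξ‖]

/-- `|ξ| ⟨v⟩ φ ≤ 1`. -/
lemma norm_mul_phi_le_one (β : ℝ) (ξ v : Vel d) : ‖ξ‖ * jap v * phi β ξ v ≤ 1 := by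
  have h1 := norm_sq_mul_phi_le β ξ v
  have h2 := phi_le β ξ v
  have h3 := phi_pos β ξ v
  have h4 := jap_pos v
  rw [Real.rpow_two] at h1
  have h5 : (‖ξ‖ * jap v * phi β ξ v) ^ 2 ≤ 1 := by
    calc (‖ξ‖ * jap v * phi β ξ v) ^ 2 = (‖ξ‖ ^ 2 * jap v ^ 2 * phi β ξ v) * phi β ξ v := by ring
      _ ≤ jap v ^ (-β) * jap v ^ β := by gcongr
      _ = 1 := by rw [← Real.rpow_add h4]; simp
  exact (abs_le_one_iff_mul_self_le_one.mpr (by rw [← sq]; exact h5) |> (le_abs_self _).trans)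

/-- `|ξ|² ⟨v⟩ φ ≤ 1`. -/
lemma norm_sq_mul_jap_mul_phi_le_one (β : ℝ) (ξ v : Vel d) :
    ‖ξ‖ ^ 2 * jap v * phi β ξ v ≤ 1 := by
  have hD := phi_denom_pos β ξ v
  rw [phi, ← mul_div_assoc, div_le_iff₀ hD, one_mul]
  have h1 : jap v * jap v ^ β ≤ jap v ^ (2 * |1 + β|) := by
    calc jap v * jap v ^ β = jap v ^ (1 + β) := by rw [Real.rpow_add (jap_pos v), Real.rpow_one]
      _ ≤ _ := jap_rpow_mono v (by linarith [le_abs_self (1 + β), abs_nonneg (1 + β)])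
  nlinarith [sq_nonneg ‖ξ‖]

lemma SymBound.phi (β : ℝ) (ξ : Vel d) :
    SymBound (phi β ξ) (6 * (10 * (1 + |β|) ^ 2)) (phi β ξ) := by
  set p : ℝ := |1 + β| with hp
  set e : ℝ := ‖ξ‖ ^ 2 with he
  have hp0 : 0 ≤ p := abs_nonneg _
  have he0 : 0 ≤ e := sq_nonneg _
  set X : ℝ → ℝ := fun s => s ^ p * e with hX
  set Q : ℝ → ℝ := fun s => β / 2 - p * (X s / (1 + X s)) with hQ
  set r : ℝ → ℝ := fun s => -(p ^ 2 * (X s / (1 + X s) ^ 2)) with hr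
  set Φ : ℝ → ℝ := fun s => s ^ (β / 2) / (1 + X s) with hΦ
  have X0 : ∀ s, 0 < s → 0 ≤ X s := fun s hs => by positivity
  have dX : ∀ s, 0 < s → HasDerivAt X (p * X s / s) s := fun s hs => by
    have := (Real.hasDerivAt_rpow_const (x := s) (p := p) (Or.inl hs.ne')).mul_const e
    convert! this using 1
    rw [Real.rpow_sub_one hs.ne']
    simp only [hX]
    ring
  have dΦ : ∀ s, 0 < s → HasDerivAt Φ (Φ s * Q s / s) s := fun s hs => by
    have h1 : 1 + X s ≠ 0 := by have := X0 s hs; positivity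
    have := (Real.hasDerivAt_rpow_const (x := s) (p := β / 2) (Or.inl hs.ne')).div
      ((dX s hs).const_add 1) h1
    convert! this using 1
    rw [Real.rpow_sub_one hs.ne']
    simp only [hΦ, hQ]
    field_simp
  have dQ : ∀ s, 0 < s → HasDerivAt Q (r s / s) s := fun s hs => by
    have h1 : 1 + X s ≠ 0 := by have := X0 s hs; positivity
    have := (((dX s hs).div ((dX s hs).const_add 1) h1).const_mul p).const_sub (β / 2)
    convert! this using 1
    simp only [hr]
    field_simp
    ring
  have dΦ₁ : ∀ s, 0 < s → HasDerivAt (fun s => Φ s * Q s / s)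
      (Φ s / s ^ 2 * (Q s ^ 2 - Q s + r s)) s := fun s hs => by
    have := ((dΦ s hs).mul (dQ s hs)).div (hasDerivAt_id s) hs.ne'
    convert! this using 1
    simp only [id, Pi.mul_apply]
    field_simp
    ring
  have ephi : FracHypo.phi β ξ = fun v => Φ (1 + ‖v‖ ^ 2) := by
    ext v
    simp only [FracHypo.phi, hΦ, hX, jap_eq_rpow, ← hp, ← he]
    congr 5
    ring
  have hB : 0 ≤ |β| := abs_nonneg β
  have pB : p ≤ 1 + |β| := (abs_add_le 1 β).trans (by rw [abs_one])
  have frac1 : ∀ s, 0 < s → 0 ≤ X s / (1 + X s) ∧ X s / (1 + X s) ≤ 1 := fun s hs => by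
    have := X0 s hs
    exact ⟨by positivity, (div_le_one (by positivity)).mpr (by linarith)⟩
  have frac2 : ∀ s, 0 < s → 0 ≤ X s / (1 + X s) ^ 2 ∧ X s / (1 + X s) ^ 2 ≤ 1 := fun s hs => by
    have := X0 s hs
    exact ⟨by positivity, (div_le_one (by positivity)).mpr (by nlinarith)⟩
  have bQ : ∀ s, 0 < s → |Q s| ≤ 3 / 2 * (1 + |β|) := fun s hs => by
    obtain ⟨h1, h2⟩ := frac1 s hs
    refine (abs_sub _ _).trans ?_
    rw [abs_div, abs_two, abs_of_nonneg (mul_nonneg hp0 h1)]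
    nlinarith
  have br : ∀ s, 0 < s → |r s| ≤ (1 + |β|) ^ 2 := fun s hs => by
    obtain ⟨h1, h2⟩ := frac2 s hs
    simp only [hr]
    rw [abs_neg, abs_of_nonneg (by positivity)]
    have : p ^ 2 ≤ (1 + |β|) ^ 2 := by gcongr
    nlinarith [sq_nonneg p]
  have pos : ∀ s, 0 < s → 0 < Φ s := fun s hs => by
    have := X0 s hs
    exact div_pos (Real.rpow_pos_of_pos hs _) (by positivity)
  have hs : ∀ v : Vel d, 0 < 1 + ‖v‖ ^ 2 := fun v => by positivity
  rw [ephi]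
  refine SymBound.radial (m := fun v => Φ (1 + ‖v‖ ^ 2)) (fun s hs => ?_) dΦ dΦ₁
    (fun v => ?_) (fun v => ?_) (fun v => ?_)
  · have h1 : 1 + X s ≠ 0 := by have := X0 s hs; positivity
    exact (Real.contDiffAt_rpow_const_of_ne hs.ne').div (contDiffAt_const.add
      ((Real.contDiffAt_rpow_const_of_ne hs.ne').mul contDiffAt_const)) h1
  · rw [abs_of_pos (pos _ (hs v))]
    exact le_mul_of_one_le_left (pos _ (hs v)).le (by nlinarith)
  · have h1 := bQ _ (hs v)
    have h2 := pos _ (hs v)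
    have h3 := hs v
    set s := 1 + ‖v‖ ^ 2
    rw [abs_div, abs_mul, abs_of_pos h2, abs_of_pos h3, mul_div_cancel₀ _ h3.ne', mul_comm]
    gcongr
    nlinarith
  · have h1 := bQ _ (hs v)
    have h2 := pos _ (hs v)
    have h4 := br _ (hs v)
    have h3 := hs v
    set s := 1 + ‖v‖ ^ 2
    rw [abs_mul, abs_div, abs_of_pos h2, abs_of_pos (by positivity : 0 < s ^ 2), ← mul_assoc,
      mul_div_cancel₀ _ (by positivity), mul_comm]
    gcongr
    have h5 : |Q s ^ 2 - Q s + r s| ≤ |Q s| ^ 2 + |Q s| + |r s| := by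
      refine (abs_add_le _ _).trans ?_
      gcongr
      refine (abs_sub _ _).trans ?_
      rw [abs_pow]
    have h6 : |Q s| ^ 2 ≤ (3 / 2 * (1 + |β|)) ^ 2 := by gcongr
    nlinarith

lemma Envelope.phi_symbol (β : ℝ) (ξ : Vel d) :
    Envelope (fun v => ‖ξ‖ * jap v * phi β ξ v) (2 * 2 ^ |β| * 2 ^ |2 * abs (1 + β)|) where
  continuous := (continuous_const.mul continuous_jap).mul (continuous_phi β ξ)
  nonneg v := by have := phi_pos β ξ v; have := jap_pos v; positivity
  le v := by
    refine (norm_mul_phi_le_one β ξ v).trans ?_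
    have h1 : (1 : ℝ) ≤ 2 ^ |β| := Real.one_le_rpow (by norm_num) (abs_nonneg _)
    have h2 : (1 : ℝ) ≤ 2 ^ |2 * abs (1 + β)| := Real.one_le_rpow (by norm_num) (abs_nonneg _)
    nlinarith
  slow v h hh := by
    have hv := jap_pos v
    have hw := jap_pos (v + h)
    have h1 := jap_add_le_two_mul hh
    have h2 := jap_le_two_mul_add hh
    have h3 := rpow_le_of_comparable hw hv h1 h2 β
    have h4 := rpow_le_of_comparable hv hw h2 h1 (2 * |1 + β|)
    have hc : (1 : ℝ) ≤ 2 ^ |2 * abs (1 + β)| := Real.one_le_rpow (by norm_num) (abs_nonneg _)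
    have h5 : 1 + jap v ^ (2 * |1 + β|) * ‖ξ‖ ^ 2 ≤
        2 ^ |2 * abs (1 + β)| * (1 + jap (v + h) ^ (2 * |1 + β|) * ‖ξ‖ ^ 2) := by
      nlinarith [sq_nonneg ‖ξ‖]
    have h6 : FracHypo.phi β ξ (v + h) ≤ 2 ^ |β| * 2 ^ |2 * abs (1 + β)| * FracHypo.phi β ξ v := by
      have hD := phi_denom_pos β ξ v
      have hD' := phi_denom_pos β ξ (v + h)
      have hb := jap_rpow_pos v β
      rw [FracHypo.phi, FracHypo.phi, ← mul_div_assoc, div_le_div_iff₀ hD' hD]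
      calc _ ≤ (2 ^ |β| * jap v ^ β) *
            (2 ^ |2 * abs (1 + β)| * (1 + jap (v + h) ^ (2 * |1 + β|) * ‖ξ‖ ^ 2)) := by gcongr
        _ = _ := by ring
    have := phi_pos β ξ (v + h)
    calc _ ≤ ‖ξ‖ * (2 * jap v) * (2 ^ |β| * 2 ^ |2 * abs (1 + β)| * FracHypo.phi β ξ v) := by gcongr
      _ = _ := by ring

lemma Envelope.jap_rpow {p : ℝ} (hp : p ≤ 0) :
    Envelope (fun v : Vel d => jap v ^ p) (2 ^ |p|) where
  continuous := continuous_jap_rpow p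
  nonneg v := (jap_rpow_pos v p).le
  le v := (jap_rpow_le_one v hp).trans (Real.one_le_rpow (by norm_num) (abs_nonneg _))
  slow v h hh := rpow_le_of_comparable (jap_pos _) (jap_pos _) (jap_add_le_two_mul hh)
    (jap_le_two_mul_add hh) p

end Phi

section Cutoff

/-- A smooth function on `ℝ`, equal to `1` on `(-∞, 1]` and to `0` on `[2, ∞)`. -/
def step (x : ℝ) : ℝ := Real.smoothTransition (2 - x)

lemma contDiff_step : ContDiff ℝ ∞ step := Real.smoothTransition.contDiff.comp (by fun_prop)

lemma step_eq_one {x : ℝ} (hx : x ≤ 1) : step x = 1 :=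
  Real.smoothTransition.one_of_one_le (by linarith)

lemma step_eq_zero {x : ℝ} (hx : 2 ≤ x) : step x = 0 :=
  Real.smoothTransition.zero_of_nonpos (by linarith)

lemma step_nonneg (x : ℝ) : 0 ≤ step x := Real.smoothTransition.nonneg _

lemma step_le_one (x : ℝ) : step x ≤ 1 := Real.smoothTransition.le_one _

/-- Radial smooth cutoff at scale `R`. -/
def cutoff (R : ℝ) (v : Vel d) : ℝ := step ((1 + ‖v‖ ^ 2) / R ^ 2)

lemma cutoff_nonneg (R : ℝ) (v : Vel d) : 0 ≤ cutoff R v := step_nonneg _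

lemma cutoff_le_one (R : ℝ) (v : Vel d) : cutoff R v ≤ 1 := step_le_one _

lemma cutoff_eq_one {R : ℝ} (hR : 0 < R) {v : Vel d} (h : jap v ≤ R) : cutoff R v = 1 := by
  refine step_eq_one ?_
  rw [← jap_sq, div_le_one (by positivity)]
  have := jap_pos v
  gcongr

lemma cutoff_eq_zero {R : ℝ} (hR : 0 < R) {v : Vel d} (h : 2 * R ≤ jap v) : cutoff R v = 0 := by
  refine step_eq_zero ?_
  rw [← jap_sq, le_div_iff₀ (by positivity)]
  have := jap_pos v
  nlinarith

lemma contDiff_cutoff (R : ℝ) : ContDiff ℝ ∞ (cutoff R : Vel d → ℝ) :=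
  contDiff_step.comp ((contDiff_const.add (contDiff_norm_sq ℝ)).div_const _)

lemma hasCompactSupport_cutoff {R : ℝ} (hR : 0 < R) :
    HasCompactSupport (cutoff R : Vel d → ℝ) := by
  refine HasCompactSupport.intro (isCompact_closedBall 0 (2 * R)) fun v hv => ?_
  refine cutoff_eq_zero hR ?_
  rw [mem_closedBall_zero_iff, not_le] at hv
  exact hv.le.trans (norm_le_jap v)

lemma isTest_cutoff_mul {R : ℝ} (hR : 0 < R) {ψ : Vel d → ℝ} (h : ContDiff ℝ ∞ ψ) :
    IsTest (fun v => cutoff R v * ψ v) :=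
  ⟨(contDiff_cutoff R).mul h, (hasCompactSupport_cutoff hR).mul_right⟩

lemma exists_bound_step_derivs :
    ∃ C : ℝ, 1 ≤ C ∧ (∀ x, 0 ≤ x → x * |deriv step x| ≤ C) ∧
      ∀ x, 0 ≤ x → x ^ 2 * |deriv (deriv step) x| ≤ C := by
  have c1 : ContDiff ℝ ∞ (deriv step) := (contDiff_infty_iff_deriv.mp contDiff_step).2
  have c2 : ContDiff ℝ ∞ (deriv (deriv step)) := (contDiff_infty_iff_deriv.mp c1).2
  have z0 : ∀ x : ℝ, 2 < x → step =ᶠ[𝓝 x] fun _ => 0 := fun x hx => by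
    filter_upwards [lt_mem_nhds hx] with y hy using step_eq_zero hy.le
  have z1 : ∀ x : ℝ, 2 < x → deriv step x = 0 := fun x hx => by
    rw [(z0 x hx).deriv_eq]; simp
  have z2 : ∀ x : ℝ, 2 < x → deriv (deriv step) x = 0 := fun x hx => by
    rw [(z0 x hx).deriv.deriv_eq]; simp
  obtain ⟨C₁, h1⟩ := (isCompact_Icc (a := (0 : ℝ)) (b := 2)).exists_bound_of_continuousOn
    (f := fun x => x * |deriv step x|) (by have := c1.continuous; fun_prop)
  obtain ⟨C₂, h2⟩ := (isCompact_Icc (a := (0 : ℝ)) (b := 2)).exists_bound_of_continuousOn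
    (f := fun x => x ^ 2 * |deriv (deriv step) x|) (by have := c2.continuous; fun_prop)
  refine ⟨max 1 (max C₁ C₂), le_max_left _ _, fun x hx => ?_, fun x hx => ?_⟩
  · rcases le_or_gt x 2 with h | h
    · exact (le_abs_self _).trans ((h1 x ⟨hx, h⟩).trans
        ((le_max_left _ _).trans (le_max_right _ _)))
    · rw [z1 x h]; simp
  · rcases le_or_gt x 2 with h | h
    · exact (le_abs_self _).trans ((h2 x ⟨hx, h⟩).trans
        ((le_max_right _ _).trans (le_max_right _ _)))
    · rw [z2 x h]; simp

lemma exists_symBound_cutoff (d : ℕ) : ∃ C : ℝ, 0 < C ∧ ∀ R : ℝ, 0 < R →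
    SymBound (fun _ : Vel d => 1) C (cutoff R) := by
  obtain ⟨C, hC, h1, h2⟩ := exists_bound_step_derivs
  have c1 : ContDiff ℝ ∞ (deriv step) := (contDiff_infty_iff_deriv.mp contDiff_step).2
  have hd0 : ∀ x, HasDerivAt step (deriv step x) x := fun x =>
    (contDiff_step.differentiable (by simp) x).hasDerivAt
  have hd1 : ∀ x, HasDerivAt (deriv step) (deriv (deriv step) x) x := fun x =>
    (c1.differentiable (by simp) x).hasDerivAt
  refine ⟨6 * C, by positivity, fun R hR => ?_⟩
  have hdiv : ∀ s : ℝ, HasDerivAt (fun s => s / R ^ 2) (1 / R ^ 2) s := fun s =>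
    (hasDerivAt_id s).div_const _
  refine SymBound.radial (Φ := fun s => step (s / R ^ 2))
    (Φ₁ := fun s => deriv step (s / R ^ 2) * (1 / R ^ 2))
    (Φ₂ := fun s => deriv (deriv step) (s / R ^ 2) * (1 / R ^ 2) * (1 / R ^ 2))
    (fun s _ => (contDiff_step.comp (contDiff_id.div_const _)).contDiffAt)
    (fun s _ => (hd0 _).comp s (hdiv s)) (fun s _ => ((hd1 _).comp s (hdiv s)).mul_const _)
    (fun v => ?_) (fun v => ?_) (fun v => ?_)
  · rw [abs_of_nonneg (step_nonneg _), mul_one]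
    exact (step_le_one _).trans hC
  · have := h1 ((1 + ‖v‖ ^ 2) / R ^ 2) (by positivity)
    rw [abs_mul, abs_of_pos (by positivity : (0 : ℝ) < 1 / R ^ 2), mul_one]
    calc _ = _ := by ring
      _ ≤ C := this
  · have := h2 ((1 + ‖v‖ ^ 2) / R ^ 2) (by positivity)
    rw [abs_mul, abs_mul, abs_of_pos (by positivity : (0 : ℝ) < 1 / R ^ 2), mul_one]
    calc _ = _ := by ring
      _ ≤ C := this

end Cutoff

end Symbols

section SecondDifference

variable {d : ℕ}

/-- The symmetric second difference. -/
def secDiff (u : Vel d → ℝ) (v h : Vel d) : ℝ := u (v + h) + u (v - h) - 2 * u v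

lemma fracLap_eq (σ : ℝ) (u : Vel d → ℝ) (v : Vel d) :
    fracLap σ u v = cFrac d σ / 2 * ∫ h : Vel d, secDiff u v h / ‖h‖ ^ ((d : ℝ) + σ) := rfl

lemma enorm_secDiff_div (σ : ℝ) (u : Vel d → ℝ) (v h : Vel d) :
    ‖secDiff u v h / ‖h‖ ^ ((d : ℝ) + σ)‖ₑ = ‖secDiff u v h‖ₑ * fracKer σ h := by
  rw [div_eq_mul_one_div, enorm_mul, fracKer, Real.enorm_of_nonneg (r := 1 / _) (by positivity)]

lemma abs_secDiff_le {u : Vel d → ℝ} (hu : ContDiff ℝ ∞ u) {v h : Vel d} {K : ℝ}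
    (hK : ∀ k, ‖k‖ ≤ ‖h‖ → ‖fderiv ℝ (fderiv ℝ u) (v + k)‖ ≤ K) :
    |secDiff u v h| ≤ K * ‖h‖ ^ 2 := by
  have d1 : Differentiable ℝ u := hu.differentiable (by simp)
  have d2 : Differentiable ℝ (fderiv ℝ u) :=
    (hu.fderiv_right (m := ∞) (by simp)).differentiable (by simp)
  have hball : ∀ x ∈ Metric.closedBall v ‖h‖, ‖fderiv ℝ (fderiv ℝ u) x‖ ≤ K := fun x hx => by
    simpa using hK (x - v) (by simpa [dist_eq_norm] using hx)
  have hlip : ∀ x ∈ Metric.closedBall v ‖h‖, ∀ y ∈ Metric.closedBall v ‖h‖,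
      ‖fderiv ℝ u y - fderiv ℝ u x‖ ≤ K * ‖y - x‖ := fun x hx y hy =>
    (convex_closedBall v ‖h‖).norm_image_sub_le_of_norm_fderiv_le (fun z _ => d2 z) hball hx hy
  set k : Vel d → ℝ := fun x => u (x + h) - u x with hk
  have dk : ∀ x, HasFDerivAt k (fderiv ℝ u (x + h) - fderiv ℝ u x) x := fun x =>
    ((hasFDerivAt_comp_add_right h).mpr (d1 (x + h)).hasFDerivAt).sub (d1 x).hasFDerivAt
  have hseg : ∀ x ∈ segment ℝ (v - h) v, ‖fderiv ℝ u (x + h) - fderiv ℝ u x‖ ≤ K * ‖h‖ := by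
    intro x hx
    obtain ⟨t, ht, rfl⟩ := (segment_eq_image_lineMap ℝ (v - h) v ▸ hx :
      x ∈ AffineMap.lineMap (v - h) v '' Icc (0 : ℝ) 1)
    have e1 : AffineMap.lineMap (v - h) v t - v = (t - 1) • h := by
      rw [AffineMap.lineMap_apply_module']
      module
    have e2 : AffineMap.lineMap (v - h) v t + h - v = t • h := by
      rw [AffineMap.lineMap_apply_module']
      module
    have := hlip (AffineMap.lineMap (v - h) v t) (by
      rw [mem_closedBall_iff_norm, e1, norm_smul, Real.norm_eq_abs]
      exact mul_le_of_le_one_left (norm_nonneg h) (abs_le.mpr ⟨by linarith [ht.1], by linarith [ht.2]⟩))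
      (AffineMap.lineMap (v - h) v t + h) (by
      rw [mem_closedBall_iff_norm, e2, norm_smul, Real.norm_eq_abs]
      exact mul_le_of_le_one_left (norm_nonneg h) (abs_le.mpr ⟨by linarith [ht.1], by linarith [ht.2]⟩))
    simpa using this
  have hfin := (convex_segment (𝕜 := ℝ) (v - h) v).norm_image_sub_le_of_norm_hasFDerivWithin_le
    (fun x _ => (dk x).hasFDerivWithinAt) hseg (left_mem_segment ℝ _ _) (right_mem_segment ℝ _ _)
  have e3 : k v - k (v - h) = secDiff u v h := by simp only [hk, secDiff, sub_add_cancel]; ring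
  rw [e3, sub_sub_cancel, Real.norm_eq_abs] at hfin
  linarith [hfin, sq ‖h‖, mul_assoc K ‖h‖ ‖h‖, congrArg (K * ·) (sq ‖h‖)]

lemma measurableSet_far (R : ℝ) : MeasurableSet {h : Vel d | R ≤ ‖h‖} :=
  measurableSet_le measurable_const measurable_norm

lemma compl_far (R : ℝ) : {h : Vel d | R ≤ ‖h‖}ᶜ = {h : Vel d | ‖h‖ < R} := by
  ext; simp

/-- Constants of the near and far integrals of the kernel `|h|^{-d-σ}`. -/
lemma exists_fracKer_const (hd : 1 ≤ d) {σ : ℝ} (h0 : 0 < σ) (h2 : σ < 2) :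
    ∃ C : ℝ, 0 < C ∧ ∀ R : ℝ, 0 < R →
      ∫⁻ h in {h : Vel d | R ≤ ‖h‖}, fracKer σ h ≤ ENNReal.ofReal (C * R ^ (-σ)) ∧
      ∫⁻ h in {h : Vel d | ‖h‖ < R}, ENNReal.ofReal (‖h‖ ^ 2) * fracKer σ h
        ≤ ENNReal.ofReal (C * R ^ (2 - σ)) := by
  obtain ⟨C₁, p1, b1⟩ := exists_lintegral_fracKer_far (d := d) h0
  obtain ⟨C₂, p2, b2⟩ := exists_lintegral_fracKer_near hd h2
  refine ⟨max C₁ C₂, lt_max_of_lt_left p1, fun R hR => ⟨(b1 R hR).trans ?_, (b2 R hR).trans ?_⟩⟩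
  · gcongr; exact le_max_left _ _
  · gcongr; exact le_max_right _ _

lemma lintegral_secDiff_near_le {σ C R K : ℝ} {u : Vel d → ℝ} (hu : ContDiff ℝ ∞ u) {v : Vel d}
    (hC : ∫⁻ h in {h : Vel d | ‖h‖ < R}, ENNReal.ofReal (‖h‖ ^ 2) * fracKer σ h
        ≤ ENNReal.ofReal (C * R ^ (2 - σ))) (hK0 : 0 ≤ K)
    (hK : ∀ k, ‖k‖ ≤ R → ‖fderiv ℝ (fderiv ℝ u) (v + k)‖ ≤ K) :
    ∫⁻ h in {h : Vel d | ‖h‖ < R}, ‖secDiff u v h‖ₑ * fracKer σ h ≤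
      ENNReal.ofReal (K * (C * R ^ (2 - σ))) := by
  calc _ ≤ ∫⁻ h in {h : Vel d | ‖h‖ < R}, ENNReal.ofReal K *
        (ENNReal.ofReal (‖h‖ ^ 2) * fracKer σ h) := by
        refine setLIntegral_mono' (measurableSet_lt measurable_norm measurable_const)
          fun h (hh : ‖h‖ < R) => ?_
        rw [← mul_assoc, ← ENNReal.ofReal_mul hK0]
        gcongr
        rw [Real.enorm_eq_ofReal_abs]
        exact ENNReal.ofReal_le_ofReal (abs_secDiff_le hu fun k hk => hK k (hk.trans hh.le))
    _ ≤ _ := by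
        rw [lintegral_const_mul _ (by fun_prop), ENNReal.ofReal_mul hK0]
        gcongr

lemma lintegral_secDiff_far_le {σ C R K : ℝ} {u : Vel d → ℝ} {v : Vel d}
    (hC : ∫⁻ h in {h : Vel d | R ≤ ‖h‖}, fracKer σ h ≤ ENNReal.ofReal (C * R ^ (-σ)))
    (hK0 : 0 ≤ K) (hK : ∀ v, |u v| ≤ K) :
    ∫⁻ h in {h : Vel d | R ≤ ‖h‖}, ‖secDiff u v h‖ₑ * fracKer σ h ≤
      ENNReal.ofReal (4 * K * (C * R ^ (-σ))) := by
  calc _ ≤ ∫⁻ h in {h : Vel d | R ≤ ‖h‖}, ENNReal.ofReal (4 * K) * fracKer σ h := by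
        refine lintegral_mono fun h => ?_
        gcongr
        rw [Real.enorm_eq_ofReal_abs]
        refine ENNReal.ofReal_le_ofReal ?_
        have h1 := abs_le.mp (hK (v + h))
        have h2 := abs_le.mp (hK (v - h))
        have h3 := abs_le.mp (hK v)
        rw [secDiff, abs_le]
        constructor <;> linarith
    _ ≤ _ := by
        rw [lintegral_const_mul _ (by fun_prop), ENNReal.ofReal_mul (p := 4 * K) (by positivity)]
        exact mul_le_mul' le_rfl hC

/-- The uniform bound on the integrals defining the fractional Laplacian of a bounded function
with bounded second derivatives. -/
lemma lintegral_secDiff_le {σ C R K₀ K₂ : ℝ} {u : Vel d → ℝ} (hu : ContDiff ℝ ∞ u)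
    (hfar : ∫⁻ h in {h : Vel d | R ≤ ‖h‖}, fracKer σ h ≤ ENNReal.ofReal (C * R ^ (-σ)))
    (hnear : ∫⁻ h in {h : Vel d | ‖h‖ < R}, ENNReal.ofReal (‖h‖ ^ 2) * fracKer σ h
        ≤ ENNReal.ofReal (C * R ^ (2 - σ)))
    (hC : 0 ≤ C) (hR : 0 < R) (hK0 : 0 ≤ K₀) (hK2 : 0 ≤ K₂)
    (hb0 : ∀ v, |u v| ≤ K₀) (hb2 : ∀ v, ‖fderiv ℝ (fderiv ℝ u) v‖ ≤ K₂) (v : Vel d) :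
    ∫⁻ h, ‖secDiff u v h‖ₑ * fracKer σ h ≤
      ENNReal.ofReal (K₂ * (C * R ^ (2 - σ)) + 4 * K₀ * (C * R ^ (-σ))) := by
  rw [← lintegral_add_compl _ (measurableSet_far R), compl_far, add_comm,
    ENNReal.ofReal_add (by positivity) (by positivity)]
  exact add_le_add (lintegral_secDiff_near_le hu hnear hK2 fun k _ => hb2 _)
    (lintegral_secDiff_far_le hfar hK0 hb0)

lemma continuous_secDiff {u : Vel d → ℝ} (hu : Continuous u) :
    Continuous (fun p : Vel d × Vel d => secDiff u p.1 p.2) := by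
  unfold secDiff
  fun_prop

lemma measurable_secDiff_div (σ : ℝ) {u : Vel d → ℝ} (hu : Continuous u) :
    Measurable (fun p : Vel d × Vel d => secDiff u p.1 p.2 / ‖p.2‖ ^ ((d : ℝ) + σ)) :=
  (continuous_secDiff hu).measurable.div (by fun_prop)

lemma measurable_fracLap (σ : ℝ) {u : Vel d → ℝ} (hu : Continuous u) :
    Measurable (fracLap σ u) := by
  have := (measurable_secDiff_div σ hu).stronglyMeasurable.integral_prod_right' (ν := volume)
  exact (this.measurable.const_mul (cFrac d σ / 2))

lemma enorm_fracLap_le (σ : ℝ) (u : Vel d → ℝ) (v : Vel d) :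
    ‖fracLap σ u v‖ₑ ≤ ‖cFrac d σ / 2‖ₑ * ∫⁻ h, ‖secDiff u v h‖ₑ * fracKer σ h := by
  rw [fracLap_eq, enorm_mul]
  gcongr
  refine (enorm_integral_le_lintegral_enorm _).trans (le_of_eq ?_)
  simp_rw [enorm_secDiff_div]

/-- A bounded function with bounded second derivatives. -/
structure BddC2 (u : Vel d → ℝ) : Prop where
  smooth : ContDiff ℝ ∞ u
  bound : ∃ K, ∀ v, |u v| ≤ K
  bound2 : ∃ K, ∀ v, ‖fderiv ℝ (fderiv ℝ u) v‖ ≤ K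

lemma BddC2.lintegral_le (hd : 1 ≤ d) {σ : ℝ} (h0 : 0 < σ) (h2 : σ < 2) {u : Vel d → ℝ}
    (hu : BddC2 u) : ∃ K : ℝ, ∀ v, ∫⁻ h, ‖secDiff u v h‖ₑ * fracKer σ h ≤ ENNReal.ofReal K := by
  obtain ⟨C, hC, hb⟩ := exists_fracKer_const hd h0 h2
  obtain ⟨K, hK⟩ := hu.bound
  obtain ⟨K', hK'⟩ := hu.bound2
  exact ⟨_, lintegral_secDiff_le hu.smooth (hb 1 one_pos).1 (hb 1 one_pos).2 hC.le one_pos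
    ((abs_nonneg _).trans (hK 0)) ((norm_nonneg (fderiv ℝ (fderiv ℝ u) 0)).trans (hK' 0)) hK hK'⟩

lemma continuous_norm_of_contDiff {E : Type*} [NormedAddCommGroup E] [NormedSpace ℝ E]
    {f : Vel d → E} (h : ContDiff ℝ ∞ f) : Continuous fun v => ‖f v‖ := h.continuous.norm

lemma IsTest.bddC2 {ζ : Vel d → ℝ} (h : IsTest ζ) : BddC2 ζ := by
  obtain ⟨h1, h2⟩ := h
  have c1 : ContDiff ℝ ∞ (fderiv ℝ ζ) := h1.fderiv_right (by simp)
  have c2 : ContDiff ℝ ∞ (fderiv ℝ (fderiv ℝ ζ)) := c1.fderiv_right (by simp)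
  refine ⟨h1, ?_, ?_⟩
  · obtain ⟨K, hK⟩ := h2.exists_bound_of_continuous h1.continuous
    exact ⟨K, hK⟩
  · obtain ⟨K, hK⟩ := IsCompact.exists_bound_of_continuousOn h2
      (f := fun v => ‖fderiv ℝ (fderiv ℝ ζ) v‖) (continuous_norm_of_contDiff c2).continuousOn
    refine ⟨max K 0, fun v => ?_⟩
    by_cases hv : v ∈ tsupport ζ
    · exact ((le_abs_self _).trans (hK v hv)).trans (le_max_left _ _)
    · have h3 : fderiv ℝ (fderiv ℝ ζ) v = 0 := by
        rw [((notMem_tsupport_iff_eventuallyEq.mp hv).fderiv (𝕜 := ℝ)).fderiv_eq]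
        simp
      rw [h3]
      exact (ContinuousLinearMap.opNorm_zero (E := Vel d)).le.trans (le_max_right _ _)

lemma BddC2.fracLap_bounded (hd : 1 ≤ d) {σ : ℝ} (h0 : 0 < σ) (h2 : σ < 2) {u : Vel d → ℝ}
    (hu : BddC2 u) : ∃ K : ℝ, ∀ v, |fracLap σ u v| ≤ K := by
  obtain ⟨K, hK⟩ := hu.lintegral_le hd h0 h2
  refine ⟨|cFrac d σ / 2| * max K 0, fun v => ?_⟩
  have h := (enorm_fracLap_le σ u v).trans (mul_le_mul_right (hK v) _)
  rw [Real.enorm_eq_ofReal_abs, Real.enorm_eq_ofReal_abs,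
    ← ENNReal.ofReal_mul (abs_nonneg _), ENNReal.ofReal_le_ofReal_iff'] at h
  rcases h with h | h
  · exact h.trans (by gcongr; exact le_max_left _ _)
  · exact h.trans (by positivity)

/-- The fractional Laplacian is symmetric. -/
lemma integral_fracLap_mul (hd : 1 ≤ d) {σ : ℝ} (h0 : 0 < σ) (h2 : σ < 2) {u w : Vel d → ℝ}
    (hu : BddC2 u) (hw : BddC2 w) (hui : Integrable u) (hwi : Integrable w) :
    ∫ v, fracLap σ u v * w v = ∫ v, u v * fracLap σ w v := by
  have key : ∀ {f g : Vel d → ℝ}, BddC2 f → BddC2 g → Integrable g →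
      Integrable (fun p : Vel d × Vel d => secDiff f p.1 p.2 / ‖p.2‖ ^ ((d : ℝ) + σ) * g p.1)
        (volume.prod volume) := by
    intro f g hf hg hgi
    obtain ⟨K, hK⟩ := hf.lintegral_le hd h0 h2
    have hm : Measurable (fun p : Vel d × Vel d =>
        secDiff f p.1 p.2 / ‖p.2‖ ^ ((d : ℝ) + σ) * g p.1) :=
      (measurable_secDiff_div σ hf.smooth.continuous).mul
        (hg.smooth.continuous.measurable.comp measurable_fst)
    refine ⟨hm.aestronglyMeasurable, ?_⟩
    rw [hasFiniteIntegral_iff_enorm, lintegral_prod _ hm.enorm.aemeasurable]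
    simp_rw [enorm_mul, enorm_secDiff_div]
    calc _ ≤ ∫⁻ v, ENNReal.ofReal K * ‖g v‖ₑ := by
          refine lintegral_mono fun v => ?_
          have hmm : Measurable fun h => ‖secDiff f v h‖ₑ * fracKer σ h :=
            (((continuous_secDiff hf.smooth.continuous).measurable.comp
              measurable_prodMk_left).enorm).mul (measurable_fracKer σ)
          rw [lintegral_mul_const _ hmm]
          exact mul_le_mul_left (hK v) _
      _ < ⊤ := by
          rw [lintegral_const_mul _ hg.smooth.continuous.measurable.enorm]
          exact ENNReal.mul_lt_top ENNReal.ofReal_lt_top hgi.2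
  have i1 := key hu hw hwi
  have i2 := key hw hu hui
  have e1 : ∫ v, fracLap σ u v * w v = cFrac d σ / 2 *
      ∫ v, ∫ h, secDiff u v h / ‖h‖ ^ ((d : ℝ) + σ) * w v := by
    rw [← integral_const_mul]
    congr with v
    rw [fracLap_eq, integral_mul_const, mul_assoc]
  have e2 : ∫ v, u v * fracLap σ w v = cFrac d σ / 2 *
      ∫ v, ∫ h, secDiff w v h / ‖h‖ ^ ((d : ℝ) + σ) * u v := by
    rw [← integral_const_mul]
    congr with v
    rw [fracLap_eq, integral_mul_const]
    ring
  rw [e1, e2,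
    integral_integral_swap (f := fun v h => secDiff u v h / ‖h‖ ^ ((d : ℝ) + σ) * w v) i1,
    integral_integral_swap (f := fun v h => secDiff w v h / ‖h‖ ^ ((d : ℝ) + σ) * u v) i2]
  congr 2 with h
  obtain ⟨Ku, hKu⟩ := hu.bound
  have cu := hu.smooth.continuous
  have cw := hw.smooth.continuous
  have prod_int : ∀ a b : Vel d, Integrable fun v => u (v + a) * w (v + b) := fun a b => by
    refine (hwi.comp_add_right b).bdd_mul (c := Ku) (by fun_prop) (ae_of_all _ fun v => ?_)
    exact hKu _
  have expand : ∀ (f g : Vel d → ℝ), (∀ a b : Vel d, Integrable fun v => f (v + a) * g (v + b)) →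
      ∫ v, secDiff f v h / ‖h‖ ^ ((d : ℝ) + σ) * g v = 1 / ‖h‖ ^ ((d : ℝ) + σ) *
        ((∫ v, f (v + h) * g (v + 0)) + (∫ v, f (v + -h) * g (v + 0)) -
          2 * ∫ v, f (v + 0) * g (v + 0)) := by
    intro f g hfg
    have e := integral_sub ((hfg h 0).add (hfg (-h) 0)) ((hfg 0 0).const_mul 2)
    simp only [Pi.add_apply] at e
    rw [integral_add (hfg h 0) (hfg (-h) 0), integral_const_mul] at e
    rw [← e, ← integral_const_mul]
    congr with v
    simp only [secDiff, add_zero, sub_eq_add_neg]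
    ring
  rw [expand u w prod_int, expand w u fun a b => by simpa only [mul_comm] using prod_int b a]
  have s1 : ∫ v, u (v + h) * w (v + 0) = ∫ v, w (v + -h) * u (v + 0) := by
    rw [← integral_add_right_eq_self _ (-h)]
    congr with v
    simp [mul_comm]
  have s2 : ∫ v, u (v + -h) * w (v + 0) = ∫ v, w (v + h) * u (v + 0) := by
    rw [← integral_add_right_eq_self _ h]
    congr with v
    simp [mul_comm]
  rw [s1, s2, show ∫ v, u (v + 0) * w (v + 0) = ∫ v, w (v + 0) * u (v + 0) by
    simp only [mul_comm]]
  ring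

end SecondDifference

section FractionalLaplacian

variable {d : ℕ}

/-- The far contribution to the fractional Laplacian of a function of size `m`. -/
def farInt (σ : ℝ) (m : Vel d → ℝ) (v : Vel d) : ℝ≥0∞ :=
  ∫⁻ h in {h : Vel d | jap v / 2 ≤ ‖h‖}, ENNReal.ofReal (m (v + h)) * fracKer σ h

lemma farInt_neg (σ : ℝ) (m : Vel d → ℝ) (v : Vel d) :
    ∫⁻ h in {h : Vel d | jap v / 2 ≤ ‖h‖}, ENNReal.ofReal (m (v - h)) * fracKer σ h
      = farInt σ m v := by
  rw [farInt, ← lintegral_indicator (measurableSet_far _), ← lintegral_indicator (measurableSet_far _),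
    ← lintegral_neg_eq_self]
  congr with h
  simp only [indicator, mem_ofPred_eq, norm_neg, sub_neg_eq_add, fracKer_neg]

lemma fracKer_le_of_mul_le {σ : ℝ} (h0 : 0 ≤ (d : ℝ) + σ) {h : Vel d} {a b : ℝ} (ha : 0 < a)
    (hb : 0 < b) (hab : b ≤ a * ‖h‖) :
    fracKer σ h ≤ ENNReal.ofReal (a ^ ((d : ℝ) + σ) * b ^ (-((d : ℝ) + σ))) := by
  refine ENNReal.ofReal_le_ofReal ?_
  have hh : 0 < ‖h‖ := by
    by_contra hc
    have : ‖h‖ = 0 := le_antisymm (not_lt.mp hc) (norm_nonneg h)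
    rw [this, mul_zero] at hab
    linarith
  have := Real.rpow_le_rpow hb.le hab h0
  rw [Real.mul_rpow ha.le hh.le] at this
  rw [Real.rpow_neg hb.le, ← div_eq_mul_inv, div_le_div_iff₀ (by positivity) (by positivity),
    one_mul]
  exact this

lemma exists_enorm_fracLap_le (hd : 1 ≤ d) {σ : ℝ} (h0 : 0 < σ) (h2 : σ < 2) {A C : ℝ}
    (hA : 0 ≤ A) (hC : 0 ≤ C) :
    ∃ K : ℝ, 0 ≤ K ∧ ∀ (u m : Vel d → ℝ), SymBound m C u → Envelope m A → ∀ v,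
      ‖fracLap σ u v‖ₑ ≤ ENNReal.ofReal K * (ENNReal.ofReal (m v * jap v ^ (-σ)) + farInt σ m v) := by
  obtain ⟨C₀, hC₀, hker⟩ := exists_fracKer_const hd h0 h2
  set K₁ : ℝ := 4 * C * A * C₀ * (1 / 2) ^ (2 - σ) + 2 * C * C₀ * (1 / 2) ^ (-σ) with hK₁
  set K₂ : ℝ := max K₁ (2 * C) with hK₂
  have hK₁' : 0 ≤ K₁ := by positivity
  refine ⟨|cFrac d σ / 2| * K₂, by positivity, fun u m hu hm v => ?_⟩
  refine (enorm_fracLap_le σ u v).trans ?_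
  rw [ENNReal.ofReal_mul (abs_nonneg _), Real.enorm_eq_ofReal_abs, mul_assoc]
  refine mul_le_mul' le_rfl ?_
  have hv := jap_pos v
  have hmv := hm.nonneg v
  obtain ⟨kfar, knear⟩ := hker (jap v / 2) (by positivity)
  have near := lintegral_secDiff_near_le (K := 4 * C * A * m v / jap v ^ 2) hu.smooth knear
    (by positivity) (fun k hk => by
      refine (hu.bound_fderiv2 (v + k)).trans ?_
      have h1 := hm.slow v k hk
      have h3 := jap_le_two_mul_add hk
      have h4 := jap_pos (v + k)
      rw [div_le_div_iff₀ (by positivity) (by positivity)]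
      have h5 : jap v ^ 2 ≤ 4 * jap (v + k) ^ 2 := by nlinarith
      calc C * m (v + k) * jap v ^ 2 ≤ C * (A * m v) * (4 * jap (v + k) ^ 2) := by gcongr
        _ = _ := by ring)
  have far : ∫⁻ h in {h : Vel d | jap v / 2 ≤ ‖h‖}, ‖secDiff u v h‖ₑ * fracKer σ h ≤
      ENNReal.ofReal C * farInt σ m v + ENNReal.ofReal C * farInt σ m v +
        ENNReal.ofReal (2 * C * m v * (C₀ * (jap v / 2) ^ (-σ))) := by
    have hmm : Measurable m := hm.continuous.measurable
    have hpt : ∀ h, ‖secDiff u v h‖ₑ * fracKer σ h ≤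
        ENNReal.ofReal C * (ENNReal.ofReal (m (v + h)) * fracKer σ h) +
        ENNReal.ofReal C * (ENNReal.ofReal (m (v - h)) * fracKer σ h) +
        ENNReal.ofReal (2 * C * m v) * fracKer σ h := fun h => by
      rw [← mul_assoc, ← mul_assoc, ← ENNReal.ofReal_mul hC, ← ENNReal.ofReal_mul hC, ← add_mul,
        ← add_mul, ← ENNReal.ofReal_add (hu.nonneg _) (hu.nonneg _), ← ENNReal.ofReal_add
        (add_nonneg (hu.nonneg _) (hu.nonneg _)) (by positivity), Real.enorm_eq_ofReal_abs]
      gcongr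
      have h1 := abs_le.mp (hu.bound (v + h))
      have h2 := abs_le.mp (hu.bound (v - h))
      have h3 := abs_le.mp (hu.bound v)
      rw [secDiff, abs_le]
      constructor <;> linarith
    refine (lintegral_mono hpt).trans ?_
    rw [lintegral_add_right _ (by fun_prop), lintegral_add_right _ (by fun_prop),
      lintegral_const_mul _ (by fun_prop), lintegral_const_mul _ (by fun_prop),
      lintegral_const_mul _ (by fun_prop), farInt_neg,
      ENNReal.ofReal_mul (p := 2 * C * m v) (by positivity)]
    exact add_le_add le_rfl (mul_le_mul' le_rfl kfar)
  rw [← lintegral_add_compl _ (measurableSet_far (jap v / 2)), compl_far]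
  refine (add_le_add far near).trans ?_
  rw [add_assoc, ← ENNReal.ofReal_add (by positivity) (by positivity), ← two_mul, ← mul_assoc,
    ← ENNReal.ofReal_ofNat 2, ← ENNReal.ofReal_mul (by norm_num), mul_add, add_comm,
    ← ENNReal.ofReal_mul (by positivity)]
  refine add_le_add (ENNReal.ofReal_le_ofReal ?_) (mul_le_mul'
    (ENNReal.ofReal_le_ofReal (le_max_right _ _)) le_rfl)
  have e1 : (jap v / 2) ^ (2 - σ) = jap v ^ 2 * jap v ^ (-σ) * (1 / 2) ^ (2 - σ) := by
    rw [div_eq_mul_one_div, Real.mul_rpow hv.le (by norm_num), sub_eq_add_neg,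
      Real.rpow_add hv, Real.rpow_two]
  have e2 : (jap v / 2) ^ (-σ) = jap v ^ (-σ) * (1 / 2) ^ (-σ) := by
    rw [div_eq_mul_one_div, Real.mul_rpow hv.le (by norm_num)]
  have hjs := jap_rpow_pos v (-σ)
  calc _ = K₁ * (m v * jap v ^ (-σ)) := by
        rw [e1, e2, hK₁]
        field_simp
        ring
    _ ≤ _ := by gcongr; exact le_max_left _ _

/-- Pointwise bound on the square of the far contribution. -/
lemma exists_farInt_sq_le (hd : 1 ≤ d) {σ γ β : ℝ} (h0 : 0 < σ) (h2 : σ < 2) (hγ : 0 < γ)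
    (hβ : β = σ - γ) :
    ∃ K : ℝ, 0 ≤ K ∧ ∀ (m : Vel d → ℝ), Measurable m → ∀ v,
      farInt σ m v ^ 2 ≤ ENNReal.ofReal (K * jap v ^ (-σ)) *
        ∫⁻ w, ENNReal.ofReal (m w) ^ 2 * wtF γ (-β) w := by
  obtain ⟨C₀, hC₀, hker⟩ := exists_fracKer_const hd h0 h2
  have hc := cGamma_pos hd hγ
  refine ⟨C₀ * (1 / 2) ^ (-σ) * (3 ^ ((d : ℝ) + σ) * (cGamma d γ)⁻¹), by positivity,
    fun m hm v => ?_⟩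
  have hv := jap_pos v
  set μ : Measure (Vel d) :=
    (volume.restrict {h : Vel d | jap v / 2 ≤ ‖h‖}).withDensity (fracKer σ) with hμ
  have hmv : Measurable fun h => ENNReal.ofReal (m (v + h)) := by fun_prop
  have e1 : farInt σ m v = ∫⁻ h, ENNReal.ofReal (m (v + h)) * 1 ∂μ := by
    rw [hμ, lintegral_withDensity_eq_lintegral_mul _ (measurable_fracKer σ) (by fun_prop), farInt]
    congr with h
    simp [mul_comm]
  have e2 : ∫⁻ h, (1 : ℝ≥0∞) ^ 2 ∂μ ≤ ENNReal.ofReal (C₀ * (jap v / 2) ^ (-σ)) := by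
    rw [hμ, lintegral_withDensity_eq_lintegral_mul _ (measurable_fracKer σ) (by fun_prop)]
    simpa using (hker (jap v / 2) (by positivity)).1
  have e3 : ∫⁻ h, ENNReal.ofReal (m (v + h)) ^ 2 ∂μ ≤
      ENNReal.ofReal (3 ^ ((d : ℝ) + σ) * (cGamma d γ)⁻¹) *
        ∫⁻ w, ENNReal.ofReal (m w) ^ 2 * wtF γ (-β) w := by
    rw [hμ, lintegral_withDensity_eq_lintegral_mul _ (measurable_fracKer σ) (by fun_prop),
      ← lintegral_const_mul _ (by fun_prop)]
    calc _ ≤ ∫⁻ h in {h : Vel d | jap v / 2 ≤ ‖h‖}, ENNReal.ofReal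
            (3 ^ ((d : ℝ) + σ) * (cGamma d γ)⁻¹) *
            (ENNReal.ofReal (m (v + h)) ^ 2 * wtF γ (-β) (v + h)) := by
          refine setLIntegral_mono' (measurableSet_far _) fun h (hh : jap v / 2 ≤ ‖h‖) => ?_
          rw [Pi.mul_apply, mul_comm, mul_left_comm]
          refine mul_le_mul' le_rfl ?_
          refine (fracKer_le_of_mul_le (a := 3) (b := jap (v + h)) (by positivity) (by norm_num)
            (jap_pos _) ?_).trans (le_of_eq ?_)
          · have := jap_add_le v h
            linarith
          · rw [wtF_eq hd hγ, ← ENNReal.ofReal_mul hc.le, ← ENNReal.ofReal_mul (by positivity)]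
            congr 1
            rw [show γ - -β = σ by rw [hβ]; ring]
            field_simp
      _ ≤ ∫⁻ h, ENNReal.ofReal (3 ^ ((d : ℝ) + σ) * (cGamma d γ)⁻¹) *
            (ENNReal.ofReal (m (v + h)) ^ 2 * wtF γ (-β) (v + h)) := setLIntegral_le_lintegral _ _
      _ = _ := lintegral_add_left_eq_self (fun w => ENNReal.ofReal
            (3 ^ ((d : ℝ) + σ) * (cGamma d γ)⁻¹) * (ENNReal.ofReal (m w) ^ 2 * wtF γ (-β) w)) v
  rw [e1]
  refine (lintegral_mul_sq_le μ hmv.aemeasurable aemeasurable_const).trans ?_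
  refine (mul_le_mul' e3 e2).trans (le_of_eq ?_)
  rw [mul_right_comm, ← ENNReal.ofReal_mul (by positivity)]
  congr 2
  rw [div_eq_mul_one_div (jap v), Real.mul_rpow hv.le (by norm_num)]
  ring

lemma equil_symBound (hd : 1 ≤ d) {γ : ℝ} (hγ : 0 < γ) :
    SymBound (fun v : Vel d => jap v ^ (-((d : ℝ) + γ)))
      (cGamma d γ * (6 * (1 + |-((d : ℝ) + γ)|) ^ 2)) (equil γ) := by
  have h := SymBound.jap_rpow (d := d) (-((d : ℝ) + γ))
  have hc := cGamma_pos hd hγ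
  have e : (equil γ : Vel d → ℝ) = fun v => cGamma d γ * jap v ^ (-((d : ℝ) + γ)) := rfl
  have e1 : fderiv ℝ (equil γ : Vel d → ℝ) =
      fun v => cGamma d γ • fderiv ℝ (fun v : Vel d => jap v ^ (-((d : ℝ) + γ))) v := by
    rw [e]
    exact funext fun v => fderiv_const_mul (h.differentiable v) _
  refine ⟨by rw [e]; exact contDiff_const.mul h.smooth, fun v => ?_, fun v => ?_, fun v => ?_⟩
  · rw [equil, abs_mul, abs_of_pos hc, mul_assoc]
    gcongr
    exact h.bound v
  · rw [e1, norm_smul, Real.norm_of_nonneg hc.le, mul_assoc, mul_div_assoc]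
    gcongr
    exact h.bound_fderiv v
  · rw [e1, ((h.differentiable_fderiv v).hasFDerivAt.fun_const_smul (cGamma d γ)).fderiv]
    refine (ContinuousLinearMap.opNorm_smul_le _ _).trans ?_
    rw [Real.norm_of_nonneg hc.le, mul_assoc, mul_div_assoc]
    gcongr
    exact h.bound_fderiv2 v

lemma SymBound.bddC2 {m u : Vel d → ℝ} {C A : ℝ} (hu : SymBound m C u) (hC : 0 ≤ C)
    (hm : ∀ v, m v ≤ A) : BddC2 u where
  smooth := hu.smooth
  bound := ⟨C * A, fun v => (hu.bound v).trans (by gcongr; exact hm v)⟩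
  bound2 := ⟨C * A, fun v => (hu.bound_fderiv2 v).trans
    ((div_le_self (hu.nonneg v) (one_le_pow₀ (one_le_jap v))).trans (by gcongr; exact hm v))⟩

lemma equil_bddC2 (hd : 1 ≤ d) {γ : ℝ} (hγ : 0 < γ) : BddC2 (equil γ : Vel d → ℝ) := by
  have hc := cGamma_pos hd hγ
  refine (equil_symBound hd hγ).bddC2 (A := 1) (by positivity) fun v => jap_rpow_le_one v ?_
  have : (0 : ℝ) ≤ d := by positivity
  linarith

lemma exists_enorm_fracLap_equil_le (hd : 1 ≤ d) {σ γ : ℝ} (h0 : 0 < σ) (h2 : σ < 2)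
    (hγ : 0 < γ) : ∃ K : ℝ, 0 ≤ K ∧ ∀ v : Vel d,
      ‖fracLap σ (equil γ) v‖ₑ ≤ ENNReal.ofReal (K * jap v ^ (-((d : ℝ) + σ))) := by
  have hc := cGamma_pos hd hγ
  have hd0 : (0 : ℝ) ≤ d := by positivity
  obtain ⟨K, hK, hb⟩ := exists_enorm_fracLap_le hd h0 h2
    (A := 2 ^ |-((d : ℝ) + γ)|) (C := cGamma d γ * (6 * (1 + |-((d : ℝ) + γ)|) ^ 2))
    (by positivity) (by positivity)
  set I : ℝ≥0∞ := ∫⁻ v : Vel d, ENNReal.ofReal (jap v ^ (-((d : ℝ) + γ))) with hI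
  have hI' : I < ⊤ := lintegral_jap_rpow_lt_top hγ
  refine ⟨K * (1 + 2 ^ ((d : ℝ) + σ) * I.toReal), by positivity, fun v => ?_⟩
  refine (hb _ _ (equil_symBound hd hγ) (Envelope.jap_rpow (by linarith)) v).trans ?_
  have hv := jap_pos v
  have hjp := jap_rpow_pos v (-((d : ℝ) + σ))
  rw [mul_assoc, ENNReal.ofReal_mul hK, add_mul, one_mul,
    ENNReal.ofReal_add (by positivity) (by positivity)]
  refine mul_le_mul' le_rfl (add_le_add (ENNReal.ofReal_le_ofReal ?_) ?_)
  · rw [← Real.rpow_add hv]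
    exact jap_rpow_mono v (by linarith)
  · calc farInt σ (fun v : Vel d => jap v ^ (-((d : ℝ) + γ))) v
        ≤ ∫⁻ h in {h : Vel d | jap v / 2 ≤ ‖h‖},
            ENNReal.ofReal (2 ^ ((d : ℝ) + σ) * jap v ^ (-((d : ℝ) + σ))) *
              ENNReal.ofReal (jap (v + h) ^ (-((d : ℝ) + γ))) := by
          refine setLIntegral_mono' (measurableSet_far _) fun h (hh : jap v / 2 ≤ ‖h‖) => ?_
          rw [mul_comm]
          exact mul_le_mul' (fracKer_le_of_mul_le (by positivity) (by norm_num) hv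
            (by linarith)) le_rfl
      _ ≤ ∫⁻ h, ENNReal.ofReal (2 ^ ((d : ℝ) + σ) * jap v ^ (-((d : ℝ) + σ))) *
              ENNReal.ofReal (jap (v + h) ^ (-((d : ℝ) + γ))) := setLIntegral_le_lintegral _ _
      _ = ENNReal.ofReal (2 ^ ((d : ℝ) + σ) * jap v ^ (-((d : ℝ) + σ))) * I := by
          rw [lintegral_const_mul _ (by fun_prop), hI]
          congr 1
          exact lintegral_add_left_eq_self
            (fun w => ENNReal.ofReal (jap w ^ (-((d : ℝ) + γ)))) v
      _ = _ := by
          rw [← ENNReal.ofReal_toReal hI'.ne, ← ENNReal.ofReal_mul (by positivity),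
            ENNReal.ofReal_toReal hI'.ne]
          congr 1
          ring

end FractionalLaplacian

section MassInBalls

variable {d : ℕ}

section MassInBalls

variable {σ γ : ℝ}

lemma integrable_fracLap_equil (hd : 1 ≤ d) (h0 : 0 < σ) (h2 : σ < 2) (hγ : 0 < γ) :
    Integrable (fracLap σ (equil γ : Vel d → ℝ)) := by
  obtain ⟨K, hK, hb⟩ := exists_enorm_fracLap_equil_le (d := d) hd h0 h2 hγ
  refine ⟨(measurable_fracLap σ (continuous_equil γ)).aestronglyMeasurable, ?_⟩
  rw [hasFiniteIntegral_iff_enorm]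
  refine (lintegral_mono hb).trans_lt ?_
  simp_rw [ENNReal.ofReal_mul hK]
  rw [lintegral_const_mul _ (continuous_jap_rpow _).measurable.ennreal_ofReal]
  exact ENNReal.mul_lt_top ENNReal.ofReal_lt_top (lintegral_jap_rpow_lt_top h0)

lemma norm_fderiv2_cutoff_le {C R : ℝ} (hC : 0 ≤ C) (hR : 0 < R)
    (h : SymBound (fun _ : Vel d => 1) C (cutoff R)) (v : Vel d) :
    ‖fderiv ℝ (fderiv ℝ (cutoff R)) v‖ ≤ C / R ^ 2 := by
  rcases lt_or_ge (jap v) R with hv | hv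
  · have : (cutoff R : Vel d → ℝ) =ᶠ[𝓝 v] fun _ => 1 := by
      filter_upwards [continuous_jap.continuousAt.eventually (gt_mem_nhds hv)] with w hw
      exact cutoff_eq_one hR (le_of_lt hw)
    have e : fderiv ℝ (fderiv ℝ (cutoff R)) v = 0 := by
      rw [(this.fderiv (𝕜 := ℝ)).fderiv_eq]
      simp
    rw [e]
    exact (ContinuousLinearMap.opNorm_zero (E := Vel d)).le.trans (by positivity)
  · refine (h.bound_fderiv2 v).trans ?_
    rw [mul_one]
    gcongr

lemma exists_fracLap_cutoff_le (hd : 1 ≤ d) (h0 : 0 < σ) (h2 : σ < 2) :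
    ∃ K : ℝ, 0 ≤ K ∧ ∀ R : ℝ, 0 < R → ∀ v : Vel d,
      ‖fracLap σ (cutoff R) v‖ₑ ≤ ENNReal.ofReal (K * R ^ (-σ)) := by
  obtain ⟨C₀, hC₀, hker⟩ := exists_fracKer_const hd h0 h2
  obtain ⟨C, hC, hb⟩ := exists_symBound_cutoff d
  refine ⟨|cFrac d σ / 2| * (C * C₀ + 4 * C₀), by positivity, fun R hR v => ?_⟩
  have h := lintegral_secDiff_le (K₀ := 1) (K₂ := C / R ^ 2) (contDiff_cutoff R) (hker R hR).1
    (hker R hR).2 hC₀.le hR zero_le_one (by positivity)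
    (fun v => by rw [abs_of_nonneg (cutoff_nonneg R v)]; exact cutoff_le_one R v)
    (norm_fderiv2_cutoff_le hC.le hR (hb R hR)) v
  refine (enorm_fracLap_le σ _ v).trans ((mul_le_mul' le_rfl h).trans (le_of_eq ?_))
  rw [Real.enorm_eq_ofReal_abs, ← ENNReal.ofReal_mul (abs_nonneg _), sub_eq_add_neg,
    Real.rpow_add hR, Real.rpow_two]
  congr 1
  field_simp

lemma isTest_cutoff {R : ℝ} (hR : 0 < R) : IsTest (cutoff R : Vel d → ℝ) :=
  ⟨contDiff_cutoff R, hasCompactSupport_cutoff hR⟩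

lemma IsTest.integrable {ζ : Vel d → ℝ} (h : IsTest ζ) : Integrable ζ :=
  h.1.continuous.integrable_of_hasCompactSupport h.2

/-- Decay of `∫_{|v| < t} Δ^{σ/2} F` as `t → ∞`. -/
lemma exists_mass_ball_far (hd : 1 ≤ d) (h0 : 0 < σ) (h2 : σ < 2) (hγ : 0 < γ) :
    ∃ K : ℝ, 0 ≤ K ∧ ∀ t : ℝ, 2 ≤ t →
      |∫ v in Metric.ball (0 : Vel d) t, fracLap σ (equil γ) v| ≤ K * t ^ (-σ) := by
  obtain ⟨K₁, hK₁, hb₁⟩ := exists_fracLap_cutoff_le hd h0 h2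
  obtain ⟨K₂, hK₂, hb₂⟩ := exists_enorm_fracLap_equil_le (d := d) hd h0 h2 hγ
  obtain ⟨C₀, hC₀, hker⟩ := exists_fracKer_const hd h0 h2
  have hpi := integrable_fracLap_equil (d := d) hd h0 h2 hγ
  have hF := integrable_equil (d := d) hd hγ
  set p := fracLap σ (equil γ : Vel d → ℝ) with hp
  set I : ℝ := ∫ v : Vel d, equil γ v with hI
  have hI0 : 0 ≤ I := integral_nonneg fun v => (equil_pos hd hγ v).le
  refine ⟨I * K₁ + K₂ * (C₀ * (1 / 2) ^ (-σ)), by positivity, fun t ht => ?_⟩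
  have ht0 : 0 < t := by linarith
  have hts := Real.rpow_pos_of_pos ht0 (-σ)
  have hc : Integrable fun v => p v * cutoff t v := by
    refine hpi.mul_bdd (c := 1) (contDiff_cutoff t).continuous.aestronglyMeasurable
      (ae_of_all _ fun v => ?_)
    rw [Real.norm_of_nonneg (cutoff_nonneg t v)]
    exact cutoff_le_one t v
  have e1 : ∫ v in Metric.ball (0 : Vel d) t, p v = (∫ v, p v * cutoff t v) -
      ∫ v, (p v * cutoff t v - (Metric.ball (0 : Vel d) t).indicator p v) := by
    rw [integral_sub hc (hpi.indicator measurableSet_ball), integral_indicator measurableSet_ball]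
    ring
  have b1 : |∫ v, p v * cutoff t v| ≤ I * K₁ * t ^ (-σ) := by
    rw [hp, integral_fracLap_mul hd h0 h2 (equil_bddC2 hd hγ) (isTest_cutoff ht0).bddC2 hF
      (isTest_cutoff ht0).integrable, ← Real.norm_eq_abs, hI, mul_assoc, ← integral_mul_const]
    refine norm_integral_le_of_norm_le (hF.mul_const _) (ae_of_all _ fun v => ?_)
    rw [norm_mul, Real.norm_of_nonneg (equil_pos hd hγ v).le]
    have hpos := (equil_pos hd hγ v).le
    gcongr
    have := hb₁ t ht0 v
    rw [Real.enorm_eq_ofReal_abs, ENNReal.ofReal_le_ofReal_iff (by positivity)] at this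
    exact this
  have b2 : |∫ v, (p v * cutoff t v - (Metric.ball (0 : Vel d) t).indicator p v)| ≤
      K₂ * (C₀ * (t / 2) ^ (-σ)) := by
    have hle : ‖∫ v, (p v * cutoff t v - (Metric.ball (0 : Vel d) t).indicator p v)‖ₑ ≤
        ENNReal.ofReal (K₂ * (C₀ * (t / 2) ^ (-σ))) := by
      refine (enorm_integral_le_lintegral_enorm _).trans ?_
      calc _ ≤ ∫⁻ v in {h : Vel d | t / 2 ≤ ‖h‖}, ENNReal.ofReal K₂ * fracKer σ v := by
            rw [← lintegral_indicator (measurableSet_far _)]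
            refine lintegral_mono fun v => ?_
            by_cases hj : jap v ≤ t
            · have h3 : v ∈ Metric.ball (0 : Vel d) t := by
                rw [mem_ball_zero_iff]
                have h4 := jap_sq v
                have h5 := jap_pos v
                by_contra hcon
                have : jap v ≤ ‖v‖ := hj.trans (not_lt.mp hcon)
                nlinarith
              rw [indicator_of_mem h3, cutoff_eq_one ht0 hj]
              simp
            · have h3 : v ∈ {h : Vel d | t / 2 ≤ ‖h‖} := by
                have := jap_le_one_add_norm v
                change t / 2 ≤ ‖v‖
                linarith
              rw [indicator_of_mem h3]
              have h4 : ‖p v * cutoff t v - (Metric.ball (0 : Vel d) t).indicator p v‖ ≤ ‖p v‖ := by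
                have h5 := cutoff_nonneg t v
                have h6 := cutoff_le_one t v
                by_cases hin : v ∈ Metric.ball (0 : Vel d) t
                · rw [indicator_of_mem hin, ← mul_sub_one, norm_mul]
                  refine mul_le_of_le_one_right (norm_nonneg _) ?_
                  rw [Real.norm_eq_abs, abs_le]
                  constructor <;> linarith
                · rw [indicator_of_notMem hin, sub_zero, norm_mul]
                  refine mul_le_of_le_one_right (norm_nonneg _) ?_
                  rw [Real.norm_of_nonneg h5]
                  exact h6
              refine (enorm_le_iff_norm_le.mpr h4).trans ((hb₂ v).trans ?_)
              rw [ENNReal.ofReal_mul hK₂]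
              refine mul_le_mul' le_rfl (ENNReal.ofReal_le_ofReal ?_)
              have hvpos : 0 < ‖v‖ := lt_of_lt_of_le (by linarith) h3
              rw [Real.rpow_neg (jap_pos v).le, one_div]
              exact inv_anti₀ (by positivity) (Real.rpow_le_rpow hvpos.le (norm_le_jap v)
                (by positivity))
        _ ≤ _ := by
            rw [lintegral_const_mul _ (by fun_prop), ENNReal.ofReal_mul hK₂]
            exact mul_le_mul' le_rfl (hker (t / 2) (by positivity)).1
    rwa [Real.enorm_eq_ofReal_abs, ENNReal.ofReal_le_ofReal_iff (by positivity)] at hle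
  rw [e1]
  refine (abs_sub _ _).trans ((add_le_add b1 b2).trans (le_of_eq ?_))
  rw [div_eq_mul_one_div t, Real.mul_rpow ht0.le (by norm_num)]
  ring

lemma exists_mass_ball_near (hd : 1 ≤ d) (h0 : 0 < σ) (h2 : σ < 2) (hγ : 0 < γ) :
    ∃ K : ℝ, 0 ≤ K ∧ ∀ t : ℝ, 0 < t →
      |∫ v in Metric.ball (0 : Vel d) t, fracLap σ (equil γ) v| ≤ K * t ^ d := by
  obtain ⟨K, hK⟩ := (equil_bddC2 (d := d) hd hγ).fracLap_bounded hd h0 h2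
  refine ⟨|K| * volume.real (Metric.ball (0 : Vel d) 1), by positivity, fun t ht => ?_⟩
  have h := norm_setIntegral_le_of_norm_le_const (μ := volume) (s := Metric.ball (0 : Vel d) t)
    (f := fracLap σ (equil γ)) (C := |K|) measure_ball_lt_top
    (fun v _ => (hK v).trans (le_abs_self K))
  rw [Real.norm_eq_abs] at h
  refine h.trans (le_of_eq ?_)
  rw [Measure.real, Measure.addHaar_ball_of_pos volume _ ht, ENNReal.toReal_mul,
    ENNReal.toReal_ofReal (by positivity), Measure.real]
  simp
  ring

lemma exists_mass_ball_le (hd : 1 ≤ d) (h0 : 0 < σ) (h2 : σ < 2) (hγ : 0 < γ) :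
    ∃ K : ℝ, 0 ≤ K ∧ ∀ t : ℝ, 0 < t →
      |∫ v in Metric.ball (0 : Vel d) t, fracLap σ (equil γ) v| ≤
        K * (t ^ (d - 1) * (1 + t ^ 2) ^ ((1 - (d : ℝ) - σ) / 2)) := by
  obtain ⟨K₁, hK₁, hb₁⟩ := exists_mass_ball_far (d := d) hd h0 h2 hγ
  obtain ⟨K₂, hK₂, hb₂⟩ := exists_mass_ball_near (d := d) hd h0 h2 hγ
  have hd1 : (1 : ℝ) ≤ d := by exact_mod_cast hd
  set q : ℝ := (1 - (d : ℝ) - σ) / 2 with hq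
  have hq0 : q ≤ 0 := by rw [hq]; linarith
  refine ⟨K₁ * 2 ^ (-q) + 2 * K₂ * 5 ^ (-q), by positivity, fun t ht => ?_⟩
  have hT : 0 < t ^ (d - 1) * (1 + t ^ 2) ^ q := by positivity
  rcases le_total 2 t with h | h
  · refine (hb₁ t h).trans ?_
    have e1 : (2 * t ^ 2) ^ q ≤ (1 + t ^ 2) ^ q :=
      Real.rpow_le_rpow_of_nonpos (by positivity) (by nlinarith) hq0
    have e2 : t ^ (-σ) = 2 ^ (-q) * (t ^ (d - 1) * (2 * t ^ 2) ^ q) := by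
      have e3 : (2 : ℝ) ^ (-q) * 2 ^ q = 1 := by rw [← Real.rpow_add (by norm_num)]; simp
      have e4 : t ^ (d - 1) * (t ^ 2) ^ q = t ^ (-σ) := by
        rw [← Real.rpow_natCast t (d - 1), ← Real.rpow_two, ← Real.rpow_mul ht.le,
          ← Real.rpow_add ht, Nat.cast_sub hd, hq]
        congr 1
        push_cast
        ring
      rw [Real.mul_rpow (by norm_num) (by positivity), ← e4]
      linear_combination -(t ^ (d - 1) * (t ^ 2) ^ q) * e3
    calc K₁ * t ^ (-σ) ≤ K₁ * (2 ^ (-q) * (t ^ (d - 1) * (1 + t ^ 2) ^ q)) := by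
          rw [e2]; gcongr
      _ ≤ _ := by
          have : 0 ≤ 2 * K₂ * 5 ^ (-q) * (t ^ (d - 1) * (1 + t ^ 2) ^ q) := by positivity
          linarith
  · refine (hb₂ t ht).trans ?_
    have e1 : (5 : ℝ) ^ q ≤ (1 + t ^ 2) ^ q :=
      Real.rpow_le_rpow_of_nonpos (by positivity) (by nlinarith) hq0
    have e3 : (5 : ℝ) ^ (-q) * 5 ^ q = 1 := by rw [← Real.rpow_add (by norm_num)]; simp
    have e2 : t ^ d = t ^ (d - 1) * t := by
      rw [← pow_succ]; congr 1; omega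
    calc K₂ * t ^ d ≤ K₂ * (t ^ (d - 1) * 2 * (5 ^ (-q) * 5 ^ q)) := by
          rw [e2, e3, mul_one]; gcongr
      _ ≤ K₂ * (t ^ (d - 1) * 2 * (5 ^ (-q) * (1 + t ^ 2) ^ q)) := by gcongr
      _ ≤ _ := by
          have : 0 ≤ K₁ * 2 ^ (-q) * (t ^ (d - 1) * (1 + t ^ 2) ^ q) := by positivity
          linarith

end MassInBalls

section RadialTest

/-- For `k` smooth with compact support in `(0, ∞)`, the function `∫_s^∞ k`. -/
def tailInt (k : ℝ → ℝ) (s : ℝ) : ℝ := (∫ t in Ioi (0 : ℝ), k t) - ∫ t in (0 : ℝ)..s, k t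

variable {k : ℝ → ℝ}

lemma hasDerivAt_tailInt (hk : Continuous k) (s : ℝ) : HasDerivAt (tailInt k) (-k s) s :=
  (intervalIntegral.integral_hasDerivAt_right (hk.intervalIntegrable _ _)
    (hk.stronglyMeasurableAtFilter _ _) hk.continuousAt).const_sub _

lemma contDiff_tailInt (hk : ContDiff ℝ ∞ k) : ContDiff ℝ ∞ (tailInt k) := by
  refine contDiff_infty_iff_deriv.mpr
    ⟨fun s => (hasDerivAt_tailInt hk.continuous s).differentiableAt, ?_⟩
  rw [funext fun s => (hasDerivAt_tailInt hk.continuous s).deriv]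
  exact hk.neg

lemma tailInt_eq (hk : Continuous k) (hs : HasCompactSupport k) (s : ℝ) :
    tailInt k s = ∫ t in Ioi s, k t := by
  have hi : Integrable k := hk.integrable_of_hasCompactSupport hs
  rw [tailInt, sub_eq_iff_eq_add, add_comm]
  exact (intervalIntegral.integral_interval_add_Ioi hi.integrableOn hi.integrableOn).symm

lemma isTest_tailInt_norm (hk : ContDiff ℝ ∞ k) (hs : HasCompactSupport k)
    (hpos : tsupport k ⊆ Ioi 0) : IsTest (fun v : Vel d => tailInt k ‖v‖) := by
  obtain ⟨δ, hδ, hz⟩ : ∃ δ > 0, ∀ s : ℝ, s < δ → k s = 0 := by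
    have h0 : (tsupport k)ᶜ ∈ 𝓝 (0 : ℝ) :=
      (isClosed_tsupport k).isOpen_compl.mem_nhds fun h => lt_irrefl (0 : ℝ) (hpos h)
    obtain ⟨δ, hδ, hsub⟩ := Metric.mem_nhds_iff.mp h0
    refine ⟨δ, hδ, fun s hs' => ?_⟩
    by_contra hne
    have hm : s ∈ tsupport k := subset_tsupport k hne
    have hp : 0 < s := hpos hm
    exact hsub (by rw [Metric.mem_ball, Real.dist_eq, sub_zero, abs_of_pos hp]; exact hs') hm
  constructor
  · refine contDiff_iff_contDiffAt.mpr fun v => ?_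
    by_cases hv : v = 0
    · have : (fun v : Vel d => tailInt k ‖v‖) =ᶠ[𝓝 v] fun _ => ∫ t in Ioi (0 : ℝ), k t := by
        have hb : Metric.ball (0 : Vel d) δ ∈ 𝓝 v := by rw [hv]; exact Metric.ball_mem_nhds _ hδ
        filter_upwards [hb] with w hw
        rw [mem_ball_zero_iff] at hw
        rw [tailInt, intervalIntegral.integral_zero_ae, sub_zero]
        refine ae_of_all _ fun t ht => hz t ?_
        rw [uIoc_of_le (norm_nonneg w)] at ht
        exact ht.2.trans_lt hw
      exact contDiffAt_const.congr_of_eventuallyEq this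
    · exact (contDiff_tailInt hk).contDiffAt.comp v (contDiffAt_norm ℝ hv)
  · obtain ⟨M, hM⟩ := hs.isBounded.subset_closedBall 0
    refine HasCompactSupport.intro (isCompact_closedBall 0 M) fun v hv => ?_
    rw [mem_closedBall_zero_iff, not_le] at hv
    rw [tailInt_eq hk.continuous hs]
    refine setIntegral_eq_zero_of_forall_eq_zero fun t (ht : ‖v‖ < t) => ?_
    by_contra hne
    have := hM (subset_tsupport k hne)
    rw [mem_closedBall_zero_iff, Real.norm_eq_abs] at this
    linarith [le_abs_self t]

lemma fderiv_tailInt_norm (hk : ContDiff ℝ ∞ k) (hs : HasCompactSupport k)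
    (hpos : tsupport k ⊆ Ioi 0) (v : Vel d) :
    fderiv ℝ (fun v : Vel d => tailInt k ‖v‖) v v = -k ‖v‖ * ‖v‖ := by
  have h1 : HasFDerivAt (fun v : Vel d => tailInt k ‖v‖)
      (fderiv ℝ (fun v : Vel d => tailInt k ‖v‖) v) ((1 : ℝ) • v) := by
    rw [one_smul]
    exact ((isTest_tailInt_norm hk hs hpos).1.differentiable (by simp) v).hasFDerivAt
  have h2 : HasDerivAt (fun t : ℝ => t • v) v 1 := by
    simpa using (hasDerivAt_id (1 : ℝ)).smul_const v
  have h3 := h1.comp_hasDerivAt (1 : ℝ) h2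
  have h4 : HasDerivAt (fun t : ℝ => tailInt k (t * ‖v‖)) (-k (1 * ‖v‖) * ‖v‖) 1 := by
    have := (hasDerivAt_tailInt hk.continuous (1 * ‖v‖)).comp (1 : ℝ)
      ((hasDerivAt_id (1 : ℝ)).mul_const ‖v‖)
    rw [one_mul ‖v‖] at this
    rw [one_mul ‖v‖]
    exact this
  rw [one_mul] at h4
  refine h3.unique (h4.congr_of_eventuallyEq ?_)
  filter_upwards [lt_mem_nhds (zero_lt_one' ℝ)] with t ht
  simp [norm_smul, abs_of_pos ht]

/-- Null sets of radii. -/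
lemma ae_norm_of_ae (hd : 1 ≤ d) {P : ℝ → Prop} (h : ∀ᵐ t : ℝ, t ∈ Ioi (0 : ℝ) → P t) :
    ∀ᵐ v : Vel d, 0 < ‖v‖ → P ‖v‖ := by
  have : Nontrivial (Vel d) := Module.nontrivial_of_finrank_pos (R := ℝ) (by simp; omega)
  set N : Set ℝ := toMeasurable volume {t : ℝ | ¬(t ∈ Ioi (0 : ℝ) → P t)} with hN
  have hN0 : volume N = 0 := by rw [hN, measure_toMeasurable]; exact h
  have hz : (fun y : ℝ => y ^ (Module.finrank ℝ (Vel d) - 1) • N.indicator (fun _ => (1 : ℝ)) y)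
      =ᵐ[volume.restrict (Ioi 0)] 0 := by
    have : ∀ᵐ y : ℝ, y ∉ N := measure_eq_zero_iff_ae_notMem.mp hN0
    filter_upwards [ae_restrict_of_ae this] with y hy
    simp [indicator_of_notMem hy]
  have hi : Integrable (fun v : Vel d => N.indicator (fun _ => (1 : ℝ)) ‖v‖) := by
    rw [integrable_fun_norm_addHaar volume (f := N.indicator (fun _ => (1 : ℝ)))]
    exact (integrable_congr hz).mpr (integrable_zero _ _ _)
  have h0 : ∫ v : Vel d, N.indicator (fun _ => (1 : ℝ)) ‖v‖ = 0 := by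
    rw [integral_fun_norm_addHaar volume (N.indicator (fun _ => (1 : ℝ))), integral_congr_ae hz]
    simp
  rw [integral_eq_zero_iff_of_nonneg (fun v => indicator_nonneg (fun _ _ => zero_le_one) _) hi] at h0
  filter_upwards [h0] with v hv hpos
  by_contra hP
  have hmem : ‖v‖ ∈ N := subset_toMeasurable _ _ (by
    rw [mem_ofPred_eq, Classical.not_imp]
    exact ⟨hpos, hP⟩)
  rw [indicator_of_mem hmem] at hv
  simp at hv

end RadialTest

end MassInBalls

section Friction

variable {d : ℕ}

/-- The radial profile of the local equilibrium. -/
def equilProfile (d : ℕ) (γ s : ℝ) : ℝ := cGamma d γ * (1 + s ^ 2) ^ (-((d : ℝ) + γ) / 2)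

lemma equil_eq_profile (γ : ℝ) (v : Vel d) : equil γ v = equilProfile d γ ‖v‖ := by
  rw [equil, equilProfile, jap_eq_rpow]

lemma friction_inner {E : Vel d → Vel d} {e : ℝ → ℝ} (he : ∀ v, E v = e ‖v‖ • v)
    (ζ : Vel d → ℝ) (v : Vel d) :
    inner ℝ (E v) (gradient ζ v) = e ‖v‖ * fderiv ℝ ζ v v := by
  rw [real_inner_comm, inner_gradient_left, he, map_smul, smul_eq_mul]

lemma integrableOn_friction_profile (hd : 1 ≤ d) {γ : ℝ} {E : Vel d → Vel d}
    (hE : LocallyIntegrable E) {e : ℝ → ℝ} (he : ∀ v, E v = e ‖v‖ • v) (r : ℝ) :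
    IntegrableOn (fun t => t ^ (d - 1) * (equilProfile d γ t * (e t * t))) (Ioo 0 r) := by
  have : Nontrivial (Vel d) := Module.nontrivial_of_finrank_pos (R := ℝ) (by simp; omega)
  have h1 : IntegrableOn (fun v : Vel d => equilProfile d γ ‖v‖ * (e ‖v‖ * ‖v‖))
      (Metric.ball 0 r) := by
    have hEr : IntegrableOn E (Metric.ball 0 r) :=
      (hE.integrableOn_isCompact (isCompact_closedBall 0 r)).mono_set Metric.ball_subset_closedBall
    have h2 : IntegrableOn (fun v : Vel d => inner ℝ (‖v‖⁻¹ • v) (E v)) (Metric.ball 0 r) := by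
      refine Integrable.mono hEr ?_ (ae_of_all _ fun v => ?_)
      · have hm : Measurable fun v : Vel d => ‖v‖⁻¹ • v := by fun_prop
        exact hm.aestronglyMeasurable.inner hEr.aestronglyMeasurable
      · refine (norm_inner_le_norm _ _).trans (mul_le_of_le_one_left (norm_nonneg _) ?_)
        rw [norm_smul, norm_inv, norm_norm]
        exact inv_mul_le_one
    have h3 : ∀ v : Vel d, inner ℝ (‖v‖⁻¹ • v) (E v) = e ‖v‖ * ‖v‖ := fun v => by
      rw [he, real_inner_smul_left, real_inner_smul_right, real_inner_self_eq_norm_sq]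
      by_cases hv : ‖v‖ = 0
      · simp [hv]
      · field_simp
    simp_rw [h3] at h2
    obtain ⟨C, hC⟩ : ∃ C, ∀ v ∈ Metric.closedBall (0 : Vel d) r, ‖equil γ v‖ ≤ C :=
      (isCompact_closedBall 0 r).exists_bound_of_continuousOn (continuous_equil γ).continuousOn
    simp_rw [← equil_eq_profile]
    refine Integrable.bdd_mul (c := C) h2 (continuous_equil γ).aestronglyMeasurable ?_
    filter_upwards [ae_restrict_mem measurableSet_ball] with v hv
    exact hC v (Metric.ball_subset_closedBall hv)
  have h4 := (integrableOn_fun_norm_addHaar (E := Vel d) volume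
    (f := fun t => equilProfile d γ t * (e t * t))).mp h1
  simpa using h4

/-- The identity satisfied by the radial profile of the friction force. -/
lemma friction_profile_eq (hd : 1 ≤ d) {γ σ : ℝ} (h0 : 0 < σ) (h2 : σ < 2) (hγ : 0 < γ)
    {E : Vel d → Vel d} (hE : IsFriction γ σ E) {e : ℝ → ℝ} (he : ∀ v, E v = e ‖v‖ • v) :
    ∀ᵐ t : ℝ, t ∈ Ioi (0 : ℝ) → (∫ v in Metric.ball (0 : Vel d) t, fracLap σ (equil γ) v) +
      d * volume.real (Metric.ball (0 : Vel d) 1) *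
        (t ^ (d - 1) * (equilProfile d γ t * (e t * t))) = 0 := by
  have : Nontrivial (Vel d) := Module.nontrivial_of_finrank_pos (R := ℝ) (by simp; omega)
  have hpi := integrable_fracLap_equil (d := d) hd h0 h2 hγ
  set p := fracLap σ (equil γ : Vel d → ℝ) with hp
  have hpm : Measurable p := measurable_fracLap σ (continuous_equil γ)
  set κ : ℝ := d * volume.real (Metric.ball (0 : Vel d) 1) with hκ
  set G : ℝ → ℝ := fun t => ∫ v in Metric.ball (0 : Vel d) t, p v with hG
  set S : Set (Vel d × ℝ) := {q | ‖q.1‖ < q.2} with hS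
  have hSm : MeasurableSet S := measurableSet_lt (by fun_prop) (by fun_prop)
  have hGi : ∀ t, G t = ∫ v, S.indicator (fun q => p q.1) (v, t) := fun t => by
    rw [hG]
    simp only
    rw [← integral_indicator measurableSet_ball]
    congr with v
    simp [indicator, hS]
  have hGm : Measurable G := by
    have h1 : Measurable (S.indicator fun q : Vel d × ℝ => p q.1) :=
      (hpm.comp measurable_fst).indicator hSm
    have h3 := (h1.comp measurable_swap).stronglyMeasurable.integral_prod_right' (ν := volume)
    rw [funext hGi]
    exact h3.measurable
  have hGb : ∀ t, ‖G t‖ ≤ ∫ v, ‖p v‖ := fun t =>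
    (norm_integral_le_integral_norm _).trans
      (setIntegral_le_integral hpi.norm (ae_of_all _ fun v => norm_nonneg _))
  have hloc : LocallyIntegrableOn (fun t => G t + κ * (t ^ (d - 1) * (equilProfile d γ t * (e t * t))))
      (Ioi 0) := by
    refine LocallyIntegrableOn.add ?_ ?_
    · have : LocallyIntegrable G :=
        (locallyIntegrable_const (∫ v, ‖p v‖)).mono hGm.aestronglyMeasurable
          (ae_of_all _ fun t => (hGb t).trans (le_abs_self _))
      exact this.locallyIntegrableOn _
    · rw [locallyIntegrableOn_iff isOpen_Ioi.isLocallyClosed]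
      intro Kc hKs hKc
      obtain ⟨r, hr⟩ := hKc.isBounded.subset_ball 0
      refine ((integrableOn_friction_profile hd hE.locInt he r).mono_set fun t ht => ?_).const_mul κ
      have := hr ht
      rw [Metric.mem_ball, Real.dist_eq, sub_zero] at this
      exact ⟨hKs ht, (le_abs_self t).trans_lt this⟩
  refine isOpen_Ioi.ae_eq_zero_of_integral_contDiff_smul_eq_zero hloc fun k hk hks hkp => ?_
  have hki : Integrable k := hk.continuous.integrable_of_hasCompactSupport hks
  have heq := hE.equation _ (isTest_tailInt_norm hk hks hkp)
  have kz : ∀ t, t ∉ Ioi (0 : ℝ) → k t = 0 := fun t ht => by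
    by_contra hne
    exact ht (hkp (subset_tsupport k hne))
  -- left-hand side
  have hint : Integrable (S.indicator fun q : Vel d × ℝ => p q.1 * k q.2)
      (volume.prod volume) := (hpi.mul_prod hki).indicator hSm
  have lhs : ∫ v, p v * tailInt k ‖v‖ = ∫ t, k t * G t := by
    calc ∫ v, p v * tailInt k ‖v‖ = ∫ v, ∫ t, S.indicator (fun q : Vel d × ℝ => p q.1 * k q.2) (v, t) := by
          congr with v
          rw [tailInt_eq hk.continuous hks, ← integral_indicator measurableSet_Ioi,
            ← integral_const_mul]
          congr with t
          simp [indicator, hS]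
      _ = ∫ t, ∫ v, S.indicator (fun q : Vel d × ℝ => p q.1 * k q.2) (v, t) :=
          integral_integral_swap (f := fun v t => S.indicator _ (v, t)) hint
      _ = _ := by
          congr with t
          rw [hGi, ← integral_const_mul]
          congr with v
          by_cases hvt : (v, t) ∈ S
          · rw [indicator_of_mem hvt, indicator_of_mem hvt, mul_comm]
          · rw [indicator_of_notMem hvt, indicator_of_notMem hvt, mul_zero]
  have rhs : ∫ v, equil γ v * inner ℝ (E v) (gradient (fun v : Vel d => tailInt k ‖v‖) v) =
      -∫ t, k t * (κ * (t ^ (d - 1) * (equilProfile d γ t * (e t * t)))) := by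
    have h3 : ∀ v : Vel d, equil γ v * inner ℝ (E v) (gradient (fun v : Vel d => tailInt k ‖v‖) v) =
        (fun t => equilProfile d γ t * (e t * (-k t * t))) ‖v‖ := fun v => by
      rw [friction_inner he, fderiv_tailInt_norm hk hks hkp, equil_eq_profile]
    simp_rw [h3]
    have h4 : ∫ t in Ioi (0 : ℝ), k t * (κ * (t ^ (d - 1) * (equilProfile d γ t * (e t * t)))) =
        ∫ t, k t * (κ * (t ^ (d - 1) * (equilProfile d γ t * (e t * t)))) :=
      setIntegral_eq_integral_of_forall_compl_eq_zero fun t ht => by rw [kz t ht, zero_mul]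
    rw [integral_fun_norm_addHaar volume (fun t => equilProfile d γ t * (e t * (-k t * t))),
      ← h4, ← integral_neg, nsmul_eq_mul, smul_eq_mul, ← mul_assoc, ← integral_const_mul]
    congr with t
    simp only [finrank_euclideanSpace, Fintype.card_fin, smul_eq_mul, hκ]
    ring
  rw [lhs, rhs] at heq
  have hkG : Integrable fun t => k t * G t :=
    hki.mul_bdd (c := ∫ v, ‖p v‖) hGm.aestronglyMeasurable (ae_of_all _ hGb)
  have hkE : Integrable fun t => k t * (κ * (t ^ (d - 1) * (equilProfile d γ t * (e t * t)))) := by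
    obtain ⟨M, hM⟩ := hks.isBounded.subset_ball 0
    obtain ⟨B, hB⟩ := hks.exists_bound_of_continuous hk.continuous
    have h5 := (integrableOn_friction_profile (γ := γ) hd hE.locInt he M).const_mul κ
    have h6 := h5.bdd_mul (c := B) hk.continuous.aestronglyMeasurable (ae_of_all _ hB)
    refine (integrableOn_iff_integrable_of_support_subset fun t ht => ?_).mp h6
    have hkt : k t ≠ 0 := fun h => ht (by simp [h])
    have h7 := subset_tsupport k hkt
    have h8 := hM h7
    rw [Metric.mem_ball, Real.dist_eq, sub_zero] at h8
    exact ⟨hkp h7, (le_abs_self t).trans_lt h8⟩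
  simp only [smul_eq_mul, mul_add]
  rw [integral_add hkG hkE, heq]
  ring

/-- Growth of the friction force. -/
lemma exists_friction_le (hd : 1 ≤ d) {γ β σ : ℝ} (h0 : 0 < σ) (h2 : σ < 2) (hγ : 0 < γ)
    (hβ : β = σ - γ) {E : Vel d → Vel d} (hE : IsFriction γ σ E) :
    ∃ K : ℝ, 0 ≤ K ∧ ∀ᵐ v : Vel d, ‖E v‖ ≤ K * jap v ^ (1 - β) := by
  obtain ⟨e, he⟩ := hE.radial
  obtain ⟨K, hK, hb⟩ := exists_mass_ball_le (d := d) hd h0 h2 hγ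
  have hc := cGamma_pos hd hγ
  have hvol : 0 < volume.real (Metric.ball (0 : Vel d) 1) :=
    ENNReal.toReal_pos (Metric.measure_ball_pos _ _ one_pos).ne' measure_ball_lt_top.ne
  have hd0 : (0 : ℝ) < d := by exact_mod_cast hd
  set κ : ℝ := d * volume.real (Metric.ball (0 : Vel d) 1) with hκ
  have hκ0 : 0 < κ := by positivity
  clear_value κ
  refine ⟨K / (κ * cGamma d γ), by positivity, ?_⟩
  have key : ∀ᵐ t : ℝ, t ∈ Ioi (0 : ℝ) →
      |e t * t| ≤ K / (κ * cGamma d γ) * (1 + t ^ 2) ^ ((1 - β) / 2) := by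
    filter_upwards [friction_profile_eq hd h0 h2 hγ hE he] with t ht ht0
    have ht0' : 0 < t := ht0
    have h3 := hb t ht0
    have ht1 := ht ht0
    rw [← hκ] at ht1
    rw [eq_neg_of_add_eq_zero_left ht1, abs_neg, abs_mul, abs_mul, abs_mul, abs_of_pos hκ0,
      abs_of_pos (by positivity : 0 < t ^ (d - 1)), equilProfile, abs_of_pos (by positivity)] at h3
    have h4 : (1 + t ^ 2) ^ ((1 - (d : ℝ) - σ) / 2) =
        (1 + t ^ 2) ^ ((1 - β) / 2) * (1 + t ^ 2) ^ (-((d : ℝ) + γ) / 2) := by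
      rw [← Real.rpow_add (by positivity), hβ]
      congr 1
      ring
    rw [h4] at h3
    have hP : 0 < t ^ (d - 1) * (1 + t ^ 2) ^ (-((d : ℝ) + γ) / 2) := by positivity
    rw [div_mul_eq_mul_div, le_div_iff₀ (by positivity)]
    refine le_of_mul_le_mul_right ?_ hP
    calc _ = κ * (t ^ (d - 1) * (cGamma d γ * (1 + t ^ 2) ^ (-((d : ℝ) + γ) / 2) * |e t * t|)) := by
          ring
      _ ≤ _ := h3
      _ = _ := by ring
  filter_upwards [ae_norm_of_ae hd key] with v hv
  rw [he, norm_smul, Real.norm_eq_abs, jap_eq_rpow]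
  rcases (norm_nonneg v).eq_or_lt with h | h
  · rw [← h, mul_zero]
    positivity
  · have := hv h
    rwa [abs_mul, abs_norm] at this

end Friction

section ControlledObservables

variable {d : ℕ}

/-- The observable `ψ` is approximated by test functions `ζ n` along which the adjoint collision
operator is dominated by `G ^ (1/2)` and converges to `T`; the weighted integral of `G` is at
most `Q`. -/
structure Controlled (γ η : ℝ) (L : Collision d) (ψ : Vel d → ℝ) (Q : ℝ≥0∞)
    (ζ : ℕ → Vel d → ℝ) (T : Vel d → ℝ) (G : Vel d → ℝ≥0∞) : Prop where
  test : ∀ n, IsTest (ζ n)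
  le : ∀ n v, |ζ n v| ≤ |ψ v|
  tendsto : ∀ v, Tendsto (fun n => ζ n v) atTop (𝓝 (ψ v))
  meas_adj : ∀ n, AEStronglyMeasurable (L.adj γ (ζ n)) volume
  meas_G : Measurable G
  adj_le : ∀ n, ∀ᵐ v, ‖L.adj γ (ζ n) v‖ₑ ^ 2 ≤ G v
  adj_tendsto : ∀ᵐ v, Tendsto (fun n => L.adj γ (ζ n) v) atTop (𝓝 (T v))
  lintegral_le : ∫⁻ v, G v * wtF γ (-η) v ≤ Q
  integral_zero : ∀ n, ∫ v, L.adj γ (ζ n) v * equil γ v = 0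

/-- Truncation of a function by cutoffs. -/
def trunc (ψ : Vel d → ℝ) (n : ℕ) (v : Vel d) : ℝ := cutoff ((n : ℝ) + 1) v * ψ v

/-- The weighted integral controlling observables of size `m`. -/
def envInt (γ β : ℝ) (m : Vel d → ℝ) : ℝ≥0∞ := ∫⁻ v, ENNReal.ofReal (m v) ^ 2 * wtF γ (-β) v

section Trunc

variable {m ψ : Vel d → ℝ} {C A : ℝ}

lemma isTest_trunc (hψ : ContDiff ℝ ∞ ψ) (n : ℕ) : IsTest (trunc ψ n) :=
  isTest_cutoff_mul (by positivity) hψ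

lemma abs_trunc_le (ψ : Vel d → ℝ) (n : ℕ) (v : Vel d) : |trunc ψ n v| ≤ |ψ v| := by
  rw [trunc, abs_mul, abs_of_nonneg (cutoff_nonneg _ _)]
  exact mul_le_of_le_one_left (abs_nonneg _) (cutoff_le_one _ _)

lemma eventually_trunc_eq (ψ : Vel d → ℝ) (v : Vel d) :
    ∀ᶠ n : ℕ in atTop, trunc ψ n =ᶠ[𝓝 v] ψ := by
  filter_upwards [eventually_gt_atTop ⌈jap v⌉₊] with n hn
  have h1 : jap v < (n : ℝ) + 1 := by
    have := Nat.le_ceil (jap v)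
    have : ((⌈jap v⌉₊ : ℕ) : ℝ) < n := by exact_mod_cast hn
    linarith
  filter_upwards [continuous_jap.continuousAt.eventually (gt_mem_nhds h1)] with w hw
  rw [trunc, cutoff_eq_one (by positivity) (le_of_lt hw), one_mul]

lemma tendsto_trunc (ψ : Vel d → ℝ) (v : Vel d) :
    Tendsto (fun n => trunc ψ n v) atTop (𝓝 (ψ v)) := by
  refine tendsto_const_nhds.congr' ?_
  filter_upwards [eventually_trunc_eq ψ v] with n hn using hn.eq_of_nhds.symm

lemma exists_symBound_trunc (d : ℕ) (C : ℝ) (hC : 0 ≤ C) : ∃ C' : ℝ, 0 ≤ C' ∧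
    ∀ (m ψ : Vel d → ℝ), SymBound m C ψ → ∀ n, SymBound m C' (trunc ψ n) := by
  obtain ⟨Cc, hCc, hb⟩ := exists_symBound_cutoff d
  refine ⟨4 * (Cc * C), by positivity, fun m ψ hψ n => ?_⟩
  exact ((hb (n + 1) (by positivity)).mul hψ).mono fun v => by rw [one_mul]

end Trunc

lemma wtF_mono {γ k l : ℝ} (hF : ∀ v : Vel d, 0 ≤ equil γ v) (h : k ≤ l) (v : Vel d) :
    wtF γ k v ≤ wtF γ l v := by
  refine ENNReal.ofReal_le_ofReal ?_
  have := hF v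
  gcongr
  exact one_le_jap v

lemma ofReal_jap_mul_wtF (γ k l : ℝ) (v : Vel d) :
    ENNReal.ofReal (jap v ^ k) * wtF γ l v = wtF γ (k + l) v := by
  rw [wtF, wtF, ← ENNReal.ofReal_mul (jap_rpow_pos v k).le, Real.rpow_add (jap_pos v), mul_assoc]

lemma lintegral_env_le {γ β k l : ℝ} (hF : ∀ v : Vel d, 0 ≤ equil γ v) (h : k + l ≤ -β) (K : ℝ)
    {m : Vel d → ℝ} (hm : Measurable m) :
    ∫⁻ v, ENNReal.ofReal K * (ENNReal.ofReal (m v) ^ 2 * ENNReal.ofReal (jap v ^ k)) * wtF γ l v ≤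
      ENNReal.ofReal K * envInt γ β m := by
  rw [envInt, ← lintegral_const_mul _ (by fun_prop)]
  refine lintegral_mono fun v => ?_
  rw [mul_assoc, mul_assoc, ofReal_jap_mul_wtF]
  gcongr
  exact wtF_mono hF h v

section FokkerPlanck

variable {γ : ℝ}

lemma adj_fokkerPlanck_eq (γ : ℝ) (ζ : Vel d → ℝ) (v : Vel d) : Collision.fokkerPlanck.adj γ ζ v = (equil γ v)⁻¹ * ∑ i : Fin d,
      fderiv ℝ (fun w => equil γ w * fderiv ℝ ζ w (EuclideanSpace.single i 1)) v
        (EuclideanSpace.single i 1) := by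
  simp only [Collision.adj, diverg]
  congr 2 with i
  congr 2 with w
  have h1 : (gradient ζ w) i = inner ℝ (gradient ζ w) (EuclideanSpace.single i (1 : ℝ)) := by
    rw [EuclideanSpace.inner_single_right]; simp
  rw [PiLp.smul_apply, smul_eq_mul, h1, inner_gradient_left]

lemma fderiv_equil_mul (hd : 1 ≤ d) (hγ : 0 < γ) {ζ : Vel d → ℝ} (hζ : ContDiff ℝ ∞ ζ)
    (v x : Vel d) : fderiv ℝ (fun w => equil γ w * fderiv ℝ ζ w x) v x =
      equil γ v * fderiv ℝ (fderiv ℝ ζ) v x x + fderiv ℝ ζ v x * fderiv ℝ (equil γ) v x := by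
  have hF := equil_symBound (d := d) hd hγ
  have h1 : Differentiable ℝ (fderiv ℝ ζ) :=
    (hζ.fderiv_right (m := ∞) (by simp)).differentiable (by simp)
  have h2 : HasFDerivAt (fun w => fderiv ℝ ζ w x)
      ((ContinuousLinearMap.apply ℝ ℝ x).comp (fderiv ℝ (fderiv ℝ ζ) v)) v :=
    (ContinuousLinearMap.apply ℝ ℝ x).hasFDerivAt.comp v (h1 v).hasFDerivAt
  rw [((hF.differentiable v).hasFDerivAt.fun_mul h2).fderiv]
  simp

lemma abs_adj_fokkerPlanck_le (hd : 1 ≤ d) (hγ : 0 < γ) {ζ m : Vel d → ℝ} {C : ℝ}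
    (hζ : SymBound m C ζ) (v : Vel d) :
    |Collision.fokkerPlanck.adj γ ζ v| ≤
      d * (1 + 6 * (1 + |-((d : ℝ) + γ)|) ^ 2) * C * (m v * jap v ^ (-2 : ℝ)) := by
  have hF := equil_symBound (d := d) hd hγ
  have hFv := equil_pos hd hγ v
  have hj := jap_pos v
  set C₁ : ℝ := 6 * (1 + |-((d : ℝ) + γ)|) ^ 2 with hC₁
  have h0 : (0 : ℝ) ≤ C₁ := by positivity
  have hF' : ‖fderiv ℝ (equil γ) v‖ ≤ C₁ * equil γ v / jap v := by
    refine (hF.bound_fderiv v).trans (le_of_eq ?_)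
    rw [equil]
    ring
  have hn : ∀ i : Fin d, ‖(EuclideanSpace.single i (1 : ℝ) : Vel d)‖ = 1 := fun i => by simp
  rw [adj_fokkerPlanck_eq, abs_mul, abs_of_pos (inv_pos.mpr hFv)]
  have hterm : ∀ i : Fin d, |fderiv ℝ (fun w => equil γ w * fderiv ℝ ζ w (EuclideanSpace.single i 1)) v
        (EuclideanSpace.single i 1)| ≤ equil γ v * ((1 + C₁) * (C * m v / jap v ^ 2)) := fun i => by
    rw [fderiv_equil_mul hd hγ hζ.smooth]
    have a1 : |fderiv ℝ (fderiv ℝ ζ) v (EuclideanSpace.single i 1) (EuclideanSpace.single i 1)| ≤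
        C * m v / jap v ^ 2 := by
      refine ((fderiv ℝ (fderiv ℝ ζ) v).le_opNorm₂ _ _).trans ?_
      rw [hn, mul_one, mul_one]
      exact hζ.bound_fderiv2 v
    have a2 : |fderiv ℝ ζ v (EuclideanSpace.single i 1)| ≤ C * m v / jap v := by
      refine ((fderiv ℝ ζ v).le_opNorm _).trans ?_
      rw [hn, mul_one]
      exact hζ.bound_fderiv v
    have a3 : |fderiv ℝ (equil γ) v (EuclideanSpace.single i 1)| ≤ C₁ * equil γ v / jap v := by
      refine ((fderiv ℝ (equil γ) v).le_opNorm _).trans ?_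
      rw [hn, mul_one]
      exact hF'
    have hCm := hζ.nonneg v
    calc _ ≤ equil γ v * (C * m v / jap v ^ 2) + (C * m v / jap v) * (C₁ * equil γ v / jap v) := by
          refine (abs_add_le _ _).trans ?_
          rw [abs_mul, abs_mul, abs_of_pos hFv]
          gcongr
      _ = _ := by
          field_simp
  calc _ ≤ (equil γ v)⁻¹ * ∑ i : Fin d, equil γ v * ((1 + C₁) * (C * m v / jap v ^ 2)) := by
        gcongr
        exact (Finset.abs_sum_le_sum_abs _ _).trans (Finset.sum_le_sum fun i _ => hterm i)
    _ = _ := by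
        rw [Finset.sum_const, Finset.card_univ, Fintype.card_fin, nsmul_eq_mul,
          Real.rpow_neg hj.le, Real.rpow_two]
        field_simp

lemma continuous_adj_fokkerPlanck (hd : 1 ≤ d) (hγ : 0 < γ) {ζ : Vel d → ℝ}
    (hζ : ContDiff ℝ ∞ ζ) : Continuous (Collision.fokkerPlanck.adj γ ζ) := by
  rw [funext (adj_fokkerPlanck_eq γ ζ)]
  refine ((continuous_equil γ).inv₀ fun v => (equil_pos hd hγ v).ne').mul
    (continuous_finsetSum _ fun i _ => ?_)
  have hF := (equil_symBound (d := d) hd hγ).smooth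
  have h1 : ContDiff ℝ ∞ (fun w => equil γ w * fderiv ℝ ζ w (EuclideanSpace.single i 1)) :=
    hF.mul ((hζ.fderiv_right (m := ∞) (by simp)).clm_apply contDiff_const)
  exact (h1.continuous_fderiv (by simp)).clm_apply continuous_const

lemma integral_adj_fokkerPlanck (hd : 1 ≤ d) (hγ : 0 < γ) {ζ : Vel d → ℝ} (hζ : IsTest ζ) :
    ∫ v, Collision.fokkerPlanck.adj γ ζ v * equil γ v = 0 := by
  have hF := (equil_symBound (d := d) hd hγ).smooth
  set g : Fin d → Vel d → ℝ := fun i w => equil γ w * fderiv ℝ ζ w (EuclideanSpace.single i 1) with hg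
  have h1 : ∀ i, ContDiff ℝ ∞ (g i) := fun i =>
    hF.mul ((hζ.1.fderiv_right (m := ∞) (by simp)).clm_apply contDiff_const)
  have h2 : ∀ i, HasCompactSupport (g i) := fun i => (hζ.2.fderiv_apply ℝ _).mul_left
  have h3 : ∀ i, Integrable fun v => fderiv ℝ (g i) v (EuclideanSpace.single i 1) := fun i =>
    (((h1 i).continuous_fderiv (by simp)).clm_apply
      continuous_const).integrable_of_hasCompactSupport ((h2 i).fderiv_apply ℝ _)
  have h4 : ∀ i, ∫ v, fderiv ℝ (g i) v (EuclideanSpace.single i 1) = 0 := fun i => by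
    have := integral_mul_fderiv_eq_neg_fderiv_mul_of_integrable (μ := (volume : Measure (Vel d)))
      (f := fun _ => (1 : ℝ)) (g := g i) (v := EuclideanSpace.single i 1) (by simp)
      (by simpa using h3 i)
      (by simpa using (h1 i).continuous.integrable_of_hasCompactSupport (h2 i))
      (fun x _ => by fun_prop) (fun x _ => (h1 i).differentiable (by simp) x)
    simpa using this
  have h5 : ∀ v, Collision.fokkerPlanck.adj γ ζ v * equil γ v =
      ∑ i, fderiv ℝ (g i) v (EuclideanSpace.single i 1) := fun v => by
    have := (equil_pos hd hγ v).ne'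
    rw [adj_fokkerPlanck_eq, mul_comm, mul_inv_cancel_left₀ this]
  simp_rw [h5]
  rw [integral_finsetSum _ fun i _ => h3 i]
  exact Finset.sum_eq_zero fun i _ => h4 i

lemma adj_fokkerPlanck_congr (hd : 1 ≤ d) (hγ : 0 < γ) {ζ ψ : Vel d → ℝ}
    (hζ : ContDiff ℝ ∞ ζ) (hψ : ContDiff ℝ ∞ ψ) {v : Vel d} (h : ζ =ᶠ[𝓝 v] ψ) :
    Collision.fokkerPlanck.adj γ ζ v = Collision.fokkerPlanck.adj γ ψ v := by
  rw [adj_fokkerPlanck_eq, adj_fokkerPlanck_eq]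
  simp_rw [fderiv_equil_mul hd hγ hζ, fderiv_equil_mul hd hγ hψ]
  rw [h.fderiv_eq, (h.fderiv (𝕜 := ℝ)).fderiv_eq]

lemma exists_controlled_fokkerPlanck (hd : 1 ≤ d) (hγ : 0 < γ) {η : ℝ} (hη : -2 ≤ η)
    (A C : ℝ) (hC : 0 ≤ C) : ∃ K : ℝ, ∀ m ψ : Vel d → ℝ, SymBound m C ψ → Envelope m A →
      ∃ T G, Controlled γ η .fokkerPlanck ψ (ENNReal.ofReal K * envInt γ 2 m) (trunc ψ) T G := by
  obtain ⟨C', hC', hb⟩ := exists_symBound_trunc d C hC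
  set K₀ : ℝ := d * (1 + 6 * (1 + |-((d : ℝ) + γ)|) ^ 2) * C' with hK₀
  have hK₀' : 0 ≤ K₀ := by positivity
  refine ⟨K₀ ^ 2, fun m ψ hψ hm => ⟨Collision.fokkerPlanck.adj γ ψ, fun v =>
    ENNReal.ofReal (K₀ ^ 2) * (ENNReal.ofReal (m v) ^ 2 * ENNReal.ofReal (jap v ^ (-4 : ℝ))), ?_⟩⟩
  have hmm := hm.continuous.measurable
  refine ⟨isTest_trunc hψ.smooth, abs_trunc_le ψ, tendsto_trunc ψ, fun n =>
    (continuous_adj_fokkerPlanck hd hγ (isTest_trunc hψ.smooth n).1).aestronglyMeasurable,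
    by fun_prop, fun n => ae_of_all _ fun v => ?_, ae_of_all _ fun v => ?_,
    lintegral_env_le (fun v => (equil_pos hd hγ v).le) (by linarith) _ hmm,
    fun n => integral_adj_fokkerPlanck hd hγ (isTest_trunc hψ.smooth n)⟩
  · have h := abs_adj_fokkerPlanck_le hd hγ (hb m ψ hψ n) v
    have hmv := hm.nonneg v
    have hj := jap_pos v
    rw [← hK₀] at h
    rw [Real.enorm_eq_ofReal_abs, ← ENNReal.ofReal_pow (abs_nonneg _), ← ENNReal.ofReal_pow hmv,
      ← ENNReal.ofReal_mul (by positivity), ← ENNReal.ofReal_mul (by positivity)]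
    refine ENNReal.ofReal_le_ofReal ((pow_le_pow_left₀ (abs_nonneg _) h 2).trans (le_of_eq ?_))
    rw [show (-4 : ℝ) = -2 + -2 by norm_num, Real.rpow_add hj]
    ring
  · refine tendsto_const_nhds.congr' ?_
    filter_upwards [eventually_trunc_eq ψ v] with n hn
    exact (adj_fokkerPlanck_congr hd hγ (isTest_trunc hψ.smooth n).1 hψ.smooth hn).symm

end FokkerPlanck

end ControlledObservables

section Scattering

variable {d : ℕ} {γ β : ℝ} {b : Vel d → Vel d → ℝ}

namespace ScatteringAssumption

lemma kernel_nonneg (hb : ScatteringAssumption γ β b) (v : Vel d) : ∀ᵐ w, 0 ≤ b v w := by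
  obtain ⟨Z, hZ, h⟩ := hb.lower
  filter_upwards [h v] with w hw
  have h1 := jap_rpow_pos v (-β)
  have h2 := jap_rpow_pos w (-β)
  exact le_trans (by positivity) hw

lemma measurable_collFreq (hb : ScatteringAssumption γ β b) : Measurable (collFreq γ b) := by
  have h : Measurable fun p : Vel d × Vel d => b p.1 p.2 * equil γ p.2 :=
    hb.measurable.mul ((measurable_equil γ).comp measurable_snd)
  exact (h.stronglyMeasurable.integral_prod_right' (ν := volume)).measurable

/-- Upper bound on the collision frequency. -/
lemma exists_collFreq_le (hb : ScatteringAssumption γ β b) :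
    ∃ K : ℝ, 0 ≤ K ∧ ∀ v, collFreq γ b v ≤ K * jap v ^ (-β) := by
  obtain ⟨K₁, hK₁, h1⟩ := hb.freq_equiv.isBigO.exists_pos
  have h2 := h1.bound
  obtain ⟨s, hs, hsub⟩ := Filter.mem_cocompact.mp h2
  obtain ⟨r, hr⟩ := hs.isBounded.subset_closedBall 0
  obtain ⟨K₂, h3⟩ := hb.freq_locBdd (max r 1)
  refine ⟨K₁ * 2 ^ |-β| + |K₂| * (1 + max r 1) ^ |β|, by positivity, fun v => ?_⟩
  have hj := jap_pos v
  have hjb := jap_rpow_pos v (-β)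
  have hm : (0 : ℝ) < max r 1 := lt_max_of_lt_right one_pos
  rw [add_mul]
  rcases le_or_gt ‖v‖ (max r 1) with hv | hv
  · have h4 : jap v ^ β ≤ (1 + max r 1) ^ |β| := by
      refine (jap_rpow_mono v (le_abs_self β)).trans (Real.rpow_le_rpow hj.le ?_ (abs_nonneg β))
      exact (jap_le_one_add_norm v).trans (by linarith)
    have h5 : jap v ^ β * jap v ^ (-β) = 1 := by rw [← Real.rpow_add hj]; simp
    calc collFreq γ b v ≤ |K₂| * (jap v ^ β * jap v ^ (-β)) := by
          rw [h5, mul_one]; exact (h3 v hv).trans (le_abs_self _)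
      _ ≤ |K₂| * (1 + max r 1) ^ |β| * jap v ^ (-β) := by rw [← mul_assoc]; gcongr
      _ ≤ _ := by
          have : 0 ≤ K₁ * 2 ^ |-β| * jap v ^ (-β) := by positivity
          linarith
  · have h4 : v ∈ sᶜ := fun hin => by
      have := hr hin
      rw [mem_closedBall_zero_iff] at this
      linarith [le_max_left r 1]
    have h5 : ‖collFreq γ b v‖ ≤ K₁ * ‖‖v‖ ^ (-β)‖ := hsub h4
    have hv1 : 1 < ‖v‖ := (le_max_right r 1).trans_lt hv
    have hv0 : 0 < ‖v‖ := by linarith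
    rw [Real.norm_of_nonneg (by positivity : (0 : ℝ) ≤ ‖v‖ ^ (-β))] at h5
    have h6 := rpow_le_of_comparable hv0 hj ((norm_le_jap v).trans (by linarith))
      ((jap_le_one_add_norm v).trans (by linarith)) (-β)
    calc collFreq γ b v ≤ K₁ * ‖v‖ ^ (-β) := (le_abs_self _).trans h5
      _ ≤ K₁ * (2 ^ |-β| * jap v ^ (-β)) := by gcongr
      _ ≤ _ := by
          have : 0 ≤ |K₂| * (1 + max r 1) ^ |β| * jap v ^ (-β) := by positivity
          linarith

end ScatteringAssumption

/-- The gain part of the adjoint of the scattering operator. -/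
def gain (γ : ℝ) (b : Vel d → Vel d → ℝ) (ζ : Vel d → ℝ) (v : Vel d) : ℝ :=
  ∫ w, b w v * ζ w * equil γ w

/-- `∫ b(w,v)² F(w) / ν(w) dw`. -/
def gainWeight (γ : ℝ) (b : Vel d → Vel d → ℝ) (v : Vel d) : ℝ≥0∞ :=
  ∫⁻ w, ENNReal.ofReal (b w v ^ 2 / collFreq γ b w * equil γ w)

lemma measurable_gainIntegrand (hb : ScatteringAssumption γ β b) {ζ : Vel d → ℝ}
    (hζ : Measurable ζ) :
    Measurable fun p : Vel d × Vel d => b p.2 p.1 * ζ p.2 * equil γ p.2 :=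
  ((hb.measurable.comp measurable_swap).mul (hζ.comp measurable_snd)).mul
    ((measurable_equil γ).comp measurable_snd)

lemma measurable_gain (hb : ScatteringAssumption γ β b) {ζ : Vel d → ℝ} (hζ : Measurable ζ) :
    Measurable (gain γ b ζ) :=
  ((measurable_gainIntegrand hb hζ).stronglyMeasurable.integral_prod_right'
    (ν := volume)).measurable

lemma measurable_gainWeight (hb : ScatteringAssumption γ β b) :
    Measurable (gainWeight γ b) := by
  have h : Measurable fun p : Vel d × Vel d =>
      ENNReal.ofReal (b p.2 p.1 ^ 2 / collFreq γ b p.2 * equil γ p.2) :=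
    ((((hb.measurable.comp measurable_swap).pow_const 2).div
      (hb.measurable_collFreq.comp measurable_snd)).mul
      ((measurable_equil γ).comp measurable_snd)).ennreal_ofReal
  exact h.lintegral_prod_right'

lemma lintegral_gainWeight_lt_top (hd : 1 ≤ d) (hγ : 0 < γ) (hb : ScatteringAssumption γ β b)
    {η : ℝ} (hη : -β ≤ η) : ∫⁻ v, gainWeight γ b v * wtF γ (-η) v < ⊤ := by
  obtain ⟨K, hK, hν⟩ := hb.exists_collFreq_le
  have hF : ∀ v : Vel d, 0 < equil γ v := equil_pos hd hγ
  have hsq := hb.square.lintegral_lt_top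
  have hbw : ∀ v : Vel d, Measurable fun w => b w v := fun v =>
    hb.measurable.comp (measurable_id.prodMk measurable_const)
  have hm : AEMeasurable (fun p : Vel d × Vel d => ENNReal.ofReal (b p.2 p.1 ^ 2 /
      (collFreq γ b p.2 * collFreq γ b p.1) * equil γ p.1 * equil γ p.2))
      (volume.prod volume) := hb.square.aestronglyMeasurable.aemeasurable.ennreal_ofReal
  have hv : (volume : Measure (Vel d × Vel d)) = volume.prod volume := rfl
  rw [hv, lintegral_prod _ hm] at hsq
  calc ∫⁻ v, gainWeight γ b v * wtF γ (-η) v ≤ ∫⁻ v, ENNReal.ofReal K * ∫⁻ w,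
        ENNReal.ofReal (b w v ^ 2 / (collFreq γ b w * collFreq γ b v) * equil γ v * equil γ w) := by
        refine lintegral_mono fun v => ?_
        rw [gainWeight, ← lintegral_mul_const _ (by have := hbw v; have := hb.measurable_collFreq; fun_prop),
          ← lintegral_const_mul _ (by have := hbw v; have := hb.measurable_collFreq; fun_prop)]
        refine lintegral_mono fun w => ?_
        have f1 := hb.freq_pos v
        have f2 := hb.freq_pos w
        have F1 := hF v
        have F2 := hF w
        have J := jap_rpow_pos v (-η)
        rw [wtF, ← ENNReal.ofReal_mul (by positivity), ← ENNReal.ofReal_mul (by positivity)]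
        refine ENNReal.ofReal_le_ofReal ?_
        have h1 : jap v ^ (-η) * collFreq γ b v ≤ K := by
          calc jap v ^ (-η) * collFreq γ b v ≤ jap v ^ (-η) * (K * jap v ^ (-β)) := by
                gcongr; exact hν v
            _ = K * jap v ^ (-η + -β) := by rw [Real.rpow_add (jap_pos v)]; ring
            _ ≤ K * 1 := by gcongr; exact jap_rpow_le_one v (by linarith)
            _ = K := mul_one K
        calc b w v ^ 2 / collFreq γ b w * equil γ w * (jap v ^ (-η) * equil γ v) =
            (jap v ^ (-η) * collFreq γ b v) * (b w v ^ 2 / (collFreq γ b w * collFreq γ b v) *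
              equil γ v * equil γ w) := by field_simp
          _ ≤ _ := by gcongr
    _ = ENNReal.ofReal K * _ := lintegral_const_mul'' _ hm.lintegral_prod_right'
    _ < ⊤ := ENNReal.mul_lt_top ENNReal.ofReal_lt_top hsq

lemma enorm_gain_sq_le (hd : 1 ≤ d) (hγ : 0 < γ) (hb : ScatteringAssumption γ β b) {K C : ℝ}
    (hK : 0 ≤ K) (hν : ∀ v, collFreq γ b v ≤ K * jap v ^ (-β)) {m ζ : Vel d → ℝ}
    (hζ : ∀ v, |ζ v| ≤ C * m v) (hm : Measurable m) (hm0 : ∀ v, 0 ≤ m v) (hζm : Measurable ζ) (v : Vel d) :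
    ‖gain γ b ζ v‖ₑ ^ 2 ≤ gainWeight γ b v * (ENNReal.ofReal (C ^ 2 * K) * envInt γ β m) := by
  have hF : ∀ v : Vel d, 0 < equil γ v := equil_pos hd hγ
  have hbw : Measurable fun w => b w v :=
    hb.measurable.comp (measurable_id.prodMk measurable_const)
  have hνm := hb.measurable_collFreq
  set f : Vel d → ℝ≥0∞ := fun w => ENNReal.ofReal (|b w v| * √(equil γ w / collFreq γ b w)) with hf
  set g : Vel d → ℝ≥0∞ := fun w => ENNReal.ofReal (|ζ w| * √(collFreq γ b w * equil γ w)) with hg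
  have h1 : ‖gain γ b ζ v‖ₑ ≤ ∫⁻ w, f w * g w := by
    refine (enorm_integral_le_lintegral_enorm _).trans (le_of_eq ?_)
    congr with w
    have f2 := hb.freq_pos w
    have F2 := hF w
    rw [hf, hg, ← ENNReal.ofReal_mul (by positivity), Real.enorm_eq_ofReal_abs, abs_mul, abs_mul,
      abs_of_pos F2]
    congr 1
    have h3 : √(equil γ w / collFreq γ b w) * √(collFreq γ b w * equil γ w) = equil γ w := by
      rw [← Real.sqrt_mul (by positivity), show equil γ w / collFreq γ b w *
        (collFreq γ b w * equil γ w) = equil γ w ^ 2 by field_simp, Real.sqrt_sq F2.le]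
    calc |b w v| * |ζ w| * equil γ w = |b w v| * |ζ w| * (√(equil γ w / collFreq γ b w) *
          √(collFreq γ b w * equil γ w)) := by rw [h3]
      _ = _ := by ring
  have h2 : ∫⁻ w, f w ^ 2 = gainWeight γ b v := by
    rw [gainWeight]
    congr with w
    have f2 := hb.freq_pos w
    have F2 := hF w
    rw [hf, ← ENNReal.ofReal_pow (by positivity), mul_pow, sq_abs, Real.sq_sqrt (by positivity)]
    congr 1
    ring
  have h3 : ∫⁻ w, g w ^ 2 ≤ ENNReal.ofReal (C ^ 2 * K) * envInt γ β m := by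
    rw [envInt, ← lintegral_const_mul _ (by fun_prop)]
    refine lintegral_mono fun w => ?_
    have f2 := hb.freq_pos w
    have F2 := hF w
    have J := jap_rpow_pos w (-β)
    rw [hg, ← ENNReal.ofReal_pow (by positivity), wtF, ← ENNReal.ofReal_pow (hm0 w),
      ← ENNReal.ofReal_mul (by positivity), ← ENNReal.ofReal_mul (by positivity), mul_pow,
      Real.sq_sqrt (by positivity)]
    refine ENNReal.ofReal_le_ofReal ?_
    calc |ζ w| ^ 2 * (collFreq γ b w * equil γ w) ≤
        (C * m w) ^ 2 * (K * jap w ^ (-β) * equil γ w) := by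
          gcongr
          · exact hζ w
          · exact hν w
      _ = _ := by ring
  calc ‖gain γ b ζ v‖ₑ ^ 2 ≤ (∫⁻ w, f w * g w) ^ 2 := by gcongr
    _ ≤ (∫⁻ w, f w ^ 2) * ∫⁻ w, g w ^ 2 :=
        lintegral_mul_sq_le _ (by fun_prop) (by fun_prop)
    _ ≤ _ := by rw [h2]; gcongr

lemma integral_adj_scattering (hd : 1 ≤ d) (hγ : 0 < γ) (hβ : -β < γ)
    (hb : ScatteringAssumption γ β b) {ζ : Vel d → ℝ} (hζ : IsTest ζ) :
    ∫ v, (Collision.scattering b).adj γ ζ v * equil γ v = 0 := by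
  obtain ⟨K, hK, hν⟩ := hb.exists_collFreq_le
  have hF : ∀ v : Vel d, 0 < equil γ v := equil_pos hd hγ
  have hζm := hζ.1.continuous.measurable
  obtain ⟨B, hB⟩ := hζ.2.exists_bound_of_continuous hζ.1.continuous
  have hνi : Integrable fun v => collFreq γ b v * ζ v * equil γ v := by
    refine ((integrable_jap_rpow_mul_equil (d := d) hd hγ hβ).const_mul (K * B)).mono'
      ((hb.measurable_collFreq.mul hζm).mul (measurable_equil γ)).aestronglyMeasurable
      (ae_of_all _ fun v => ?_)
    have f := hb.freq_pos v
    have F := hF v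
    have J := jap_rpow_pos v (-β)
    have hB0 : 0 ≤ B := (norm_nonneg _).trans (hB v)
    rw [norm_mul, norm_mul, Real.norm_of_nonneg f.le, Real.norm_of_nonneg F.le]
    calc _ ≤ K * jap v ^ (-β) * B * equil γ v := by
          gcongr
          · exact hν v
          · exact hB v
      _ = _ := by ring
  have hmeas : Measurable fun p : Vel d × Vel d => b p.2 p.1 * ζ p.2 * equil γ p.2 * equil γ p.1 :=
    (measurable_gainIntegrand hb hζm).mul ((measurable_equil γ).comp measurable_fst)
  have inner_eq : ∀ w : Vel d, ∫⁻ v, ‖b w v * ζ w * equil γ w * equil γ v‖ₑ =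
      ‖collFreq γ b w * ζ w * equil γ w‖ₑ := fun w => by
    have h1 : ∫⁻ v, ‖b w v * equil γ v‖ₑ = ‖collFreq γ b w‖ₑ := by
      rw [Real.enorm_of_nonneg (hb.freq_pos w).le, collFreq,
        ofReal_integral_eq_lintegral_ofReal (hb.integrable_left w) (by
          filter_upwards [hb.kernel_nonneg w] with v hv using mul_nonneg hv (hF v).le)]
      refine lintegral_congr_ae ?_
      filter_upwards [hb.kernel_nonneg w] with v hv
      exact Real.enorm_of_nonneg (mul_nonneg hv (hF v).le)
    have h2 : ∀ v, ‖b w v * ζ w * equil γ w * equil γ v‖ₑ =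
        ‖ζ w * equil γ w‖ₑ * ‖b w v * equil γ v‖ₑ := fun v => by
      rw [← enorm_mul]; congr 1; ring
    simp_rw [h2]
    rw [lintegral_const_mul' _ _ enorm_ne_top, h1, ← enorm_mul]
    congr 1
    ring
  have hint : Integrable (fun p : Vel d × Vel d => b p.2 p.1 * ζ p.2 * equil γ p.2 * equil γ p.1)
      (volume.prod volume) := by
    refine ⟨hmeas.aestronglyMeasurable, ?_⟩
    rw [hasFiniteIntegral_iff_enorm, lintegral_prod_symm' _ hmeas.enorm]
    simp only [inner_eq]
    exact hνi.2
  have e1 : ∀ v, (Collision.scattering b).adj γ ζ v * equil γ v =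
      (∫ w, b w v * ζ w * equil γ w * equil γ v) - collFreq γ b v * ζ v * equil γ v := fun v => by
    rw [integral_mul_const, ← sub_mul]; rfl
  simp_rw [e1]
  rw [integral_sub hint.integral_prod_left hνi,
    integral_integral_swap (f := fun v w => b w v * ζ w * equil γ w * equil γ v) hint, sub_eq_zero]
  congr with w
  rw [collFreq, ← integral_mul_const, ← integral_mul_const]
  congr with v
  ring

lemma tendsto_gain_trunc (hb : ScatteringAssumption γ β b) {ψ : Vel d → ℝ}
    (hψ : Continuous ψ) {B : ℝ} (hB : ∀ v, |ψ v| ≤ B) (v : Vel d) :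
    Tendsto (fun n => gain γ b (trunc ψ n) v) atTop (𝓝 (gain γ b ψ v)) := by
  have hm : ∀ ζ : Vel d → ℝ, Measurable ζ → AEStronglyMeasurable (fun w => b w v * ζ w * equil γ w) :=
    fun ζ hζ => ((measurable_gainIntegrand hb hζ).comp measurable_prodMk_left).aestronglyMeasurable
  refine tendsto_integral_of_dominated_convergence (fun w => |b w v * equil γ w| * B)
    (fun n => hm _ ?_) ((hb.integrable_right v).abs.mul_const B)
    (fun n => ae_of_all _ fun w => ?_) (ae_of_all _ fun w => ?_)
  · exact ((contDiff_cutoff _).continuous.mul hψ).measurable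
  · rw [mul_right_comm, norm_mul, Real.norm_eq_abs, Real.norm_eq_abs]
    gcongr
    exact (abs_trunc_le ψ n w).trans (hB w)
  · exact ((tendsto_trunc ψ w).const_mul _).mul_const _

lemma enorm_sub_sq_le (x y : ℝ) : ‖x - y‖ₑ ^ 2 ≤ 2 * (‖x‖ₑ ^ 2 + ‖y‖ₑ ^ 2) := by
  simp only [Real.enorm_eq_ofReal_abs, ← ENNReal.ofReal_pow (abs_nonneg _), sq_abs]
  rw [← ENNReal.ofReal_add (by positivity) (by positivity), ← ENNReal.ofReal_ofNat 2,
    ← ENNReal.ofReal_mul (by norm_num)]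
  exact ENNReal.ofReal_le_ofReal (by nlinarith [sq_nonneg (x + y)])

lemma exists_controlled_scattering (hd : 1 ≤ d) (hγ : 0 < γ) (hβ : -β < γ) {η : ℝ} (hη : -β ≤ η)
    (hb : ScatteringAssumption γ β b) (A C : ℝ) (hC : 0 ≤ C) :
    ∃ K : ℝ, ∀ m ψ : Vel d → ℝ, SymBound m C ψ → Envelope m A →
      ∃ T G, Controlled γ η (.scattering b) ψ (ENNReal.ofReal K * envInt γ β m) (trunc ψ) T G := by
  obtain ⟨K, hK, hν⟩ := hb.exists_collFreq_le
  have hI := lintegral_gainWeight_lt_top hd hγ hb hη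
  set I := ∫⁻ v, gainWeight γ b v * wtF γ (-η) v with hI'
  refine ⟨2 * (C ^ 2 * K * I.toReal + (K * C) ^ 2), fun m ψ hψ hm => ⟨(Collision.scattering b).adj γ ψ, fun v =>
    2 * (gainWeight γ b v * (ENNReal.ofReal (C ^ 2 * K) * envInt γ β m) +
      ENNReal.ofReal ((K * C) ^ 2) * (ENNReal.ofReal (m v) ^ 2 * ENNReal.ofReal (jap v ^ (-2 * β)))),
    ?_⟩⟩
  have hmm := hm.continuous.measurable
  have hψm := hψ.smooth.continuous.measurable
  have hgw := measurable_gainWeight hb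
  have hle : ∀ n v, |trunc ψ n v| ≤ C * m v := fun n v => (abs_trunc_le ψ n v).trans (hψ.bound v)
  refine ⟨isTest_trunc hψ.smooth, abs_trunc_le ψ, tendsto_trunc ψ, fun n => ?_,
    by fun_prop, fun n => ae_of_all _ fun v => ?_, ae_of_all _ fun v => ?_, ?_,
    fun n => integral_adj_scattering hd hγ hβ hb (isTest_trunc hψ.smooth n)⟩
  · have hζm := (isTest_trunc hψ.smooth n).1.continuous.measurable
    exact ((measurable_gain hb hζm).sub (hb.measurable_collFreq.mul hζm)).aestronglyMeasurable
  · have hζm := (isTest_trunc hψ.smooth n).1.continuous.measurable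
    refine (enorm_sub_sq_le (gain γ b (trunc ψ n) v) (collFreq γ b v * trunc ψ n v)).trans ?_
    gcongr
    · exact enorm_gain_sq_le hd hγ hb hK hν (hle n) hmm hm.nonneg hζm v
    · have f := hb.freq_pos v
      have hmv := hm.nonneg v
      have J := jap_rpow_pos v (-β)
      have J2 := jap_rpow_pos v (-2 * β)
      rw [Real.enorm_eq_ofReal_abs, ← ENNReal.ofReal_pow (abs_nonneg _), ← ENNReal.ofReal_pow hmv,
        ← ENNReal.ofReal_mul (by positivity), ← ENNReal.ofReal_mul (by positivity)]
      refine ENNReal.ofReal_le_ofReal ?_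
      rw [abs_mul, abs_of_pos f]
      calc (collFreq γ b v * |trunc ψ n v|) ^ 2 ≤ (K * jap v ^ (-β) * (C * m v)) ^ 2 := by
            gcongr
            · exact hν v
            · exact hle n v
        _ = _ := by
            rw [show -2 * β = -β + -β by ring, Real.rpow_add (jap_pos v)]
            ring
  · refine (tendsto_gain_trunc hb hψ.smooth.continuous (B := C * A)
      (fun w => (hψ.bound w).trans (by gcongr; exact hm.le w)) v).sub ?_
    exact (tendsto_trunc ψ v).const_mul _
  · have hFn : ∀ v : Vel d, 0 ≤ equil γ v := fun v => (equil_pos hd hγ v).le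
    have t1 : ∫⁻ v, gainWeight γ b v * (ENNReal.ofReal (C ^ 2 * K) * envInt γ β m) * wtF γ (-η) v
        = ENNReal.ofReal (C ^ 2 * K * I.toReal) * envInt γ β m := by
      have : ∀ v, gainWeight γ b v * (ENNReal.ofReal (C ^ 2 * K) * envInt γ β m) * wtF γ (-η) v =
        (ENNReal.ofReal (C ^ 2 * K) * envInt γ β m) * (gainWeight γ b v * wtF γ (-η) v) := fun v => by
          ring
      simp_rw [this]
      rw [lintegral_const_mul _ (by fun_prop), ← hI',
        ENNReal.ofReal_mul (p := C ^ 2 * K) (by positivity), ENNReal.ofReal_toReal hI.ne]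
      ring
    have t2 := lintegral_env_le (γ := γ) (β := β) (k := -2 * β) (l := -η) hFn (by linarith)
      ((K * C) ^ 2) hmm
    have t3 : ∀ v, 2 * (gainWeight γ b v * (ENNReal.ofReal (C ^ 2 * K) * envInt γ β m) +
        ENNReal.ofReal ((K * C) ^ 2) *
          (ENNReal.ofReal (m v) ^ 2 * ENNReal.ofReal (jap v ^ (-2 * β)))) * wtF γ (-η) v =
        2 * (gainWeight γ b v * (ENNReal.ofReal (C ^ 2 * K) * envInt γ β m) * wtF γ (-η) v +
        ENNReal.ofReal ((K * C) ^ 2) *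
          (ENNReal.ofReal (m v) ^ 2 * ENNReal.ofReal (jap v ^ (-2 * β))) * wtF γ (-η) v) :=
      fun v => by ring
    simp_rw [t3]
    rw [lintegral_const_mul _ (by fun_prop), lintegral_add_left (by fun_prop), t1,
      ENNReal.ofReal_mul (p := 2) (by norm_num),
      ENNReal.ofReal_add (p := C ^ 2 * K * I.toReal) (by positivity) (by positivity),
      ENNReal.ofReal_ofNat, mul_assoc 2 (_ + _), add_mul]
    gcongr

end Scattering

section FractionalFokkerPlanck

variable {d : ℕ}

lemma abs_inner_gradient_le (x : Vel d) (ζ : Vel d → ℝ) (v : Vel d) :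
    |inner ℝ x (gradient ζ v)| ≤ ‖fderiv ℝ ζ v‖ * ‖x‖ := by
  rw [real_inner_comm, inner_gradient_left]
  exact (fderiv ℝ ζ v).le_opNorm x

lemma ennreal_add_sq_le (x y : ℝ≥0∞) : (x + y) ^ 2 ≤ 2 * (x ^ 2 + y ^ 2) := by
  rcases eq_or_ne x ⊤ with rfl | hx
  · simp
  rcases eq_or_ne y ⊤ with rfl | hy
  · simp
  lift x to NNReal using hx
  lift y to NNReal using hy
  norm_cast
  exact add_sq_le

lemma tendsto_fracLap_trunc (hd : 1 ≤ d) {σ : ℝ} (h0 : 0 < σ) (h2 : σ < 2) {A C : ℝ} (hC : 0 ≤ C)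
    {m ψ : Vel d → ℝ} (hψ : SymBound m C ψ) (hm : Envelope m A) (v : Vel d) :
    Tendsto (fun n => fracLap σ (trunc ψ n) v) atTop (𝓝 (fracLap σ ψ v)) := by
  obtain ⟨C₀, hC₀, hker⟩ := exists_fracKer_const hd h0 h2
  obtain ⟨C', hC', hb⟩ := exists_symBound_trunc d C hC
  have hA : 0 ≤ A := (hm.nonneg 0).trans (hm.le 0)
  set K : ℝ := C' * A with hK
  have hK0 : 0 ≤ K := by positivity
  have hb0 : ∀ n v, |trunc ψ n v| ≤ K := fun n v =>
    ((hb m ψ hψ n).bound v).trans (by rw [hK]; gcongr; exact hm.le v)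
  have hb2 : ∀ n v, ‖fderiv ℝ (fderiv ℝ (trunc ψ n)) v‖ ≤ K := fun n v =>
    ((hb m ψ hψ n).bound_fderiv2 v).trans ((div_le_self ((hb m ψ hψ n).nonneg v)
      (one_le_pow₀ (one_le_jap v))).trans (by rw [hK]; gcongr; exact hm.le v))
  clear_value K
  set bnd : Vel d → ℝ := fun h => min (K * ‖h‖ ^ 2) (4 * K) / ‖h‖ ^ ((d : ℝ) + σ) with hbnd
  have hbm : Measurable bnd := by rw [hbnd]; fun_prop
  have hbi : Integrable bnd := by
    refine ⟨hbm.aestronglyMeasurable, ?_⟩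
    have hpos : ∀ h : Vel d, 0 ≤ min (K * ‖h‖ ^ 2) (4 * K) := fun h => by positivity
    have e : (fun h : Vel d => ENNReal.ofReal (bnd h)) = fun h =>
        ENNReal.ofReal (min (K * ‖h‖ ^ 2) (4 * K)) * fracKer σ h := funext fun h => by
      rw [fracKer, ← ENNReal.ofReal_mul (hpos h), mul_one_div]
    rw [hasFiniteIntegral_iff_ofReal (ae_of_all _ fun h => div_nonneg (hpos h) (by positivity)),
      e, ← lintegral_add_compl _ (measurableSet_far 1), compl_far]
    refine ENNReal.add_lt_top.mpr ⟨?_, ?_⟩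
    · calc _ ≤ ∫⁻ h in {h : Vel d | 1 ≤ ‖h‖}, ENNReal.ofReal (4 * K) * fracKer σ h := by
            refine lintegral_mono fun h => ?_
            gcongr
            exact min_le_right _ _
        _ < ⊤ := by
            rw [lintegral_const_mul _ (by fun_prop)]
            exact ENNReal.mul_lt_top ENNReal.ofReal_lt_top
              ((hker 1 one_pos).1.trans_lt ENNReal.ofReal_lt_top)
    · calc _ ≤ ∫⁻ h in {h : Vel d | ‖h‖ < 1}, ENNReal.ofReal K *
              (ENNReal.ofReal (‖h‖ ^ 2) * fracKer σ h) := by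
            refine lintegral_mono fun h => ?_
            rw [← mul_assoc, ← ENNReal.ofReal_mul hK0]
            gcongr
            exact min_le_left _ _
        _ < ⊤ := by
            rw [lintegral_const_mul _ (by fun_prop)]
            exact ENNReal.mul_lt_top ENNReal.ofReal_lt_top
              ((hker 1 one_pos).2.trans_lt ENNReal.ofReal_lt_top)
  simp_rw [fracLap_eq]
  refine Tendsto.const_mul _ (tendsto_integral_of_dominated_convergence bnd (fun n => ?_) hbi
    (fun n => ae_of_all _ fun h => ?_) (ae_of_all _ fun h => ?_))
  · exact ((measurable_secDiff_div σ (isTest_trunc hψ.smooth n).1.continuous).comp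
      measurable_prodMk_left).aestronglyMeasurable
  · rw [norm_div, Real.norm_of_nonneg (by positivity : (0 : ℝ) ≤ ‖h‖ ^ ((d : ℝ) + σ)), hbnd]
    simp only
    gcongr
    refine le_min ?_ ?_
    · exact abs_secDiff_le (isTest_trunc hψ.smooth n).1 fun k _ => hb2 n _
    · have h1 := abs_le.mp (hb0 n (v + h))
      have h2 := abs_le.mp (hb0 n (v - h))
      have h3 := abs_le.mp (hb0 n v)
      rw [secDiff, Real.norm_eq_abs, abs_le]
      constructor <;> linarith
  · refine Tendsto.div_const ?_ _
    exact ((tendsto_trunc ψ (v + h)).add (tendsto_trunc ψ (v - h))).sub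
      ((tendsto_trunc ψ v).const_mul 2)

lemma continuous_gradient {ζ : Vel d → ℝ} (hζ : ContDiff ℝ ∞ ζ) : Continuous (gradient ζ) :=
  (InnerProductSpace.toDual ℝ (Vel d)).symm.continuous.comp (hζ.continuous_fderiv (by simp))

lemma integral_adj_fracFokkerPlanck (hd : 1 ≤ d) {γ σ : ℝ} (h0 : 0 < σ) (h2 : σ < 2) (hγ : 0 < γ)
    {E : Vel d → Vel d} (hE : IsFriction γ σ E) {ζ : Vel d → ℝ} (hζ : IsTest ζ) :
    ∫ v, (Collision.fracFokkerPlanck σ E).adj γ ζ v * equil γ v = 0 := by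
  have hF := integrable_equil (d := d) hd hγ
  obtain ⟨K, hK⟩ := hζ.bddC2.fracLap_bounded hd h0 h2
  have i1 : Integrable fun v => fracLap σ ζ v * equil γ v :=
    hF.bdd_mul (c := K) (measurable_fracLap σ hζ.1.continuous).aestronglyMeasurable
      (ae_of_all _ hK)
  have i2 : Integrable fun v => equil γ v * inner ℝ (E v) (gradient ζ v) := by
    have hsupp : IsCompact (tsupport ζ) := hζ.2
    have hEi : IntegrableOn E (tsupport ζ) := hE.locInt.integrableOn_isCompact hsupp
    obtain ⟨B, hB⟩ := hsupp.exists_bound_of_continuousOn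
      (f := fun v => equil γ v * ‖gradient ζ v‖)
      ((continuous_equil γ).mul (continuous_gradient hζ.1).norm).continuousOn
    have h3 : IntegrableOn (fun v => equil γ v * inner ℝ (E v) (gradient ζ v)) (tsupport ζ) := by
      refine Integrable.mono' (hEi.norm.const_mul B) ?_ ?_
      · exact (continuous_equil γ).aestronglyMeasurable.mul
          (hEi.aestronglyMeasurable.inner (continuous_gradient hζ.1).aestronglyMeasurable)
      · filter_upwards [ae_restrict_mem (isClosed_tsupport ζ).measurableSet] with v hv
        have h4 := hB v hv
        have h5 := equil_pos hd hγ v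
        rw [norm_mul, Real.norm_of_nonneg h5.le, norm_norm] at h4
        rw [norm_mul, Real.norm_of_nonneg h5.le]
        calc _ ≤ equil γ v * (‖E v‖ * ‖gradient ζ v‖) := by
              gcongr; exact norm_inner_le_norm _ _
          _ = (equil γ v * ‖gradient ζ v‖) * ‖E v‖ := by ring
          _ ≤ _ := by gcongr
    refine (integrableOn_iff_integrable_of_support_subset fun v hv => ?_).mp h3
    by_contra hns
    refine hv ?_
    have : fderiv ℝ ζ v = 0 := by
      rw [(notMem_tsupport_iff_eventuallyEq.mp hns).fderiv_eq]; simp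
    change equil γ v * inner ℝ (E v) (gradient ζ v) = 0
    rw [real_inner_comm, inner_gradient_left, this]
    simp
  have e1 : ∀ v, (Collision.fracFokkerPlanck σ E).adj γ ζ v * equil γ v =
      fracLap σ ζ v * equil γ v - equil γ v * inner ℝ (E v) (gradient ζ v) := fun v => by
    simp only [Collision.adj]; ring
  simp_rw [e1]
  rw [integral_sub i1 i2, ← hE.equation ζ hζ,
    integral_fracLap_mul hd h0 h2 (equil_bddC2 hd hγ) hζ.bddC2 hF hζ.integrable, sub_eq_zero]
  simp only [mul_comm]

lemma exists_controlled_fracFokkerPlanck (hd : 1 ≤ d) {γ β η σ : ℝ} (h0 : 0 < σ) (h2 : σ < 2)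
    (hγ : 0 < γ) (hβ : β = σ - γ) (hη : -β ≤ η) {E : Vel d → Vel d}
    (hE : IsFriction γ σ E) (A C : ℝ) (hA : 0 ≤ A) (hC : 0 ≤ C) :
    ∃ K : ℝ, ∀ m ψ : Vel d → ℝ, SymBound m C ψ → Envelope m A →
      ∃ T G, Controlled γ η (.fracFokkerPlanck σ E) ψ (ENNReal.ofReal K * envInt γ β m)
        (trunc ψ) T G := by
  obtain ⟨C', hC', hb⟩ := exists_symBound_trunc d C hC
  obtain ⟨K₁, hK₁, hb1⟩ := exists_enorm_fracLap_le hd h0 h2 hA hC'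
  obtain ⟨K₂, hK₂, hb2⟩ := exists_farInt_sq_le hd h0 h2 hγ hβ
  obtain ⟨K₃, hK₃, hb3⟩ := exists_friction_le hd h0 h2 hγ hβ hE
  have hFn : ∀ v : Vel d, 0 ≤ equil γ v := fun v => (equil_pos hd hγ v).le
  have hI := lintegral_wtF_lt_top (d := d) (k := -σ + -η) hd hγ (by linarith)
  set I : ℝ≥0∞ := ∫⁻ v : Vel d, wtF γ (-σ + -η) v with hI'
  set G : (Vel d → ℝ) → Vel d → ℝ≥0∞ := fun m v =>
    ENNReal.ofReal (4 * K₁ ^ 2) * (ENNReal.ofReal (m v) ^ 2 * ENNReal.ofReal (jap v ^ (-2 * σ))) +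
    ENNReal.ofReal (4 * K₁ ^ 2 * K₂) * envInt γ β m * ENNReal.ofReal (jap v ^ (-σ)) +
    ENNReal.ofReal (2 * (K₃ * C') ^ 2) *
      (ENNReal.ofReal (m v) ^ 2 * ENNReal.ofReal (jap v ^ (-2 * β))) with hG
  refine ⟨4 * K₁ ^ 2 + 4 * K₁ ^ 2 * K₂ * I.toReal + 2 * (K₃ * C') ^ 2, fun m ψ hψ hm =>
    ⟨(Collision.fracFokkerPlanck σ E).adj γ ψ, G m, ?_⟩⟩
  have hmm := hm.continuous.measurable
  have hEm : AEStronglyMeasurable E volume := hE.locInt.aestronglyMeasurable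
  refine ⟨isTest_trunc hψ.smooth, abs_trunc_le ψ, tendsto_trunc ψ, fun n => ?_,
    by rw [hG]; fun_prop, fun n => ?_, ae_of_all _ fun v => ?_, ?_,
    fun n => integral_adj_fracFokkerPlanck hd h0 h2 hγ hE (isTest_trunc hψ.smooth n)⟩
  · have hs := (isTest_trunc hψ.smooth n).1
    exact (measurable_fracLap σ hs.continuous).aestronglyMeasurable.sub
      (hEm.inner (continuous_gradient hs).aestronglyMeasurable)
  · filter_upwards [hb3] with v hv
    have hmv := hm.nonneg v
    have hj := jap_pos v
    refine (enorm_sub_sq_le (fracLap σ (trunc ψ n) v)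
      (inner ℝ (E v) (gradient (trunc ψ n) v))).trans ?_
    have t1 : ‖fracLap σ (trunc ψ n) v‖ₑ ^ 2 ≤ ENNReal.ofReal (K₁ ^ 2) *
        (2 * (ENNReal.ofReal (m v) ^ 2 * ENNReal.ofReal (jap v ^ (-2 * σ)) +
          ENNReal.ofReal (K₂ * jap v ^ (-σ)) * envInt γ β m)) := by
      have h1 := hb1 _ _ (hb m ψ hψ n) hm v
      have h3 : ∀ x y : ℝ≥0∞, (x + y) ^ 2 ≤ 2 * (x ^ 2 + y ^ 2) := fun x y => ennreal_add_sq_le x y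
      calc _ ≤ (ENNReal.ofReal K₁ * (ENNReal.ofReal (m v * jap v ^ (-σ)) + farInt σ m v)) ^ 2 := by
            gcongr
        _ ≤ ENNReal.ofReal (K₁ ^ 2) * (2 * (ENNReal.ofReal (m v * jap v ^ (-σ)) ^ 2 +
              farInt σ m v ^ 2)) := by
            rw [mul_pow, ENNReal.ofReal_pow hK₁]
            gcongr
            exact h3 _ _
        _ ≤ _ := by
            gcongr
            · rw [ENNReal.ofReal_mul hmv, mul_pow, ← ENNReal.ofReal_pow (p := jap v ^ (-σ))
                (jap_rpow_pos v _).le]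
              gcongr
              rw [show -2 * σ = -σ + -σ by ring, Real.rpow_add hj, sq]
            · exact hb2 m hmm v
    have t2 : ‖inner ℝ (E v) (gradient (trunc ψ n) v)‖ₑ ^ 2 ≤ ENNReal.ofReal ((K₃ * C') ^ 2) *
        (ENNReal.ofReal (m v) ^ 2 * ENNReal.ofReal (jap v ^ (-2 * β))) := by
      have J2 := jap_rpow_pos v (-2 * β)
      have J1 := jap_rpow_pos v (1 - β)
      rw [Real.enorm_eq_ofReal_abs, ← ENNReal.ofReal_pow (abs_nonneg _), ← ENNReal.ofReal_pow hmv,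
        ← ENNReal.ofReal_mul (by positivity), ← ENNReal.ofReal_mul (by positivity)]
      refine ENNReal.ofReal_le_ofReal ?_
      calc _ ≤ ((C' * m v / jap v) * (K₃ * jap v ^ (1 - β))) ^ 2 := by
            refine pow_le_pow_left₀ (abs_nonneg _) ((abs_inner_gradient_le _ _ _).trans ?_) 2
            gcongr
            exact (hb m ψ hψ n).bound_fderiv v
        _ = _ := by
            rw [show -2 * β = -β + -β by ring, Real.rpow_add hj, sub_eq_add_neg 1 β,
              Real.rpow_add hj, Real.rpow_one]
            field_simp
    refine (mul_le_mul' le_rfl (add_le_add t1 t2)).trans (le_of_eq ?_)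
    rw [hG]
    simp only
    rw [ENNReal.ofReal_mul (p := 4 * K₁ ^ 2) (by positivity), ENNReal.ofReal_mul (p := 4) (by norm_num),
      ENNReal.ofReal_mul (p := 2) (by norm_num), ENNReal.ofReal_mul hK₂, ENNReal.ofReal_ofNat,
      ENNReal.ofReal_ofNat]
    ring
  · refine (tendsto_fracLap_trunc hd h0 h2 hC hψ hm v).sub ?_
    refine tendsto_const_nhds.congr' ?_
    filter_upwards [eventually_trunc_eq ψ v] with n hn
    rw [gradient, gradient, hn.fderiv_eq]
  · have u1 := lintegral_env_le (γ := γ) (β := β) (k := -2 * σ) (l := -η) hFn (by linarith)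
      (4 * K₁ ^ 2) hmm
    have u3 := lintegral_env_le (γ := γ) (β := β) (k := -2 * β) (l := -η) hFn (by linarith)
      (2 * (K₃ * C') ^ 2) hmm
    have u2 : ∫⁻ v : Vel d, ENNReal.ofReal (4 * K₁ ^ 2 * K₂) * envInt γ β m *
        ENNReal.ofReal (jap v ^ (-σ)) * wtF γ (-η) v =
        ENNReal.ofReal (4 * K₁ ^ 2 * K₂ * I.toReal) * envInt γ β m := by
      have : ∀ v : Vel d, ENNReal.ofReal (4 * K₁ ^ 2 * K₂) * envInt γ β m *
        ENNReal.ofReal (jap v ^ (-σ)) * wtF γ (-η) v =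
        ENNReal.ofReal (4 * K₁ ^ 2 * K₂) * envInt γ β m * wtF γ (-σ + -η) v := fun v => by
          rw [mul_assoc, ofReal_jap_mul_wtF]
      simp_rw [this]
      rw [lintegral_const_mul _ (by fun_prop), ← hI',
        ENNReal.ofReal_mul (p := 4 * K₁ ^ 2 * K₂) (by positivity), ENNReal.ofReal_toReal hI.ne]
      ring
    rw [hG]
    simp_rw [add_mul]
    rw [lintegral_add_left (by fun_prop), lintegral_add_left (by fun_prop), u2,
      ENNReal.ofReal_add (by positivity) (by positivity),
      ENNReal.ofReal_add (p := 4 * K₁ ^ 2) (by positivity) (by positivity), add_mul, add_mul]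
    gcongr

/-- Observables of symbol type are controlled, for all the collision operators under
consideration. -/
theorem exists_controlled (hd : 1 ≤ d) {γ β η : ℝ} (hγ : 0 < γ) (hγβ : -β < γ)
    (hηβ : -β ≤ η) {L : Collision d} (hL : AssumptionH γ β L) (A C : ℝ) (hA : 0 ≤ A)
    (hC : 0 ≤ C) : ∃ K : ℝ, ∀ m ψ : Vel d → ℝ, SymBound m C ψ → Envelope m A →
      ∃ ζ T G, Controlled γ η L ψ (ENNReal.ofReal K * envInt γ β m) ζ T G := by
  cases L with
  | fokkerPlanck =>
    have hβ : β = 2 := hL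
    subst hβ
    obtain ⟨K, hK⟩ := exists_controlled_fokkerPlanck hd hγ hηβ A C hC
    exact ⟨K, fun m ψ h1 h2 => ⟨_, hK m ψ h1 h2⟩⟩
  | scattering b =>
    obtain ⟨K, hK⟩ := exists_controlled_scattering hd hγ hγβ hηβ hL A C hC
    exact ⟨K, fun m ψ h1 h2 => ⟨_, hK m ψ h1 h2⟩⟩
  | fracFokkerPlanck σ E =>
    obtain ⟨h0, h2, hβ, hE⟩ := hL
    obtain ⟨K, hK⟩ := exists_controlled_fracFokkerPlanck hd h0 h2 hγ hβ hηβ hE A C hA hC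
    exact ⟨K, fun m ψ h1 h2 => ⟨_, hK m ψ h1 h2⟩⟩

end FractionalFokkerPlanck

section MacroscopicRate

variable {d : ℕ}

lemma integral_inner_sq_mul_eq_of_norm_eq {h : Vel d → ℝ}
    (hh : ∀ v w : Vel d, ‖v‖ = ‖w‖ → h v = h w) {ξ ζ : Vel d} (hξ : ‖ξ‖ = ‖ζ‖) :
    ∫ v, (inner ℝ v ξ) ^ 2 * h v = ∫ v, (inner ℝ v ζ) ^ 2 * h v := by
  set R := (ℝ ∙ (ξ - ζ))ᗮ.reflection with hR
  have h1 : R ξ = ζ := Submodule.reflection_sub hξ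
  have hmp : MeasurePreserving R volume volume := R.measurePreserving
  rw [← hmp.integral_comp R.toHomeomorph.measurableEmbedding
    fun v => (inner ℝ v ζ) ^ 2 * h v]
  refine integral_congr_ae (ae_of_all _ fun v => ?_)
  simp only
  rw [hh (R v) v (R.norm_map v), ← h1, R.inner_map_map]

lemma integral_inner_sq_mul {h : Vel d → ℝ} (hh : ∀ v w : Vel d, ‖v‖ = ‖w‖ → h v = h w)
    (hm : Measurable h) (hi : Integrable fun v : Vel d => ‖v‖ ^ 2 * h v) (ξ : Vel d) :
    (d : ℝ) * ∫ v, (inner ℝ v ξ) ^ 2 * h v = ‖ξ‖ ^ 2 * ∫ v, ‖v‖ ^ 2 * h v := by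
  have hint : ∀ ζ : Vel d, Integrable fun v : Vel d => (inner ℝ v ζ) ^ 2 * h v := fun ζ => by
    refine (hi.norm.const_mul (‖ζ‖ ^ 2)).mono' (by fun_prop) (ae_of_all _ fun v => ?_)
    rw [norm_mul, norm_mul, norm_pow, ← mul_assoc]
    gcongr
    rw [norm_pow, norm_norm, ← mul_pow, mul_comm]
    gcongr
    exact norm_inner_le_norm _ _
  have h1 : ∀ i : Fin d, ∫ v, (inner ℝ v ξ) ^ 2 * h v =
      ∫ v, (inner ℝ v (‖ξ‖ • EuclideanSpace.single i (1 : ℝ))) ^ 2 * h v := fun i => by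
    refine integral_inner_sq_mul_eq_of_norm_eq hh ?_
    rw [norm_smul, norm_norm]
    simp
  calc (d : ℝ) * ∫ v, (inner ℝ v ξ) ^ 2 * h v = ∑ _i : Fin d, ∫ v, (inner ℝ v ξ) ^ 2 * h v := by
        simp
    _ = ∑ i : Fin d, ∫ v, (inner ℝ v (‖ξ‖ • EuclideanSpace.single i (1 : ℝ))) ^ 2 * h v :=
        Finset.sum_congr rfl fun i _ => h1 i
    _ = ∫ v, ∑ i : Fin d, (inner ℝ v (‖ξ‖ • EuclideanSpace.single i (1 : ℝ))) ^ 2 * h v :=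
        (integral_finsetSum _ fun i _ => hint _).symm
    _ = ∫ v, ‖ξ‖ ^ 2 * (‖v‖ ^ 2 * h v) := by
        refine integral_congr_ae (ae_of_all _ fun v => ?_)
        simp only
        rw [← Finset.sum_mul, EuclideanSpace.norm_sq_eq v, ← mul_assoc, Finset.mul_sum]
        congr 1
        refine Finset.sum_congr rfl fun i _ => ?_
        rw [inner_smul_right, EuclideanSpace.inner_single_right]
        simp [mul_pow]
    _ = _ := integral_const_mul _ _

lemma integral_norm_rpow_annulus (hd : 1 ≤ d) {a b : ℝ} (ha : 1 ≤ a) (hab : a ≤ b) :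
    ∫ v : Vel d, (Icc a b).indicator (fun y : ℝ => y ^ (-(d : ℝ))) ‖v‖ =
      d * (volume : Measure (Vel d)).real (Metric.ball 0 1) * Real.log (b / a) := by
  have : Nontrivial (Vel d) := by
    have : Nonempty (Fin d) := ⟨⟨0, hd⟩⟩
    infer_instance
  rw [integral_fun_norm_addHaar (volume : Measure (Vel d))
    (fun y => (Icc a b).indicator (fun y : ℝ => y ^ (-(d : ℝ))) y)]
  simp only [finrank_euclideanSpace, Fintype.card_fin, nsmul_eq_mul, smul_eq_mul, mul_assoc]
  congr 2
  have e1 : ∀ y ∈ Ioi (0 : ℝ), y ^ (d - 1) * (Icc a b).indicator (fun y : ℝ => y ^ (-(d : ℝ))) y =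
      (Icc a b).indicator (fun y : ℝ => y⁻¹) y := fun y hy => by
    by_cases h : y ∈ Icc a b
    · rw [indicator_of_mem h, indicator_of_mem h, Real.rpow_neg (le_of_lt hy), Real.rpow_natCast]
      have hy' : y ≠ 0 := ne_of_gt hy
      obtain ⟨k, rfl⟩ := Nat.exists_eq_add_of_le' hd
      simp only [Nat.add_sub_cancel, pow_succ]
      field_simp
    · rw [indicator_of_notMem h, indicator_of_notMem h, mul_zero]
  rw [setIntegral_congr_fun measurableSet_Ioi e1, setIntegral_indicator measurableSet_Icc,
    inter_eq_right.mpr fun y hy => mem_Ioi.mpr (by linarith [hy.1] : (0 : ℝ) < y),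
    integral_Icc_eq_integral_Ioc, ← intervalIntegral.integral_of_le hab,
    integral_inv_of_pos (by linarith) (by linarith)]

lemma volume_real_ball_pos (d : ℕ) : 0 < (volume : Measure (Vel d)).real (Metric.ball 0 1) :=
  ENNReal.toReal_pos (Metric.measure_ball_pos _ _ one_pos).ne' measure_ball_lt_top.ne

section Symbol

variable {γ β : ℝ}

/-- The macroscopic dissipation rate `∫ (v·ξ)² φ F`. -/
def rate (γ β : ℝ) (ξ : Vel d) : ℝ := ∫ v : Vel d, (inner ℝ v ξ) ^ 2 * (phi β ξ v * equil γ v)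

lemma inner_sq_mul_phi_le (β : ℝ) (ξ v : Vel d) :
    (inner ℝ v ξ) ^ 2 * phi β ξ v ≤ jap v ^ (-β) := by
  have hφ := phi_pos β ξ v
  refine le_trans ?_ (norm_sq_mul_phi_le β ξ v)
  gcongr
  rw [Real.rpow_two, ← mul_pow, ← sq_abs, mul_comm ‖ξ‖]
  gcongr
  exact (abs_real_inner_le_norm v ξ).trans (by gcongr; exact norm_le_jap v)

lemma integrable_jap_sq_mul_phi (hd : 1 ≤ d) (hγ : 0 < γ) (hβ : -β < γ) {ξ : Vel d} (hξ : ξ ≠ 0) :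
    Integrable fun v : Vel d => jap v ^ 2 * (phi β ξ v * equil γ v) := by
  have hξ' : 0 < ‖ξ‖ := norm_pos_iff.mpr hξ
  refine ((integrable_jap_rpow_mul_equil hd hγ hβ).const_mul (‖ξ‖ ^ 2)⁻¹).mono'
    ((continuous_jap.pow 2).mul ((continuous_phi β ξ).mul
      (continuous_equil γ))).aestronglyMeasurable (ae_of_all _ fun v => ?_)
  have hF := equil_pos hd hγ v
  have hφ := phi_pos β ξ v
  have h := norm_sq_mul_phi_le β ξ v
  rw [Real.rpow_two] at h
  have h' : jap v ^ 2 * phi β ξ v ≤ (‖ξ‖ ^ 2)⁻¹ * jap v ^ (-β) := by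
    rw [inv_mul_eq_div, le_div_iff₀' (by positivity), ← mul_assoc]
    exact h
  rw [Real.norm_of_nonneg (by positivity), ← mul_assoc, ← mul_assoc]
  exact mul_le_mul_of_nonneg_right h' hF.le

lemma integrable_norm_sq_mul_phi (hd : 1 ≤ d) (hγ : 0 < γ) (hβ : -β < γ) {ξ : Vel d}
    (hξ : ξ ≠ 0) : Integrable fun v : Vel d => ‖v‖ ^ 2 * (phi β ξ v * equil γ v) := by
  refine (integrable_jap_sq_mul_phi hd hγ hβ hξ).mono'
    ((continuous_norm.pow 2).mul ((continuous_phi β ξ).mul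
      (continuous_equil γ))).aestronglyMeasurable (ae_of_all _ fun v => ?_)
  have hF := equil_pos hd hγ v
  have hφ := phi_pos β ξ v
  rw [Real.norm_of_nonneg (by positivity)]
  gcongr
  exact norm_le_jap v

lemma integrable_rate (hd : 1 ≤ d) (hγ : 0 < γ) (hβ : -β < γ) (ξ : Vel d) :
    Integrable fun v : Vel d => (inner ℝ v ξ) ^ 2 * (phi β ξ v * equil γ v) := by
  have hc := continuous_phi β ξ
  have hc' := continuous_equil (d := d) γ
  refine (integrable_jap_rpow_mul_equil hd hγ hβ).mono' (by fun_prop) (ae_of_all _ fun v => ?_)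
  have hF := equil_pos hd hγ v
  have hφ := phi_pos β ξ v
  rw [Real.norm_of_nonneg (by positivity), ← mul_assoc]
  gcongr
  exact inner_sq_mul_phi_le β ξ v

lemma rate_nonneg (hd : 1 ≤ d) (hγ : 0 < γ) (ξ : Vel d) : 0 ≤ rate γ β ξ :=
  integral_nonneg fun v => mul_nonneg (sq_nonneg _)
    (mul_nonneg (phi_pos β ξ v).le (equil_pos hd hγ v).le)

lemma rate_le (hd : 1 ≤ d) (hγ : 0 < γ) (hβ : -β < γ) (ξ : Vel d) :
    rate γ β ξ ≤ ∫ v : Vel d, jap v ^ (-β) * equil γ v := by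
  refine integral_mono (integrable_rate hd hγ hβ ξ) (integrable_jap_rpow_mul_equil hd hγ hβ)
    fun v => ?_
  have hF := equil_pos hd hγ v
  simp only
  rw [← mul_assoc]
  gcongr
  exact inner_sq_mul_phi_le β ξ v

lemma mul_rate_eq (hd : 1 ≤ d) (hγ : 0 < γ) (hβ : -β < γ) (ξ : Vel d) :
    d * rate γ β ξ = ‖ξ‖ ^ 2 * ∫ v : Vel d, ‖v‖ ^ 2 * (phi β ξ v * equil γ v) := by
  rcases eq_or_ne ξ 0 with rfl | hξ
  · simp [rate]
  · refine integral_inner_sq_mul (h := fun v => phi β ξ v * equil γ v) (fun v w hvw => ?_)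
      ((continuous_phi β ξ).mul (continuous_equil γ)).measurable
      (integrable_norm_sq_mul_phi hd hγ hβ hξ) ξ
    simp only [phi, equil, jap, hvw]

lemma exists_annulus_le (hd : 1 ≤ d) (hγ : 0 < γ) (hβ : -β < γ) : ∃ c : ℝ, 0 < c ∧
    ∀ (ξ : Vel d) (a b m D : ℝ), ξ ≠ 0 → 1 ≤ a → a ≤ b → 0 ≤ m → 0 < D →
      (∀ y, a ≤ y → y ≤ b → m ≤ y ^ (2 + β - γ)) →
      (∀ v : Vel d, ‖v‖ ≤ b → a ≤ ‖v‖ → 1 + jap v ^ (2 * |1 + β|) * ‖ξ‖ ^ 2 ≤ D) →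
      c * (‖ξ‖ ^ 2 * (m / D) * Real.log (b / a)) ≤ rate γ β ξ := by
  set p : ℝ := β - (d + γ) with hp
  set κ : ℝ := d * (volume : Measure (Vel d)).real (Metric.ball 0 1) with hκ
  have hd0 : (0 : ℝ) < d := by exact_mod_cast hd
  have hκ0 : 0 < κ := mul_pos hd0 (volume_real_ball_pos d)
  have hc := cGamma_pos hd hγ
  set c₀ : ℝ := cGamma d γ / 2 ^ |p| with hc₀
  have hc₀' : 0 < c₀ := by positivity
  refine ⟨c₀ * κ / d, by positivity, fun ξ a b m D hξ ha hab hm hD h1 h2 => ?_⟩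
  have key : c₀ * (m / D) * (κ * Real.log (b / a)) ≤
      ∫ v : Vel d, ‖v‖ ^ 2 * (phi β ξ v * equil γ v) := by
    rw [hκ, ← integral_norm_rpow_annulus hd ha hab, ← integral_const_mul]
    refine integral_mono_of_nonneg (ae_of_all _ fun v => ?_)
      (integrable_norm_sq_mul_phi hd hγ hβ hξ) (ae_of_all _ fun v => ?_)
    · refine mul_nonneg (by positivity) (indicator_nonneg (fun y hy => ?_) _)
      exact Real.rpow_nonneg (by linarith [hy.1]) _
    · have hF := equil_pos hd hγ v
      have hφ := phi_pos β ξ v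
      simp only
      by_cases hv : ‖v‖ ∈ Icc a b
      · rw [indicator_of_mem hv]
        have hv0 : 0 < ‖v‖ := by linarith [hv.1]
        have hj : jap v ≤ 2 * ‖v‖ := by linarith [jap_le_one_add_norm v, hv.1]
        have hr := rpow_le_of_comparable hv0 (jap_pos v)
          (by linarith [norm_le_jap v, jap_pos v]) hj p
        have hm' := h1 _ hv.1 hv.2
        have hD' := h2 v hv.2 hv.1
        have e1 : ‖v‖ ^ 2 * (phi β ξ v * equil γ v) = cGamma d γ * (‖v‖ ^ 2 * jap v ^ p) /
            (1 + jap v ^ (2 * |1 + β|) * ‖ξ‖ ^ 2) := by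
          rw [phi, equil, hp, sub_eq_add_neg, Real.rpow_add (jap_pos v)]
          ring
        have e2 : ‖v‖ ^ (2 + β - γ) * ‖v‖ ^ (-(d : ℝ)) = ‖v‖ ^ 2 * ‖v‖ ^ p := by
          rw [← Real.rpow_two, ← Real.rpow_add hv0, ← Real.rpow_add hv0, hp]
          ring_nf
        rw [e1]
        calc c₀ * (m / D) * ‖v‖ ^ (-(d : ℝ))
            ≤ c₀ * (‖v‖ ^ (2 + β - γ) / D) * ‖v‖ ^ (-(d : ℝ)) := by gcongr
          _ = c₀ * (‖v‖ ^ 2 * ‖v‖ ^ p) / D := by rw [← e2]; ring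
          _ ≤ c₀ * (‖v‖ ^ 2 * (2 ^ |p| * jap v ^ p)) / D := by gcongr
          _ = cGamma d γ * (‖v‖ ^ 2 * jap v ^ p) / D := by rw [hc₀]; field_simp
          _ ≤ _ := by
              have := jap_rpow_pos v p
              have := phi_denom_pos β ξ v
              gcongr
      · rw [indicator_of_notMem hv, mul_zero]
        positivity
  have e := mul_rate_eq hd hγ hβ ξ
  rw [← mul_le_mul_iff_of_pos_left hd0, e]
  refine le_trans (le_of_eq ?_) (mul_le_mul_of_nonneg_left key (sq_nonneg ‖ξ‖))
  field_simp

lemma exists_rate_ge (hd : 1 ≤ d) (hγ : 0 < γ) (hβ : -β < γ) : ∃ c : ℝ, 0 < c ∧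
    ∀ ξ : Vel d, c * (‖ξ‖ ^ 2 / (1 + ‖ξ‖ ^ 2)) ≤ rate γ β ξ := by
  obtain ⟨c, hc, h⟩ := exists_annulus_le hd hγ hβ
  set m : ℝ := (2 ^ |2 + β - γ|)⁻¹ with hm
  set q : ℝ := 3 ^ (2 * |1 + β|) with hq
  have hq0 : 0 < q := by positivity
  have hq1 : 1 ≤ q := Real.one_le_rpow (by norm_num) (by positivity)
  have hl : 0 < Real.log 2 := Real.log_pos (by norm_num)
  refine ⟨c * (m / q) * Real.log 2, by positivity, fun ξ => ?_⟩
  rcases eq_or_ne ξ 0 with rfl | hξ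
  · simpa using rate_nonneg hd hγ 0
  refine le_trans (le_of_eq ?_) (h ξ 1 2 m (q * (1 + ‖ξ‖ ^ 2)) hξ le_rfl (by norm_num)
    (by positivity) (by positivity) (fun y h1 h2 => ?_) fun v h2 h1 => ?_)
  · rw [div_one]
    field_simp
  · have := rpow_le_of_comparable (x := 1) (y := y) one_pos (by linarith) (by linarith)
      (by linarith) (2 + β - γ)
    rw [Real.one_rpow] at this
    rw [hm, inv_le_iff_one_le_mul₀ (by positivity)]
    linarith
  · have hj : jap v ≤ 3 := by linarith [jap_le_one_add_norm v]
    have : jap v ^ (2 * |1 + β|) ≤ q :=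
      Real.rpow_le_rpow (jap_pos v).le hj (by positivity)
    nlinarith [sq_nonneg ‖ξ‖]

lemma exists_jap_sq_le_rate (hd : 1 ≤ d) (hγ : 0 < γ) (hβ : -β < γ) : ∃ C : ℝ, 0 ≤ C ∧
    ∀ ξ : Vel d, ‖ξ‖ ^ 2 * ∫ v : Vel d, jap v ^ 2 * (phi β ξ v * equil γ v) ≤ C * rate γ β ξ := by
  obtain ⟨c, hc, h⟩ := exists_rate_ge hd hγ hβ
  have hI : 0 ≤ ∫ v : Vel d, equil γ v := integral_nonneg fun v => (equil_pos hd hγ v).le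
  refine ⟨2 * d + 2 * 2 ^ |β| * (∫ v : Vel d, equil γ v) / c, by positivity, fun ξ => ?_⟩
  rcases eq_or_ne ξ 0 with rfl | hξ
  · have := rate_nonneg (β := β) hd hγ (0 : Vel d)
    simp only [norm_zero, ne_eq, OfNat.ofNat_ne_zero, not_false_eq_true, zero_pow, zero_mul]
    positivity
  have i1 := (integrable_norm_sq_mul_phi hd hγ hβ hξ).const_mul 2
  have i2 := (integrable_equil (d := d) hd hγ).const_mul (2 * 2 ^ |β| / (1 + ‖ξ‖ ^ 2))
  have key : ∫ v : Vel d, jap v ^ 2 * (phi β ξ v * equil γ v) ≤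
      2 * (∫ v : Vel d, ‖v‖ ^ 2 * (phi β ξ v * equil γ v)) +
        2 * 2 ^ |β| / (1 + ‖ξ‖ ^ 2) * ∫ v : Vel d, equil γ v := by
    rw [← integral_const_mul, ← integral_const_mul, ← integral_add i1 i2]
    refine integral_mono (integrable_jap_sq_mul_phi hd hγ hβ hξ) (i1.add i2) fun v => ?_
    have hF := equil_pos hd hγ v
    have hφ := phi_pos β ξ v
    simp only
    rcases le_total 1 ‖v‖ with hv | hv
    · have h1 : jap v ^ 2 ≤ 2 * ‖v‖ ^ 2 := by rw [jap_sq]; nlinarith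
      calc jap v ^ 2 * (phi β ξ v * equil γ v) ≤ 2 * ‖v‖ ^ 2 * (phi β ξ v * equil γ v) := by
            gcongr
        _ ≤ 2 * (‖v‖ ^ 2 * (phi β ξ v * equil γ v)) +
            2 * 2 ^ |β| / (1 + ‖ξ‖ ^ 2) * equil γ v := by
            have : 0 ≤ 2 * 2 ^ |β| / (1 + ‖ξ‖ ^ 2) * equil γ v := by positivity
            linarith
    · have h1 : jap v ^ 2 ≤ 2 := by rw [jap_sq]; nlinarith [norm_nonneg v]
      have h2 : jap v ≤ 2 := by linarith [jap_le_one_add_norm v]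
      have h3 : phi β ξ v ≤ 2 ^ |β| / (1 + ‖ξ‖ ^ 2) := by
        have h4 := rpow_le_of_comparable (y := 1) (jap_pos v) one_pos (by linarith)
          (by linarith [one_le_jap v]) β
        rw [Real.one_rpow, mul_one] at h4
        have h5 : 1 ≤ jap v ^ (2 * |1 + β|) := Real.one_le_rpow (one_le_jap v) (by positivity)
        rw [phi]
        gcongr
        nlinarith [sq_nonneg ‖ξ‖]
      calc jap v ^ 2 * (phi β ξ v * equil γ v)
          ≤ 2 * (2 ^ |β| / (1 + ‖ξ‖ ^ 2) * equil γ v) := by gcongr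
        _ ≤ 2 * (‖v‖ ^ 2 * (phi β ξ v * equil γ v)) +
            2 * 2 ^ |β| / (1 + ‖ξ‖ ^ 2) * equil γ v := by
            have : 0 ≤ ‖v‖ ^ 2 * (phi β ξ v * equil γ v) := by positivity
            linarith [show 2 * (2 ^ |β| / (1 + ‖ξ‖ ^ 2) * equil γ v) =
              2 * 2 ^ |β| / (1 + ‖ξ‖ ^ 2) * equil γ v by ring]
  calc _ ≤ ‖ξ‖ ^ 2 * (2 * (∫ v : Vel d, ‖v‖ ^ 2 * (phi β ξ v * equil γ v)) +
        2 * 2 ^ |β| / (1 + ‖ξ‖ ^ 2) * ∫ v : Vel d, equil γ v) := by gcongr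
    _ = 2 * d * rate γ β ξ + 2 * 2 ^ |β| * (∫ v : Vel d, equil γ v) / c *
        (c * (‖ξ‖ ^ 2 / (1 + ‖ξ‖ ^ 2))) := by
        rw [mul_assoc 2 (d : ℝ), mul_rate_eq hd hγ hβ]
        field_simp
    _ ≤ _ := by
        rw [add_mul]
        gcongr
        exact h ξ

/-- The envelope of the principal observable is controlled by the macroscopic rate. -/
lemma exists_envInt_le_rate (hd : 1 ≤ d) (hγ : 0 < γ) (hβ : -β < γ) : ∃ C : ℝ, 0 ≤ C ∧
    ∀ ξ : Vel d, envInt γ β (fun v => ‖ξ‖ * jap v * phi β ξ v) ≤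
      ENNReal.ofReal (C * rate γ β ξ) := by
  obtain ⟨C, hC, h⟩ := exists_jap_sq_le_rate hd hγ hβ
  refine ⟨C, hC, fun ξ => ?_⟩
  rcases eq_or_ne ξ 0 with rfl | hξ
  · simp [envInt]
  refine le_trans ?_ (ENNReal.ofReal_le_ofReal (h ξ))
  rw [← integral_const_mul, ofReal_integral_eq_lintegral_ofReal
    ((integrable_jap_sq_mul_phi hd hγ hβ hξ).const_mul _) (ae_of_all _ fun v => mul_nonneg
      (sq_nonneg _) (mul_nonneg (sq_nonneg _) (mul_nonneg (phi_pos β ξ v).le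
        (equil_pos hd hγ v).le))), envInt]
  refine lintegral_mono fun v => ?_
  have hF := equil_pos hd hγ v
  have hφ := phi_pos β ξ v
  have hj := jap_pos v
  rw [wtF, ← ENNReal.ofReal_pow (by positivity), ← ENNReal.ofReal_mul (by positivity)]
  refine ENNReal.ofReal_le_ofReal ?_
  have h1 : phi β ξ v * jap v ^ (-β) ≤ 1 := by
    calc _ ≤ jap v ^ β * jap v ^ (-β) := by gcongr; exact phi_le β ξ v
      _ = 1 := by rw [← Real.rpow_add hj, add_neg_cancel, Real.rpow_zero]
  calc (‖ξ‖ * jap v * phi β ξ v) ^ 2 * (jap v ^ (-β) * equil γ v) =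
        ‖ξ‖ ^ 2 * (jap v ^ 2 * (phi β ξ v * equil γ v)) * (phi β ξ v * jap v ^ (-β)) := by ring
    _ ≤ _ := mul_le_of_le_one_right (by positivity) h1

lemma lintegral_inner_sq_mul_phi_sq_le (hd : 1 ≤ d) (hγ : 0 < γ) (hβ : -β < γ) {η : ℝ}
    (hη : -β ≤ η) (ξ : Vel d) :
    ∫⁻ v : Vel d, ENNReal.ofReal ((inner ℝ v ξ) ^ 2 * phi β ξ v) ^ 2 * wtF γ (-η) v ≤
      ENNReal.ofReal (rate γ β ξ) := by
  rw [rate, ofReal_integral_eq_lintegral_ofReal (integrable_rate hd hγ hβ ξ)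
    (ae_of_all _ fun v => mul_nonneg (sq_nonneg _) (mul_nonneg (phi_pos β ξ v).le
        (equil_pos hd hγ v).le))]
  refine lintegral_mono fun v => ?_
  have hF := equil_pos hd hγ v
  have hφ := phi_pos β ξ v
  have hj := jap_pos v
  have h1 := inner_sq_mul_phi_le β ξ v
  rw [wtF, ← ENNReal.ofReal_pow (by positivity), ← ENNReal.ofReal_mul (by positivity)]
  refine ENNReal.ofReal_le_ofReal ?_
  have h2 : jap v ^ (-β) * jap v ^ (-η) ≤ 1 := by
    rw [← Real.rpow_add hj]
    exact jap_rpow_le_one v (by linarith)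
  calc ((inner ℝ v ξ) ^ 2 * phi β ξ v) ^ 2 * (jap v ^ (-η) * equil γ v)
      = (inner ℝ v ξ) ^ 2 * phi β ξ v * ((inner ℝ v ξ) ^ 2 * phi β ξ v) *
        (jap v ^ (-η) * equil γ v) := by ring
    _ ≤ (inner ℝ v ξ) ^ 2 * phi β ξ v * jap v ^ (-β) * (jap v ^ (-η) * equil γ v) := by gcongr
    _ = (inner ℝ v ξ) ^ 2 * (phi β ξ v * equil γ v) * (jap v ^ (-β) * jap v ^ (-η)) := by ring
    _ ≤ _ := mul_le_of_le_one_right (by positivity) h2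

lemma symbolL_zero (hβ : -β < γ) : symbolL γ β (0 : Vel d) = 0 := by
  rw [symbolL]
  split_ifs with h
  · simp
  · have : alphaExp γ β ≠ 0 := by
      rw [alphaExp]
      split_ifs with h'
      · exact (div_pos (by linarith) (by linarith)).ne'
      · norm_num
    rw [norm_zero, Real.zero_rpow this, zero_div]

/-- The symbol is controlled by the macroscopic rate. -/
lemma exists_symbolL_le_rate (hd : 1 ≤ d) (hγ : 0 < γ) (hβ : -β < γ) : ∃ C : ℝ, 0 < C ∧
    ∀ ξ : Vel d, symbolL γ β ξ ≤ C * rate γ β ξ := by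
  obtain ⟨c₁, hc₁, h₁⟩ := exists_rate_ge hd hγ hβ
  obtain ⟨c₂, hc₂, h₂⟩ := exists_annulus_le hd hγ hβ
  have large : ∀ ξ : Vel d, 1 ≤ ‖ξ‖ → 1 ≤ 2 / c₁ * rate γ β ξ := fun ξ hξ => by
    have := h₁ ξ
    have h3 : 1 / 2 ≤ ‖ξ‖ ^ 2 / (1 + ‖ξ‖ ^ 2) := by
      rw [div_le_div_iff₀ (by norm_num) (by positivity)]; nlinarith
    rw [div_mul_eq_mul_div, le_div_iff₀ hc₁]
    nlinarith
  set q : ℝ := 1 + 3 ^ (2 * |1 + β|) with hq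
  have hq0 : 0 < q := by positivity
  -- on the relevant annuli the denominator of `phi` is bounded
  have hden : ∀ ξ : Vel d, ξ ≠ 0 → 0 < 1 + β → ∀ v : Vel d,
      jap v ≤ 3 * ‖ξ‖ ^ (-(1 / (1 + β))) → 1 + jap v ^ (2 * |1 + β|) * ‖ξ‖ ^ 2 ≤ q := by
    intro ξ hξ hb v hv
    have hξ' : 0 < ‖ξ‖ := norm_pos_iff.mpr hξ
    have : jap v ^ (2 * |1 + β|) ≤ 3 ^ (2 * |1 + β|) * (‖ξ‖ ^ 2)⁻¹ := by
      refine (Real.rpow_le_rpow (jap_pos v).le hv (by positivity)).trans (le_of_eq ?_)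
      rw [Real.mul_rpow (by norm_num) (by positivity), ← Real.rpow_mul hξ'.le, abs_of_pos hb,
        show -(1 / (1 + β)) * (2 * (1 + β)) = -2 by field_simp, Real.rpow_neg hξ'.le,
        Real.rpow_two]
    rw [hq]
    gcongr
    calc _ ≤ 3 ^ (2 * |1 + β|) * (‖ξ‖ ^ 2)⁻¹ * ‖ξ‖ ^ 2 := by gcongr
      _ = _ := by field_simp
  have hR1 : ∀ ξ : Vel d, ξ ≠ 0 → ‖ξ‖ ≤ 1 → 0 < 1 + β → 1 ≤ ‖ξ‖ ^ (-(1 / (1 + β))) :=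
    fun ξ hξ h1 hb => Real.one_le_rpow_of_pos_of_le_one_of_nonpos (norm_pos_iff.mpr hξ) h1
      (neg_nonpos.mpr (by positivity))
  have hsmall : ∀ ξ : Vel d, ‖ξ‖ ^ 2 / jap ξ ^ 2 ≤ 1 / c₁ * rate γ β ξ := fun ξ => by
    have := h₁ ξ
    rw [jap_sq, div_mul_eq_mul_div, le_div_iff₀ hc₁]
    linarith
  rcases lt_trichotomy γ (2 + β) with hlt | heq | hgt
  · have hb : 0 < 1 + β := by linarith
    have hl : 0 < Real.log 2 := Real.log_pos (by norm_num)
    have hα : 0 < (γ + β) / (1 + β) := div_pos (by linarith) hb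
    refine ⟨2 / c₁ + q / (c₂ * Real.log 2), by positivity, fun ξ => ?_⟩
    have hr := rate_nonneg (β := β) hd hγ ξ
    rcases eq_or_ne ξ 0 with rfl | hξ
    · rw [symbolL_zero hβ]; positivity
    have hξ' : 0 < ‖ξ‖ := norm_pos_iff.mpr hξ
    rw [symbolL, if_neg hlt.ne, alphaExp, if_pos hlt]
    rcases le_total 1 ‖ξ‖ with h1 | h1
    · calc _ ≤ (1 : ℝ) := by
            rw [div_le_one (jap_rpow_pos _ _)]
            exact Real.rpow_le_rpow hξ'.le (norm_le_jap ξ) hα.le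
        _ ≤ _ := large ξ h1
        _ ≤ _ := by gcongr; exact le_add_of_nonneg_right (by positivity)
    · set R : ℝ := ‖ξ‖ ^ (-(1 / (1 + β))) with hR
      have hR' := hR1 ξ hξ h1 hb
      have hR0 : 0 < R := by linarith
      have key := h₂ ξ R (2 * R) (R ^ (2 + β - γ)) q hξ hR' (by linarith) (by positivity) hq0
        (fun y h3 _ => Real.rpow_le_rpow hR0.le h3 (by linarith))
        (fun v h3 _ => hden ξ hξ hb v (by linarith [jap_le_one_add_norm v]))
      rw [mul_div_assoc, div_self hR0.ne', mul_one] at key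
      have e : ‖ξ‖ ^ 2 * R ^ (2 + β - γ) = ‖ξ‖ ^ ((γ + β) / (1 + β)) := by
        rw [hR, ← Real.rpow_mul hξ'.le, ← Real.rpow_two, ← Real.rpow_add hξ']
        congr 1
        field_simp
        ring
      calc _ ≤ ‖ξ‖ ^ ((γ + β) / (1 + β)) :=
            div_le_self (by positivity) (Real.one_le_rpow (one_le_jap ξ) hα.le)
        _ ≤ q / (c₂ * Real.log 2) * rate γ β ξ := by
            rw [← e, div_mul_eq_mul_div, le_div_iff₀ (by positivity)]
            calc _ = q * (c₂ * (‖ξ‖ ^ 2 * (R ^ (2 + β - γ) / q) * Real.log 2)) := by field_simp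
              _ ≤ _ := by gcongr
        _ ≤ _ := by gcongr; exact le_add_of_nonneg_left (by positivity)
  · have hb : 0 < 1 + β := by linarith
    refine ⟨2 / c₁ + 4 / 3 * ((1 + β) * q / c₂), by positivity, fun ξ => ?_⟩
    have hr := rate_nonneg (β := β) hd hγ ξ
    rcases eq_or_ne ξ 0 with rfl | hξ
    · rw [symbolL_zero hβ]; positivity
    have hξ' : 0 < ‖ξ‖ := norm_pos_iff.mpr hξ
    rw [symbolL, if_pos heq]
    rcases le_total 1 ‖ξ‖ with h1 | h1
    · have hl := Real.log_nonneg h1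
      calc _ ≤ (1 : ℝ) := by
            rw [abs_of_nonneg hl, div_le_one (by positivity)]
            linarith
        _ ≤ _ := large ξ h1
        _ ≤ _ := by gcongr; exact le_add_of_nonneg_right (by positivity)
    · set R : ℝ := ‖ξ‖ ^ (-(1 / (1 + β))) with hR
      have hR' := hR1 ξ hξ h1 hb
      have key := h₂ ξ 1 R 1 q hξ le_rfl hR' zero_le_one hq0
        (fun y h3 _ => by rw [show 2 + β - γ = 0 by linarith, Real.rpow_zero])
        (fun v h3 _ => hden ξ hξ hb v (by linarith [jap_le_one_add_norm v]))
      have hlog : Real.log (R / 1) = |Real.log ‖ξ‖| / (1 + β) := by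
        rw [div_one, hR, Real.log_rpow hξ', abs_of_nonpos (Real.log_nonpos hξ'.le h1)]
        ring
      rw [hlog] at key
      have hden' : 3 / 4 ≤ 1 + ‖ξ‖ ^ 2 * Real.log ‖ξ‖ := by
        have h4 := Real.one_sub_inv_le_log_of_pos hξ'
        have h5 : ‖ξ‖ ^ 2 * (1 - ‖ξ‖⁻¹) ≤ ‖ξ‖ ^ 2 * Real.log ‖ξ‖ := by gcongr
        have h6 : ‖ξ‖ ^ 2 * (1 - ‖ξ‖⁻¹) = ‖ξ‖ ^ 2 - ‖ξ‖ := by field_simp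
        nlinarith [sq_nonneg (‖ξ‖ - 1 / 2)]
      calc _ ≤ ‖ξ‖ ^ 2 * |Real.log ‖ξ‖| / (3 / 4) := by gcongr
        _ = 4 / 3 * (‖ξ‖ ^ 2 * |Real.log ‖ξ‖|) := by ring
        _ ≤ 4 / 3 * ((1 + β) * q / c₂ * rate γ β ξ) := by
            refine mul_le_mul_of_nonneg_left ?_ (by norm_num)
            rw [div_mul_eq_mul_div, le_div_iff₀ hc₂]
            calc _ = (1 + β) * q * (c₂ * (‖ξ‖ ^ 2 * (1 / q) * (|Real.log ‖ξ‖| / (1 + β)))) := by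
                  field_simp
              _ ≤ _ := by gcongr
        _ = 4 / 3 * ((1 + β) * q / c₂) * rate γ β ξ := by ring
        _ ≤ _ := by gcongr; exact le_add_of_nonneg_left (by positivity)
  · refine ⟨1 / c₁, by positivity, fun ξ => ?_⟩
    rw [symbolL, if_neg hgt.ne', alphaExp, if_neg hgt.not_gt, Real.rpow_two, Real.rpow_two]
    exact hsmall ξ

end Symbol

end MacroscopicRate

section WeightedDuality

variable {d : ℕ} {γ η : ℝ}

section WeightedNorm

lemma measurable_normSq_weight (γ k : ℝ) :
    Measurable fun v : Vel d => ENNReal.ofReal (jap v ^ k * (equil γ v)⁻¹) :=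
  ((continuous_jap_rpow k).measurable.mul (measurable_equil γ).inv).ennreal_ofReal

lemma aemeasurable_normSq_integrand (γ k : ℝ) {g : Vel d → ℂ}
    (hg : AEStronglyMeasurable g volume) :
    AEMeasurable fun v => ‖g v‖ₑ ^ 2 * ENNReal.ofReal (jap v ^ k * (equil γ v)⁻¹) :=
  (hg.enorm.pow_const 2).mul (measurable_normSq_weight γ k).aemeasurable

/-- Cauchy–Schwarz for the duality between the weights `⟨v⟩^{-η} F` and `⟨v⟩^η F⁻¹`. -/
lemma lintegral_enorm_mul_sq_le (hd : 1 ≤ d) (hγ : 0 < γ) (η : ℝ) {w g : Vel d → ℂ}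
    (hw : AEStronglyMeasurable w volume) (hg : AEStronglyMeasurable g volume) :
    (∫⁻ v, ‖w v‖ₑ * ‖g v‖ₑ) ^ 2 ≤ (∫⁻ v, ‖w v‖ₑ ^ 2 * wtF γ (-η) v) * normSq γ η g := by
  set a : Vel d → ℝ := fun v => √(jap v ^ (-η) * equil γ v) with ha
  set b : Vel d → ℝ := fun v => √(jap v ^ η * (equil γ v)⁻¹) with hb
  have pos1 : ∀ v : Vel d, 0 < jap v ^ (-η) * equil γ v := fun v =>
    mul_pos (jap_rpow_pos v _) (equil_pos hd hγ v)
  have pos2 : ∀ v : Vel d, 0 < jap v ^ η * (equil γ v)⁻¹ := fun v =>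
    mul_pos (jap_rpow_pos v _) (inv_pos.mpr (equil_pos hd hγ v))
  have hab : ∀ v, a v * b v = 1 := fun v => by
    have := (equil_pos hd hγ v).ne'
    rw [ha, hb]
    simp only
    rw [← Real.sqrt_mul (pos1 v).le, Real.sqrt_eq_one, show jap v ^ (-η) * equil γ v *
      (jap v ^ η * (equil γ v)⁻¹) = (jap v ^ (-η) * jap v ^ η) * (equil γ v * (equil γ v)⁻¹) by ring,
      mul_inv_cancel₀ this, ← Real.rpow_add (jap_pos v), neg_add_cancel, Real.rpow_zero, one_mul]
  have ham : Measurable a :=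
    ((continuous_jap_rpow (-η)).measurable.mul (measurable_equil γ)).sqrt
  have hbm : Measurable b :=
    ((continuous_jap_rpow η).measurable.mul (measurable_equil γ).inv).sqrt
  have h := lintegral_mul_sq_le volume
    (f := fun v => ‖w v‖ₑ * ENNReal.ofReal (a v)) (g := fun v => ‖g v‖ₑ * ENNReal.ofReal (b v))
    (hw.enorm.mul ham.ennreal_ofReal.aemeasurable) (hg.enorm.mul hbm.ennreal_ofReal.aemeasurable)
  have e1 : ∀ v, ‖w v‖ₑ * ENNReal.ofReal (a v) * (‖g v‖ₑ * ENNReal.ofReal (b v)) =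
      ‖w v‖ₑ * ‖g v‖ₑ := fun v => by
    have : ENNReal.ofReal (a v) * ENNReal.ofReal (b v) = 1 := by
      rw [← ENNReal.ofReal_mul (Real.sqrt_nonneg _), hab, ENNReal.ofReal_one]
    calc _ = ‖w v‖ₑ * ‖g v‖ₑ * (ENNReal.ofReal (a v) * ENNReal.ofReal (b v)) := by ring
      _ = _ := by rw [this, mul_one]
  have e2 : ∀ v, (‖w v‖ₑ * ENNReal.ofReal (a v)) ^ 2 = ‖w v‖ₑ ^ 2 * wtF γ (-η) v := fun v => by
    rw [mul_pow, ← ENNReal.ofReal_pow (Real.sqrt_nonneg _), Real.sq_sqrt (pos1 v).le, wtF]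
  have e3 : ∀ v, (‖g v‖ₑ * ENNReal.ofReal (b v)) ^ 2 =
      ‖g v‖ₑ ^ 2 * ENNReal.ofReal (jap v ^ η * (equil γ v)⁻¹) := fun v => by
    rw [mul_pow, ← ENNReal.ofReal_pow (Real.sqrt_nonneg _), Real.sq_sqrt (pos2 v).le]
  simp_rw [e1, e2, e3] at h
  exact h

lemma enorm_integral_mul_sq_le (hd : 1 ≤ d) (hγ : 0 < γ) (η : ℝ) {w g : Vel d → ℂ}
    (hw : AEStronglyMeasurable w volume) (hg : AEStronglyMeasurable g volume) :
    ‖∫ v, w v * g v‖ₑ ^ 2 ≤ (∫⁻ v, ‖w v‖ₑ ^ 2 * wtF γ (-η) v) * normSq γ η g := by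
  refine le_trans ?_ (lintegral_enorm_mul_sq_le hd hγ η hw hg)
  gcongr
  refine (enorm_integral_le_lintegral_enorm _).trans (le_of_eq ?_)
  simp_rw [enorm_mul]

lemma integrable_mul_of_normSq (hd : 1 ≤ d) (hγ : 0 < γ) {w g : Vel d → ℂ}
    (hw : AEStronglyMeasurable w volume) (hg : AEStronglyMeasurable g volume)
    (hw' : ∫⁻ v, ‖w v‖ₑ ^ 2 * wtF γ (-η) v ≠ ⊤) (hg' : normSq γ η g ≠ ⊤) :
    Integrable fun v => w v * g v := by
  refine ⟨hw.mul hg, ?_⟩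
  rw [HasFiniteIntegral]
  simp_rw [enorm_mul]
  have h := (lintegral_enorm_mul_sq_le hd hγ η hw hg).trans_lt
    (ENNReal.mul_lt_top hw'.lt_top hg'.lt_top)
  exact (ENNReal.pow_lt_top_iff.mp h).resolve_right (by norm_num)

lemma normSq_const_mul (γ k : ℝ) (c : ℂ) {g : Vel d → ℂ} (hg : AEStronglyMeasurable g volume) :
    normSq γ k (fun v => c * g v) = ‖c‖ₑ ^ 2 * normSq γ k g := by
  simp_rw [normSq, enorm_mul, mul_pow, mul_assoc]
  rw [lintegral_const_mul'' _ (aemeasurable_normSq_integrand γ k hg)]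

lemma normSq_equil (hd : 1 ≤ d) (hγ : 0 < γ) (k : ℝ) :
    normSq γ k (fun v : Vel d => ((equil γ v : ℝ) : ℂ)) = ∫⁻ v : Vel d, wtF γ k v := by
  refine lintegral_congr fun v => ?_
  have h := equil_pos hd hγ v
  rw [← ofReal_norm, Complex.norm_real, Real.norm_of_nonneg h.le,
    ← ENNReal.ofReal_pow h.le, ← ENNReal.ofReal_mul (by positivity), wtF]
  congr 1
  field_simp

lemma normSq_proj (hd : 1 ≤ d) (hγ : 0 < γ) (k : ℝ) (g : Vel d → ℂ) :
    normSq γ k (proj γ g) = ‖∫ v, g v‖ₑ ^ 2 * ∫⁻ v : Vel d, wtF γ k v := by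
  rw [← normSq_equil hd hγ]
  exact normSq_const_mul γ k _
    (Complex.continuous_ofReal.comp (continuous_equil γ)).aestronglyMeasurable

lemma ennreal_enorm_add_sq_le (x y : ℂ) : ‖x + y‖ₑ ^ 2 ≤ 2 * (‖x‖ₑ ^ 2 + ‖y‖ₑ ^ 2) :=
  (by gcongr; exact enorm_add_le x y : ‖x + y‖ₑ ^ 2 ≤ (‖x‖ₑ + ‖y‖ₑ) ^ 2).trans
    (ennreal_add_sq_le _ _)

lemma normSq_add_le (γ k : ℝ) {g : Vel d → ℂ} (hg : AEStronglyMeasurable g volume)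
    (h : Vel d → ℂ) : normSq γ k (fun v => g v + h v) ≤ 2 * (normSq γ k g + normSq γ k h) := by
  have hg' := aemeasurable_normSq_integrand γ k hg
  rw [normSq, normSq, normSq, ← lintegral_add_left' hg', ← lintegral_const_mul' _ _ (by simp)]
  refine lintegral_mono fun v => ?_
  calc _ ≤ 2 * (‖g v‖ₑ ^ 2 + ‖h v‖ₑ ^ 2) * ENNReal.ofReal (jap v ^ k * (equil γ v)⁻¹) := by
        gcongr; exact ennreal_enorm_add_sq_le _ _
    _ = _ := by ring

lemma aestronglyMeasurable_proj (γ : ℝ) (g : Vel d → ℂ) :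
    AEStronglyMeasurable (proj γ g) volume :=
  ((Complex.continuous_ofReal.comp (continuous_equil γ)).const_mul _).aestronglyMeasurable

lemma aestronglyMeasurable_micro {g : Vel d → ℂ} (hg : AEStronglyMeasurable g volume) :
    AEStronglyMeasurable (micro γ g) volume :=
  hg.sub (aestronglyMeasurable_proj γ g)

lemma normSq_le_micro (hd : 1 ≤ d) (hγ : 0 < γ) (k : ℝ) (g : Vel d → ℂ) : normSq γ k g ≤
      2 * (‖∫ v, g v‖ₑ ^ 2 * (∫⁻ v : Vel d, wtF γ k v) + normSq γ k (micro γ g)) := by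
  have h := normSq_add_le γ k (aestronglyMeasurable_proj γ g) (micro γ g)
  rw [normSq_proj hd hγ] at h
  refine le_trans (le_of_eq ?_) h
  congr 1
  funext v
  simp [micro]

lemma enorm_integral_sq_le (hd : 1 ≤ d) (hγ : 0 < γ) {g : Vel d → ℂ}
    (hg : AEStronglyMeasurable g volume) :
    ‖∫ v, g v‖ₑ ^ 2 ≤ (∫⁻ v : Vel d, wtF γ 0 v) * normSq γ 0 g := by
  have h := enorm_integral_mul_sq_le hd hγ 0 (w := fun _ => 1) aestronglyMeasurable_const hg
  simpa using h

lemma integrable_of_normSq (hd : 1 ≤ d) (hγ : 0 < γ) {g : Vel d → ℂ}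
    (hg : AEStronglyMeasurable g volume) (h : normSq γ 0 g ≠ ⊤) : Integrable g := by
  have := integrable_mul_of_normSq hd hγ (η := 0) (w := fun _ => 1) aestronglyMeasurable_const hg
    (by simpa using (lintegral_wtF_lt_top hd hγ hγ).ne) h
  simpa using this

end WeightedNorm

/-- The function `T - i (v·ξ) ψ`. -/
def modeOp (ξ : Vel d) (T ψ : Vel d → ℝ) (v : Vel d) : ℂ :=
  ((T v : ℝ) : ℂ) - Complex.I * ((inner ℝ v ξ : ℝ) : ℂ) * ((ψ v : ℝ) : ℂ)

lemma enorm_modeOp_sq_le (ξ : Vel d) (T ψ : Vel d → ℝ) (v : Vel d) :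
    ‖modeOp ξ T ψ v‖ₑ ^ 2 ≤ 2 * (‖T v‖ₑ ^ 2 + ENNReal.ofReal |inner ℝ v ξ * ψ v| ^ 2) := by
  rw [modeOp, sub_eq_add_neg]
  refine (ennreal_enorm_add_sq_le _ _).trans (le_of_eq ?_)
  rw [enorm_neg, enorm_mul, enorm_mul]
  simp only [← ofReal_norm, Complex.norm_real, Complex.norm_I, ENNReal.ofReal_one, one_mul]
  rw [← ENNReal.ofReal_mul (norm_nonneg _), ← norm_mul, Real.norm_eq_abs, Real.norm_eq_abs]

lemma ae_lt_top_of_lintegral_wtF (hd : 1 ≤ d) (hγ : 0 < γ) {G : Vel d → ℝ≥0∞} {k : ℝ}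
    (hG : Measurable G) (h : ∫⁻ v, G v * wtF γ k v ≠ ⊤) : ∀ᵐ v, G v < ⊤ := by
  filter_upwards [ae_lt_top (hG.mul (measurable_wtF γ k)) h] with v hv
  by_contra hG
  rw [not_lt_top_iff] at hG
  simp only [Pi.mul_apply, hG] at hv
  rw [ENNReal.top_mul] at hv
  · exact hv.ne rfl
  · rw [wtF, ne_eq, ENNReal.ofReal_eq_zero, not_le]
    exact mul_pos (jap_rpow_pos v _) (equil_pos hd hγ v)

lemma enorm_sqrt_toReal_sq_le (x : ℝ≥0∞) : ‖((√x.toReal : ℝ) : ℂ)‖ₑ ^ 2 ≤ x := by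
  rw [← ofReal_norm, Complex.norm_real, Real.norm_of_nonneg (Real.sqrt_nonneg _),
    ← ENNReal.ofReal_pow (Real.sqrt_nonneg _), Real.sq_sqrt ENNReal.toReal_nonneg]
  exact ENNReal.ofReal_toReal_le

lemma norm_le_sqrt_toReal {E : Type*} [SeminormedAddCommGroup E] {z : E} {x : ℝ≥0∞}
    (h : ‖z‖ₑ ^ 2 ≤ x) (hx : x < ⊤) : ‖z‖ ≤ √x.toReal := by
  refine Real.le_sqrt_of_sq_le ?_
  rw [← ENNReal.ofReal_le_iff_le_toReal hx.ne, ENNReal.ofReal_pow (norm_nonneg _), ofReal_norm]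
  exact h

namespace Controlled

variable {L : Collision d} {ψ T : Vel d → ℝ} {Q Q' : ℝ≥0∞} {ζ : ℕ → Vel d → ℝ}
  {G : Vel d → ℝ≥0∞} {ξ : Vel d}

lemma aestronglyMeasurable_limit (h : Controlled γ η L ψ Q ζ T G) :
    AEStronglyMeasurable T volume :=
  aestronglyMeasurable_of_tendsto_ae atTop h.meas_adj h.adj_tendsto

lemma enorm_limit_le (h : Controlled γ η L ψ Q ζ T G) : ∀ᵐ v, ‖T v‖ₑ ^ 2 ≤ G v := by
  filter_upwards [h.adj_tendsto, ae_all_iff.mpr h.adj_le] with v h1 h2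
  exact le_of_tendsto (((ENNReal.continuous_pow 2).tendsto _).comp h1.enorm)
    (Eventually.of_forall h2)

/-- The common bound for `|L†ζₙ - i (v·ξ) ζₙ|²` and its limit. -/
def majorant (_ : Controlled γ η L ψ Q ζ T G) (ξ : Vel d) (v : Vel d) : ℝ≥0∞ :=
  2 * (G v + ENNReal.ofReal |inner ℝ v ξ * ψ v| ^ 2)

lemma measurable_majorant (h : Controlled γ η L ψ Q ζ T G) (hψ : Measurable ψ) :
    Measurable (h.majorant ξ) := by
  have := h.meas_G
  unfold majorant
  fun_prop

lemma lintegral_majorant_le (h : Controlled γ η L ψ Q ζ T G) (hψ : Measurable ψ)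
    (hQ' : ∫⁻ v, ENNReal.ofReal |inner ℝ v ξ * ψ v| ^ 2 * wtF γ (-η) v ≤ Q') :
    ∫⁻ v, h.majorant ξ v * wtF γ (-η) v ≤ 2 * (Q + Q') := by
  have hm := h.meas_G
  have hw := measurable_wtF (d := d) γ (-η)
  have : ∀ v, h.majorant ξ v * wtF γ (-η) v = 2 * (G v * wtF γ (-η) v +
      ENNReal.ofReal |inner ℝ v ξ * ψ v| ^ 2 * wtF γ (-η) v) := fun v => by
    rw [majorant]; ring
  simp_rw [this]
  rw [lintegral_const_mul _ (by fun_prop), lintegral_add_left (by fun_prop)]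
  gcongr
  exact h.lintegral_le

lemma enorm_modeOp_approx_le (h : Controlled γ η L ψ Q ζ T G) (n : ℕ) :
    ∀ᵐ v, ‖modeOp ξ (L.adj γ (ζ n)) (ζ n) v‖ₑ ^ 2 ≤ h.majorant ξ v := by
  filter_upwards [h.adj_le n] with v hv
  refine (enorm_modeOp_sq_le _ _ _ _).trans ?_
  rw [majorant]
  gcongr 2 * (?_ + ENNReal.ofReal ?_ ^ 2)
  rw [abs_mul, abs_mul]
  exact mul_le_mul_of_nonneg_left (h.le n v) (abs_nonneg _)

lemma enorm_modeOp_le (h : Controlled γ η L ψ Q ζ T G) :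
    ∀ᵐ v, ‖modeOp ξ T ψ v‖ₑ ^ 2 ≤ h.majorant ξ v := by
  filter_upwards [h.enorm_limit_le] with v hv
  refine (enorm_modeOp_sq_le _ _ _ _).trans ?_
  rw [majorant]
  gcongr

lemma lintegral_modeOp_le (h : Controlled γ η L ψ Q ζ T G) (hψ : Measurable ψ)
    (hQ' : ∫⁻ v, ENNReal.ofReal |inner ℝ v ξ * ψ v| ^ 2 * wtF γ (-η) v ≤ Q') :
    ∫⁻ v, ‖modeOp ξ T ψ v‖ₑ ^ 2 * wtF γ (-η) v ≤ 2 * (Q + Q') := by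
  refine (lintegral_mono_ae ?_).trans (h.lintegral_majorant_le hψ hQ')
  filter_upwards [h.enorm_modeOp_le (ξ := ξ)] with v hv
  gcongr

lemma aestronglyMeasurable_modeOp (h : Controlled γ η L ψ Q ζ T G) (hψ : Measurable ψ) :
    AEStronglyMeasurable (modeOp ξ T ψ) volume := by
  have h1 : Measurable fun v : Vel d => Complex.I * ((inner ℝ v ξ : ℝ) : ℂ) * ((ψ v : ℝ) : ℂ) := by
    fun_prop
  exact (Complex.continuous_ofReal.comp_aestronglyMeasurable h.aestronglyMeasurable_limit).sub
    h1.aestronglyMeasurable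

lemma integral_limit_mul_equil (h : Controlled γ η L ψ Q ζ T G) (hd : 1 ≤ d) (hγ : 0 < γ)
    (hη : η < γ) (hQ : Q ≠ ⊤) : Integrable (fun v => T v * equil γ v) ∧
      ∫ v, T v * equil γ v = 0 := by
  set B : Vel d → ℝ := fun v => √(G v).toReal with hB
  have hFm : AEStronglyMeasurable (fun v : Vel d => ((equil γ v : ℝ) : ℂ)) volume :=
    (Complex.continuous_ofReal.comp (continuous_equil γ)).aestronglyMeasurable
  have hBm : Measurable B := h.meas_G.ennreal_toReal.sqrt
  have hGfin := ae_lt_top_of_lintegral_wtF hd hγ h.meas_G (h.lintegral_le.trans_lt hQ.lt_top).ne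
  have hBF : Integrable fun v => B v * equil γ v := by
    have := integrable_mul_of_normSq hd hγ (η := η) (w := fun v => ((B v : ℝ) : ℂ))
      (Complex.measurable_ofReal.comp hBm).aestronglyMeasurable hFm
      (((lintegral_mono fun v => mul_le_mul_left (enorm_sqrt_toReal_sq_le (G v)) _).trans h.lintegral_le).trans_lt
        hQ.lt_top).ne
      (by rw [normSq_equil hd hγ]; exact (lintegral_wtF_lt_top hd hγ hη).ne)
    simpa using this.re
  have bound : ∀ n, ∀ᵐ v, ‖L.adj γ (ζ n) v * equil γ v‖ ≤ B v * equil γ v := fun n => by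
    filter_upwards [h.adj_le n, hGfin] with v h1 h2
    have hF := equil_pos hd hγ v
    rw [norm_mul, Real.norm_of_nonneg hF.le]
    gcongr
    exact norm_le_sqrt_toReal h1 h2
  have hlim : ∀ᵐ v, Tendsto (fun n => L.adj γ (ζ n) v * equil γ v) atTop (𝓝 (T v * equil γ v)) := by
    filter_upwards [h.adj_tendsto] with v hv using hv.mul_const _
  have hmeas : ∀ n, AEStronglyMeasurable (fun v => L.adj γ (ζ n) v * equil γ v) volume := fun n =>
    (h.meas_adj n).mul (continuous_equil γ).aestronglyMeasurable
  refine ⟨hBF.mono' (h.aestronglyMeasurable_limit.mul (continuous_equil γ).aestronglyMeasurable) ?_,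
    ?_⟩
  · filter_upwards [hlim, ae_all_iff.mpr bound] with v h1 h2
    exact le_of_tendsto h1.norm (Eventually.of_forall h2)
  · have := tendsto_integral_of_dominated_convergence _ hmeas hBF bound hlim
    simp_rw [h.integral_zero] at this
    exact tendsto_nhds_unique this tendsto_const_nhds

end Controlled

end WeightedDuality

section MomentEvolution

variable {d : ℕ} {γ η : ℝ} {L : Collision d} {ξ : Vel d} {f : ℝ → Vel d → ℂ}

namespace IsModeSolution

lemma normSq_zero_ne_top (hf : IsModeSolution γ L ξ f) {t : ℝ} (ht : 0 ≤ t) :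
    normSq γ 0 (f t) ≠ ⊤ := by
  obtain ⟨C, hC⟩ := hf.locBdd t
  exact ((hC t ht le_rfl).trans_lt ENNReal.ofReal_lt_top).ne

lemma integrable_at (hf : IsModeSolution γ L ξ f) (hd : 1 ≤ d) (hγ : 0 < γ) {t : ℝ} (ht : 0 ≤ t) :
    Integrable (f t) :=
  integrable_of_normSq hd hγ (hf.meas_at t ht) (hf.normSq_zero_ne_top ht)

lemma aestronglyMeasurable_Ioc (hf : IsModeSolution γ L ξ f) {a b : ℝ} (ha : 0 ≤ a) :
    AEStronglyMeasurable (fun p : ℝ × Vel d => f p.1 p.2)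
      ((volume.restrict (Ioc a b)).prod volume) :=
  hf.meas.mono_measure (Measure.prod_mono
    (Measure.restrict_mono (fun _ hx => ha.trans hx.1.le) le_rfl) le_rfl)

lemma aemeasurable_normSq (hf : IsModeSolution γ L ξ f) {a b : ℝ} (ha : 0 ≤ a) (k : ℝ) :
    AEMeasurable (fun t => normSq γ k (f t)) (volume.restrict (Ioc a b)) :=
  (((hf.aestronglyMeasurable_Ioc ha).enorm.pow_const 2).mul
    ((measurable_normSq_weight γ k).comp measurable_snd).aemeasurable).lintegral_prod_right'

lemma integrable_prod_mul (hf : IsModeSolution γ L ξ f) (hd : 1 ≤ d) (hγ : 0 < γ) {a b : ℝ}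
    (ha : 0 ≤ a) (hab : ∫⁻ r in Ioc a b, normSq γ η (f r) ≠ ⊤) {w : Vel d → ℂ}
    (hw : AEStronglyMeasurable w volume) (hw' : ∫⁻ v, ‖w v‖ₑ ^ 2 * wtF γ (-η) v ≠ ⊤) :
    Integrable (fun p : ℝ × Vel d => w p.2 * f p.1 p.2)
      ((volume.restrict (Ioc a b)).prod volume) := by
  have hm : AEStronglyMeasurable (fun p : ℝ × Vel d => w p.2 * f p.1 p.2)
      ((volume.restrict (Ioc a b)).prod volume) :=
    hw.comp_snd.mul (hf.aestronglyMeasurable_Ioc ha)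
  refine ⟨hm, ?_⟩
  rw [HasFiniteIntegral, lintegral_prod _ hm.enorm]
  set W := ∫⁻ v, ‖w v‖ₑ ^ 2 * wtF γ (-η) v with hW
  calc _ ≤ ∫⁻ r in Ioc a b, (1 + W * normSq γ η (f r)) := by
        refine lintegral_mono_ae ?_
        filter_upwards [ae_restrict_mem measurableSet_Ioc] with r hr
        have h1 := lintegral_enorm_mul_sq_le hd hγ η hw (hf.meas_at r (ha.trans hr.1.le))
        simp_rw [enorm_mul]
        set x := ∫⁻ v, ‖w v‖ₑ * ‖f r v‖ₑ
        rcases le_total x 1 with hx | hx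
        · exact hx.trans le_self_add
        · calc x = x * 1 := (mul_one x).symm
            _ ≤ x ^ 2 := by rw [sq]; gcongr
            _ ≤ _ := h1.trans le_add_self
    _ = volume (Ioc a b) + W * ∫⁻ r in Ioc a b, normSq γ η (f r) := by
        rw [lintegral_add_left measurable_const, lintegral_const_mul' _ _ hw']
        simp
    _ < ⊤ := ENNReal.add_lt_top.mpr ⟨measure_Ioc_lt_top, ENNReal.mul_lt_top hw'.lt_top hab.lt_top⟩

variable {ψ T : Vel d → ℝ} {Q Q' : ℝ≥0∞} {ζ : ℕ → Vel d → ℝ} {G : Vel d → ℝ≥0∞}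

/-- Controlled observables of mode solutions satisfy the moment equation. -/
lemma integral_mul_sub (hf : IsModeSolution γ L ξ f) (hd : 1 ≤ d) (hγ : 0 < γ)
    (h : Controlled γ η L ψ Q ζ T G) (hψ : Measurable ψ) {C : ℝ} (hC : ∀ v, |ψ v| ≤ C)
    (hQ : Q ≠ ⊤) (hQ' : ∫⁻ v, ENNReal.ofReal |inner ℝ v ξ * ψ v| ^ 2 * wtF γ (-η) v ≤ Q')
    (hQ'' : Q' ≠ ⊤) {a b : ℝ} (ha : 0 ≤ a) (hab : a ≤ b)
    (hfin : ∫⁻ r in Ioc a b, normSq γ η (f r) ≠ ⊤) :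
    (∫ v, ((ψ v : ℝ) : ℂ) * f b v) - ∫ v, ((ψ v : ℝ) : ℂ) * f a v =
      ∫ r in a..b, ∫ v, modeOp ξ T ψ v * f r v := by
  set μ := ((volume : Measure ℝ).restrict (Ioc a b)).prod (volume : Measure (Vel d)) with hμ
  have hfinM : ∫⁻ v, h.majorant ξ v * wtF γ (-η) v ≠ ⊤ :=
    ((h.lintegral_majorant_le hψ hQ').trans_lt (ENNReal.mul_lt_top (by simp)
      (ENNReal.add_lt_top.mpr ⟨hQ.lt_top, hQ''.lt_top⟩))).ne
  have hMm := h.measurable_majorant (ξ := ξ) hψ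
  have htop := ae_lt_top_of_lintegral_wtF hd hγ hMm hfinM
  set B : Vel d → ℝ := fun v => √(h.majorant ξ v).toReal with hB
  have hBi : Integrable (fun p : ℝ × Vel d => ((B p.2 : ℝ) : ℂ) * f p.1 p.2) μ :=
    hf.integrable_prod_mul hd hγ ha hfin (w := fun v => ((B v : ℝ) : ℂ))
      (Complex.measurable_ofReal.comp hMm.ennreal_toReal.sqrt).aestronglyMeasurable
      ((lintegral_mono fun v => mul_le_mul_left (enorm_sqrt_toReal_sq_le _) _).trans_lt
        hfinM.lt_top).ne
  have hbd : ∀ (w : Vel d → ℂ), (∀ᵐ v, ‖w v‖ₑ ^ 2 ≤ h.majorant ξ v) →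
      ∀ᵐ p ∂μ, ‖w p.2 * f p.1 p.2‖ ≤ ‖((B p.2 : ℝ) : ℂ) * f p.1 p.2‖ := fun w hw => by
    have h1 : ∀ᵐ v, ‖w v‖ ≤ B v := by
      filter_upwards [hw, htop] with v h1 h2 using norm_le_sqrt_toReal h1 h2
    filter_upwards [Measure.quasiMeasurePreserving_snd.ae h1] with p hp
    rw [norm_mul, norm_mul, Complex.norm_real, Real.norm_of_nonneg (Real.sqrt_nonneg _)]
    gcongr
  have hwm : ∀ n, AEStronglyMeasurable (modeOp ξ (L.adj γ (ζ n)) (ζ n)) volume := fun n => by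
    have h1 : Measurable fun v : Vel d =>
        Complex.I * ((inner ℝ v ξ : ℝ) : ℂ) * ((ζ n v : ℝ) : ℂ) := by
      have := (h.test n).1.continuous.measurable
      fun_prop
    exact (Complex.continuous_ofReal.comp_aestronglyMeasurable (h.meas_adj n)).sub
      h1.aestronglyMeasurable
  have hfm := hf.aestronglyMeasurable_Ioc (b := b) ha
  have hint : ∀ n, Integrable (fun p : ℝ × Vel d =>
      modeOp ξ (L.adj γ (ζ n)) (ζ n) p.2 * f p.1 p.2) μ := fun n =>
    hBi.norm.mono' ((hwm n).comp_snd.mul hfm) (hbd _ (h.enorm_modeOp_approx_le n))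
  have hint' : Integrable (fun p : ℝ × Vel d => modeOp ξ T ψ p.2 * f p.1 p.2) μ :=
    hBi.norm.mono' ((h.aestronglyMeasurable_modeOp hψ).comp_snd.mul hfm) (hbd _ h.enorm_modeOp_le)
  have hlim : ∀ᵐ p ∂μ, Tendsto (fun n => modeOp ξ (L.adj γ (ζ n)) (ζ n) p.2 * f p.1 p.2) atTop
      (𝓝 (modeOp ξ T ψ p.2 * f p.1 p.2)) := by
    filter_upwards [Measure.quasiMeasurePreserving_snd.ae h.adj_tendsto] with p hp
    refine Tendsto.mul_const _ (Tendsto.sub ?_ (Tendsto.const_mul _ ?_))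
    · exact (Complex.continuous_ofReal.tendsto _).comp hp
    · exact (Complex.continuous_ofReal.tendsto _).comp (h.tendsto _)
  have hR := tendsto_integral_of_dominated_convergence _ (fun n => (hint n).aestronglyMeasurable)
    hBi.norm (fun n => hbd _ (h.enorm_modeOp_approx_le n)) hlim
  have hside : ∀ t, 0 ≤ t → Tendsto (fun n => ∫ v, ((ζ n v : ℝ) : ℂ) * f t v) atTop
      (𝓝 (∫ v, ((ψ v : ℝ) : ℂ) * f t v)) := fun t ht => by
    have hft := hf.integrable_at hd hγ ht
    refine tendsto_integral_of_dominated_convergence (fun v => C * ‖f t v‖) (fun n => ?_)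
      (hft.norm.const_mul C) (fun n => ae_of_all _ fun v => ?_) (ae_of_all _ fun v => ?_)
    · exact (Complex.continuous_ofReal.comp (h.test n).1.continuous).aestronglyMeasurable.mul
        hft.aestronglyMeasurable
    · rw [norm_mul, Complex.norm_real]
      gcongr
      exact (h.le n v).trans (hC v)
    · exact ((Complex.continuous_ofReal.tendsto _).comp (h.tendsto v)).mul_const _
  have hL := (hside b (ha.trans hab)).sub (hside a ha)
  have heq : ∀ n, (∫ v, ((ζ n v : ℝ) : ℂ) * f b v) - ∫ v, ((ζ n v : ℝ) : ℂ) * f a v =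
      ∫ p, modeOp ξ (L.adj γ (ζ n)) (ζ n) p.2 * f p.1 p.2 ∂μ := fun n => by
    rw [hf.equation _ (h.test n) a b ha hab, intervalIntegral.integral_of_le hab, hμ,
      integral_prod _ (hint n)]
    rfl
  simp_rw [heq] at hL
  rw [tendsto_nhds_unique hL hR, hμ, integral_prod _ hint', intervalIntegral.integral_of_le hab]

lemma intervalIntegrable_moment (hf : IsModeSolution γ L ξ f) (hd : 1 ≤ d) (hγ : 0 < γ)
    {w : Vel d → ℂ} (hw : AEStronglyMeasurable w volume)
    (hw' : ∫⁻ v, ‖w v‖ₑ ^ 2 * wtF γ (-η) v ≠ ⊤) {a b : ℝ} (ha : 0 ≤ a) (hab : a ≤ b)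
    (hfin : ∫⁻ r in Ioc a b, normSq γ η (f r) ≠ ⊤) :
    IntervalIntegrable (fun r => ∫ v, w v * f r v) volume a b := by
  rw [intervalIntegrable_iff_integrableOn_Ioc_of_le hab]
  exact (hf.integrable_prod_mul hd hγ ha hfin hw hw').integral_prod_left

end IsModeSolution

end MomentEvolution

section Correction

section Calculus

lemma absolutelyContinuousOnInterval_congr {X : Type*} [PseudoMetricSpace X] {f g : ℝ → X}
    {a b : ℝ} (hf : AbsolutelyContinuousOnInterval f a b) (h : EqOn f g (uIcc a b)) :
    AbsolutelyContinuousOnInterval g a b := by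
  rw [absolutelyContinuousOnInterval_iff] at hf ⊢
  intro ε hε
  obtain ⟨δ, hδ, H⟩ := hf ε hε
  refine ⟨δ, hδ, fun E hE hlt => lt_of_eq_of_lt (Finset.sum_congr rfl fun i hi => ?_)
    (H E hE hlt)⟩
  rw [h (hE.1 i hi).1, h (hE.1 i hi).2]

variable {M D : ℝ → ℂ} {a b : ℝ}

lemma ac_re_of_integral (hab : a < b) (hD : IntervalIntegrable D volume a b)
    (hM : ∀ t ∈ Icc a b, M t - M a = ∫ r in a..t, D r) :
    AbsolutelyContinuousOnInterval (fun t => (M t).re) a b := by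
  have hre : IntervalIntegrable (fun r => (D r).re) volume a b :=
    ⟨hD.1.re, hD.2.re⟩
  have h1 := (hre.absolutelyContinuousOnInterval_intervalIntegral left_mem_uIcc).fun_add
    ((LipschitzWith.const (M a).re).lipschitzOnWith.absolutelyContinuousOnInterval)
  refine absolutelyContinuousOnInterval_congr h1 fun t ht => ?_
  rw [uIcc_of_le hab.le] at ht
  have h2 := hM t ht
  have h3 : (∫ r in a..t, D r).re = ∫ r in a..t, (D r).re :=
    (Complex.reCLM.intervalIntegral_comp_comm (hD.mono_set (by
      rw [uIcc_of_le hab.le, uIcc_of_le ht.1]; exact Icc_subset_Icc_right ht.2))).symm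
  rw [← h3, ← h2]
  simp

lemma ac_im_of_integral (hab : a < b) (hD : IntervalIntegrable D volume a b)
    (hM : ∀ t ∈ Icc a b, M t - M a = ∫ r in a..t, D r) :
    AbsolutelyContinuousOnInterval (fun t => (M t).im) a b := by
  have h := ac_re_of_integral (M := fun t => -Complex.I * M t) (D := fun t => -Complex.I * D t) hab
    (hD.const_mul _) fun t ht => by
      rw [intervalIntegral.integral_const_mul, ← hM t ht]; ring
  simpa using h

lemma hasDerivAt_of_integral {t : ℝ} (ht : t ∈ Ioo a b)
    (hM : ∀ t ∈ Icc a b, M t - M a = ∫ r in a..t, D r)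
    (h : HasDerivAt (fun x => ∫ r in a..x, D r) (D t) t) : HasDerivAt M (D t) t := by
  refine (h.add_const (M a)).congr_of_eventuallyEq ?_
  filter_upwards [Ioo_mem_nhds ht.1 ht.2] with s hs
  rw [← hM s ⟨hs.1.le, hs.2.le⟩, sub_add_cancel]

lemma ae_hasDerivAt_of_integral (hD : IntervalIntegrable D volume a b)
    (hM : ∀ t ∈ Icc a b, M t - M a = ∫ r in a..t, D r) :
    ∀ᵐ t, t ∈ Ioo a b → HasDerivAt M (D t) t := by
  filter_upwards [hD.ae_hasDerivAt_integral] with t h ht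
  exact hasDerivAt_of_integral ht hM
    (h (Icc_subset_uIcc (Ioo_subset_Icc_self ht)) a left_mem_uIcc)

lemma hasDerivAt_of_integral_of_continuousAt (hD : IntervalIntegrable D volume a b)
    (hM : ∀ t ∈ Icc a b, M t - M a = ∫ r in a..t, D r) {t : ℝ} (ht : t ∈ Ioo a b)
    (hc : ContinuousAt D t) : HasDerivAt M (D t) t := by
  refine hasDerivAt_of_integral ht hM (intervalIntegral.integral_hasDerivAt_right ?_ ?_ hc)
  · refine hD.mono_set ?_
    rw [uIcc_of_le (ht.1.trans ht.2).le, uIcc_of_le ht.1.le]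
    exact Icc_subset_Icc_right ht.2.le
  · exact ⟨Ioc a b, Ioc_mem_nhds ht.1 ht.2, hD.1.aestronglyMeasurable⟩

lemma hasDerivAt_im_mul_re_sub {M N : ℝ → ℂ} {D E : ℂ} {t : ℝ} (hM : HasDerivAt M D t)
    (hN : HasDerivAt N E t) :
    HasDerivAt (fun s => (M s).im * (N s).re - (M s).re * (N s).im)
      ((Complex.I * starRingEnd ℂ D * N t).re + (Complex.I * starRingEnd ℂ (M t) * E).re) t := by
  have h1 := Complex.reCLM.hasFDerivAt.comp_hasDerivAt t hM
  have h2 := Complex.imCLM.hasFDerivAt.comp_hasDerivAt t hM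
  have h3 := Complex.reCLM.hasFDerivAt.comp_hasDerivAt t hN
  have h4 := Complex.imCLM.hasFDerivAt.comp_hasDerivAt t hN
  convert! (h2.fun_mul h3).fun_sub (h1.fun_mul h4) using 1
  simp
  ring

end Calculus

lemma re_le_of_bounds {ρ n p m q : ℂ} {c A X l e : ℝ} (hc : 0 < c) (hA : 0 ≤ A) (hX : 0 ≤ X)
    (hl : 0 ≤ l) (hlA : l ≤ A) (he : 0 < e) (hn : ‖n‖ ^ 2 ≤ A * X) (hp : ‖p‖ ^ 2 ≤ A * l * X)
    (hm : ‖m‖ ^ 2 ≤ A / e * X) (hq : ‖q‖ ^ 2 ≤ A * e * X) :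
    (Complex.I * starRingEnd ℂ (ρ * (-Complex.I * l) + p) * (ρ * c + n)).re +
      (Complex.I * starRingEnd ℂ m * q).re ≤
      -(c / 2 * l * ‖ρ‖ ^ 2) + (A ^ 2 / c + c * A + (A ^ 2 + A) / 2 + A) * X := by
  have e1 : Complex.I * starRingEnd ℂ (ρ * (-Complex.I * l) + p) * (ρ * c + n) =
      -((l * c * ‖ρ‖ ^ 2 : ℝ) : ℂ) + -(l * (starRingEnd ℂ ρ * n)) +
        Complex.I * (starRingEnd ℂ p * (ρ * c + n)) := by
    have h1 : starRingEnd ℂ ρ * ρ = ((‖ρ‖ ^ 2 : ℝ) : ℂ) := by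
      rw [mul_comm, Complex.mul_conj, Complex.normSq_eq_norm_sq]
    have h2 : Complex.I * starRingEnd ℂ (-Complex.I * l) = -l := by
      rw [map_mul, map_neg, Complex.conj_I, Complex.conj_ofReal, neg_neg, ← mul_assoc,
        Complex.I_mul_I, neg_one_mul]
    rw [map_add, map_mul]
    calc _ = starRingEnd ℂ ρ * ρ * (Complex.I * starRingEnd ℂ (-Complex.I * l)) * c +
          (Complex.I * starRingEnd ℂ (-Complex.I * l)) * (starRingEnd ℂ ρ * n) +
          Complex.I * (starRingEnd ℂ p * (ρ * c + n)) := by ring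
      _ = _ := by rw [h1, h2]; push_cast; ring
  have b1 : (-(l * (starRingEnd ℂ ρ * n)) : ℂ).re ≤ l * (‖ρ‖ * ‖n‖) := by
    refine (Complex.re_le_norm _).trans (le_of_eq ?_)
    rw [norm_neg, norm_mul, norm_mul, Complex.norm_real, Real.norm_of_nonneg hl, RCLike.norm_conj]
  have b2 : (Complex.I * (starRingEnd ℂ p * (ρ * c + n))).re ≤ ‖p‖ * (‖ρ‖ * c + ‖n‖) := by
    refine (Complex.re_le_norm _).trans ?_
    rw [norm_mul, norm_mul, Complex.norm_I, one_mul, RCLike.norm_conj]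
    gcongr
    refine (norm_add_le _ _).trans (le_of_eq ?_)
    rw [norm_mul, Complex.norm_real, Real.norm_of_nonneg hc.le]
  have b3 : (Complex.I * starRingEnd ℂ m * q).re ≤ ‖m‖ * ‖q‖ := by
    refine (Complex.re_le_norm _).trans (le_of_eq ?_)
    rw [norm_mul, norm_mul, Complex.norm_I, one_mul, RCLike.norm_conj]
  have hmq : ‖m‖ * ‖q‖ ≤ A * X := by
    refine abs_le_of_sq_le_sq' ?_ (by positivity) |>.2
    calc (‖m‖ * ‖q‖) ^ 2 = ‖m‖ ^ 2 * ‖q‖ ^ 2 := mul_pow _ _ _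
      _ ≤ (A / e * X) * (A * e * X) := by gcongr
      _ = (A * X) ^ 2 := by field_simp
  have hpρ : ‖p‖ * ‖ρ‖ ≤ A * X + l * ‖ρ‖ ^ 2 / 4 := by
    refine abs_le_of_sq_le_sq' ?_ (by positivity) |>.2
    calc (‖p‖ * ‖ρ‖) ^ 2 = ‖p‖ ^ 2 * ‖ρ‖ ^ 2 := mul_pow _ _ _
      _ ≤ (A * l * X) * ‖ρ‖ ^ 2 := by gcongr
      _ ≤ _ := by nlinarith [sq_nonneg (A * X - l * ‖ρ‖ ^ 2 / 4)]
  have hρn : ‖ρ‖ * ‖n‖ ≤ c * ‖ρ‖ ^ 2 / 4 + A * X / c := by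
    have h1 : ‖n‖ ^ 2 / c ≤ A * X / c := by gcongr
    have h2 : ‖ρ‖ * ‖n‖ ≤ c * ‖ρ‖ ^ 2 / 4 + ‖n‖ ^ 2 / c := by
      have h3 : 0 ≤ (c * ‖ρ‖ / 2 - ‖n‖) ^ 2 / c := by positivity
      have h4 : (c * ‖ρ‖ / 2 - ‖n‖) ^ 2 / c = c * ‖ρ‖ ^ 2 / 4 + ‖n‖ ^ 2 / c - ‖ρ‖ * ‖n‖ := by
        field_simp; ring
      linarith
    linarith
  have hlρn : l * (‖ρ‖ * ‖n‖) ≤ l * c * ‖ρ‖ ^ 2 / 4 + A ^ 2 / c * X := by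
    calc l * (‖ρ‖ * ‖n‖) ≤ l * (c * ‖ρ‖ ^ 2 / 4 + A * X / c) := by gcongr
      _ = l * c * ‖ρ‖ ^ 2 / 4 + l * (A * X / c) := by ring
      _ ≤ l * c * ‖ρ‖ ^ 2 / 4 + A * (A * X / c) := by gcongr
      _ = _ := by ring
  have hpn : ‖p‖ * ‖n‖ ≤ (A ^ 2 + A) / 2 * X := by
    have h1 : A * l * X ≤ A * A * X := by gcongr
    nlinarith [sq_nonneg (‖p‖ - ‖n‖)]
  have hcp : c * (‖p‖ * ‖ρ‖) ≤ c * (A * X + l * ‖ρ‖ ^ 2 / 4) := by gcongr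
  rw [e1, Complex.add_re, Complex.add_re, Complex.neg_re, Complex.ofReal_re]
  nlinarith

variable {d : ℕ} {γ β η : ℝ}

lemma corrector_eq (hd : 1 ≤ d) (hγ : 0 < γ) (β : ℝ) (ξ : Vel d) (g : Vel d → ℂ) :
    corrector γ β ξ g =
      (∫ v, ((inner ℝ v ξ * phi β ξ v : ℝ) : ℂ) * g v).im *
          (∫ v, ((jap v ^ (-2 : ℝ) : ℝ) : ℂ) * g v).re -
        (∫ v, ((inner ℝ v ξ * phi β ξ v : ℝ) : ℂ) * g v).re *
          (∫ v, ((jap v ^ (-2 : ℝ) : ℝ) : ℂ) * g v).im := by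
  set M := ∫ v, ((inner ℝ v ξ * phi β ξ v : ℝ) : ℂ) * g v with hM
  set N := ∫ v, ((jap v ^ (-2 : ℝ) : ℝ) : ℂ) * g v with hN
  have e1 : ∫ w, -Complex.I * ((inner ℝ w ξ : ℝ) : ℂ) * ((phi β ξ w : ℝ) : ℂ) * g w =
      -Complex.I * M := by
    rw [hM, ← integral_const_mul]
    refine integral_congr_ae (ae_of_all _ fun v => ?_)
    simp only
    push_cast
    ring
  have e2 : innerMu γ (opA γ β ξ g) g = starRingEnd ℂ (-Complex.I * M) * N := by
    rw [hN, ← integral_const_mul]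
    refine integral_congr_ae (ae_of_all _ fun v => ?_)
    simp only [opA, proj]
    rw [e1, map_mul, map_mul (starRingEnd ℂ) (-Complex.I * M), Complex.conj_ofReal,
      Complex.conj_ofReal]
    have hF : ((equil γ v : ℝ) : ℂ) ≠ 0 := by exact_mod_cast (equil_pos hd hγ v).ne'
    push_cast
    field_simp
  rw [corrector, e2]
  simp

lemma exists_integral_mul_split (hd : 1 ≤ d) (hγ : 0 < γ) (hη : η < γ) {w g : Vel d → ℂ} {W : ℝ}
    (hW0 : 0 ≤ W) (hw : AEStronglyMeasurable w volume)
    (hW : ∫⁻ v, ‖w v‖ₑ ^ 2 * wtF γ (-η) v ≤ ENNReal.ofReal W)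
    (hg : AEStronglyMeasurable g volume) (hX : normSq γ η (micro γ g) ≠ ⊤) :
    ∃ m : ℂ, ∫ v, w v * g v = (∫ v, g v) * (∫ v, w v * ((equil γ v : ℝ) : ℂ)) + m ∧
      ‖m‖ ^ 2 ≤ W * (normSq γ η (micro γ g)).toReal := by
  have hW' : ∫⁻ v, ‖w v‖ₑ ^ 2 * wtF γ (-η) v ≠ ⊤ := (hW.trans_lt ENNReal.ofReal_lt_top).ne
  have hgm := aestronglyMeasurable_micro (γ := γ) hg
  have hP : normSq γ η (proj γ g) ≠ ⊤ := by
    rw [normSq_proj hd hγ]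
    exact ENNReal.mul_ne_top (by simp) (lintegral_wtF_lt_top hd hγ hη).ne
  have i1 := integrable_mul_of_normSq hd hγ hw (aestronglyMeasurable_proj γ g) hW' hP
  have i2 := integrable_mul_of_normSq hd hγ hw hgm hW' hX
  refine ⟨∫ v, w v * micro γ g v, ?_, ?_⟩
  · have e : ∀ v, w v * g v = w v * proj γ g v + w v * micro γ g v := fun v => by
      rw [micro]; ring
    simp_rw [e]
    rw [integral_add i1 i2, ← integral_const_mul]
    congr 2
    funext v
    rw [proj]
    ring
  · have h := (enorm_integral_mul_sq_le hd hγ η hw hgm).trans (mul_le_mul_left hW _)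
    rw [← ENNReal.ofReal_toReal hX, ← ENNReal.ofReal_mul hW0, ← ofReal_norm,
      ← ENNReal.ofReal_pow (norm_nonneg _)] at h
    exact (ENNReal.ofReal_le_ofReal_iff (by positivity)).mp h

lemma integral_eq_zero_of_odd {h : Vel d → ℂ} (hh : ∀ v, h (-v) = -h v) : ∫ v, h v = 0 := by
  have h1 := integral_neg_eq_self h volume
  simp_rw [hh] at h1
  rw [integral_neg] at h1
  exact self_eq_neg.mp h1.symm

end Correction

section Dissipation

variable {d : ℕ} {γ β η : ℝ} {L : Collision d}

/-- For mode solutions which are square integrable in time with values in the weighted space, the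
moment `∫ ψ f` has derivative `∫ w f`, in integrated form. -/
def MomentEquation (γ η : ℝ) (L : Collision d) (ξ : Vel d) (ψ : Vel d → ℝ) (w : Vel d → ℂ) : Prop :=
  ∀ f : ℝ → Vel d → ℂ, IsModeSolution γ L ξ f → ∀ a b : ℝ, 0 ≤ a → a ≤ b →
    ∫⁻ r in Ioc a b, normSq γ η (f r) ≠ ⊤ →
    IntervalIntegrable (fun r => ∫ v, w v * f r v) volume a b ∧
    ∀ t ∈ Icc a b, (∫ v, ((ψ v : ℝ) : ℂ) * f t v) - ∫ v, ((ψ v : ℝ) : ℂ) * f a v =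
      ∫ r in a..t, ∫ v, w v * f r v

lemma Controlled.exists_moment {ξ : Vel d} {ψ T : Vel d → ℝ} {Q Q' : ℝ≥0∞} {ζ : ℕ → Vel d → ℝ}
    {G : Vel d → ℝ≥0∞} (h : Controlled γ η L ψ Q ζ T G) (hd : 1 ≤ d) (hγ : 0 < γ) (hη : η < γ)
    (hψ : Measurable ψ) {C : ℝ} (hC : ∀ v, |ψ v| ≤ C)
    (hI : Integrable fun v => inner ℝ v ξ * ψ v * equil γ v)
    (hQ' : ∫⁻ v, ENNReal.ofReal |inner ℝ v ξ * ψ v| ^ 2 * wtF γ (-η) v ≤ Q') {A : ℝ}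
    (hA : 2 * (Q + Q') ≤ ENNReal.ofReal A) :
    ∃ w : Vel d → ℂ, AEStronglyMeasurable w volume ∧
      ∫⁻ v, ‖w v‖ₑ ^ 2 * wtF γ (-η) v ≤ ENNReal.ofReal A ∧
      ∫ v, w v * ((equil γ v : ℝ) : ℂ) =
        -Complex.I * ((∫ v, inner ℝ v ξ * ψ v * equil γ v : ℝ) : ℂ) ∧
      MomentEquation γ η L ξ ψ w := by
  have hQQ : Q + Q' ≠ ⊤ := fun htop => by
    rw [htop, ENNReal.mul_top (by simp), top_le_iff] at hA
    exact ENNReal.ofReal_ne_top hA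
  obtain ⟨hQ, hQ''⟩ := ENNReal.add_ne_top.mp hQQ
  have hw := h.aestronglyMeasurable_modeOp (ξ := ξ) hψ
  have hw' := (h.lintegral_modeOp_le hψ hQ').trans hA
  refine ⟨modeOp ξ T ψ, hw, hw', ?_, fun f hf a b ha hab hfin => ⟨hf.intervalIntegrable_moment hd hγ
    hw (hw'.trans_lt ENNReal.ofReal_lt_top).ne ha hab hfin, fun t ht => hf.integral_mul_sub hd hγ h
    hψ hC hQ hQ' hQ'' ha ht.1 (ne_top_of_le_ne_top hfin
      (lintegral_mono_set (Ioc_subset_Ioc_right ht.2)))⟩⟩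
  obtain ⟨i1, h0⟩ := h.integral_limit_mul_equil hd hγ hη hQ
  have e : ∀ v, modeOp ξ T ψ v * ((equil γ v : ℝ) : ℂ) = ((T v * equil γ v : ℝ) : ℂ) -
      Complex.I * ((inner ℝ v ξ * ψ v * equil γ v : ℝ) : ℂ) := fun v => by
    rw [modeOp]; push_cast; ring
  simp_rw [e]
  rw [integral_sub i1.ofReal (hI.ofReal.const_mul _), integral_const_mul,
    integral_complex_ofReal, integral_complex_ofReal, h0, Complex.ofReal_zero, zero_sub, neg_mul]

/-- The principal observable `(v·ξ) φ`. -/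
lemma exists_moment_principal (hd : 1 ≤ d) (hγ : 0 < γ) (hγβ : -β < γ) (hη : η < γ)
    (hηβ : -β ≤ η) (hL : AssumptionH γ β L) : ∃ A : ℝ, 0 ≤ A ∧ ∀ ξ : Vel d,
      ∃ w : Vel d → ℂ, AEStronglyMeasurable w volume ∧
        ∫⁻ v, ‖w v‖ₑ ^ 2 * wtF γ (-η) v ≤ ENNReal.ofReal (A * rate γ β ξ) ∧
        ∫ v, w v * ((equil γ v : ℝ) : ℂ) = -Complex.I * rate γ β ξ ∧
        MomentEquation γ η L ξ (fun v => inner ℝ v ξ * phi β ξ v) w := by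
  obtain ⟨C, hC, hE⟩ := exists_envInt_le_rate (d := d) hd hγ hγβ
  obtain ⟨K, hK⟩ := exists_controlled hd hγ hγβ hηβ hL (2 * 2 ^ |β| * 2 ^ |2 * abs (1 + β)|)
    (4 * (1 * (6 * (10 * (1 + |β|) ^ 2)))) (by positivity) (by positivity)
  refine ⟨2 * (|K| * C + 1), by positivity, fun ξ => ?_⟩
  have hr := rate_nonneg (β := β) hd hγ ξ
  obtain ⟨ζ, T, G, h⟩ := hK _ _ ((SymBound.inner_left ξ).mul (SymBound.phi β ξ))
    (Envelope.phi_symbol β ξ)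
  have hψ : Continuous fun v : Vel d => inner ℝ v ξ * phi β ξ v :=
    (continuous_id.inner continuous_const).mul (continuous_phi β ξ)
  have e1 : ∀ v : Vel d, inner ℝ v ξ * (inner ℝ v ξ * phi β ξ v) = (inner ℝ v ξ) ^ 2 * phi β ξ v :=
    fun v => by ring
  have hQ' : ∫⁻ v : Vel d, ENNReal.ofReal |inner ℝ v ξ * (inner ℝ v ξ * phi β ξ v)| ^ 2 *
      wtF γ (-η) v ≤ ENNReal.ofReal (rate γ β ξ) := by
    simp_rw [e1, fun v => abs_of_nonneg (mul_nonneg (sq_nonneg (inner ℝ v ξ)) (phi_pos β ξ v).le)]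
    exact lintegral_inner_sq_mul_phi_sq_le hd hγ hγβ hηβ ξ
  have e2 : ∀ v : Vel d, inner ℝ v ξ * (inner ℝ v ξ * phi β ξ v) * equil γ v =
      (inner ℝ v ξ) ^ 2 * (phi β ξ v * equil γ v) := fun v => by ring
  have key := h.exists_moment (ξ := ξ) (C := 1) hd hγ hη hψ.measurable (fun v => ?_) (by
    simp_rw [e2]; exact integrable_rate hd hγ hγβ ξ) hQ' (A := 2 * (|K| * C + 1) * rate γ β ξ) ?_
  · simp_rw [e2] at key
    exact key
  · have hφ := phi_pos β ξ v
    rw [abs_mul, abs_of_pos hφ]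
    refine le_trans ?_ (norm_mul_phi_le_one β ξ v)
    gcongr
    rw [mul_comm]
    exact (abs_real_inner_le_norm v ξ).trans (by gcongr; exact norm_le_jap v)
  · calc _ ≤ 2 * (ENNReal.ofReal |K| * ENNReal.ofReal (C * rate γ β ξ) +
          ENNReal.ofReal (rate γ β ξ)) := by
          gcongr
          · exact le_abs_self K
          · exact hE ξ
      _ = _ := by
          rw [← ENNReal.ofReal_mul (abs_nonneg K), ← ENNReal.ofReal_add (by positivity) hr,
            ← ENNReal.ofReal_ofNat 2, ← ENNReal.ofReal_mul (by norm_num)]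
          congr 1
          ring

lemma abs_inner_mul_jap_le (ξ v : Vel d) : |inner ℝ v ξ * jap v ^ (-2 : ℝ)| ≤ ‖ξ‖ := by
  have hj := jap_pos v
  rw [abs_mul, abs_of_pos (jap_rpow_pos v _), Real.rpow_neg hj.le, Real.rpow_two,
    ← div_eq_mul_inv, div_le_iff₀ (by positivity)]
  refine (abs_real_inner_le_norm v ξ).trans ?_
  rw [mul_comm]
  gcongr
  exact (norm_le_jap v).trans (le_self_pow₀ (one_le_jap v) (by norm_num))

/-- The auxiliary observable `⟨v⟩⁻²`. -/
lemma exists_moment_auxiliary (hd : 1 ≤ d) (hγ : 0 < γ) (hγβ : -β < γ) (hη' : -γ < η) (hη : η < γ)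
    (hηβ : -β ≤ η) (hL : AssumptionH γ β L) : ∃ A : ℝ, 0 ≤ A ∧ ∀ ξ : Vel d,
      ∃ w : Vel d → ℂ, AEStronglyMeasurable w volume ∧
        ∫⁻ v, ‖w v‖ₑ ^ 2 * wtF γ (-η) v ≤ ENNReal.ofReal (A * (1 + ‖ξ‖ ^ 2)) ∧
        ∫ v, w v * ((equil γ v : ℝ) : ℂ) = 0 ∧
        MomentEquation γ η L ξ (fun v => jap v ^ (-2 : ℝ)) w := by
  obtain ⟨K, hK⟩ := exists_controlled hd hγ hγβ hηβ hL (2 ^ |(-2 : ℝ)|)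
    (6 * ((1 + |(-2 : ℝ)|) ^ 2)) (by positivity) (by positivity)
  have hI1 := lintegral_wtF_lt_top (d := d) (k := -β) hd hγ hγβ
  have hI2 := lintegral_wtF_lt_top (d := d) (k := -η) hd hγ (by linarith)
  set I₁ := ∫⁻ v : Vel d, wtF γ (-β) v with hI₁
  set I₂ := ∫⁻ v : Vel d, wtF γ (-η) v with hI₂
  refine ⟨2 * (|K| * I₁.toReal + I₂.toReal), by positivity, fun ξ => ?_⟩
  obtain ⟨ζ, T, G, h⟩ := hK _ _ (SymBound.jap_rpow (d := d) (-2))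
    (Envelope.jap_rpow (by norm_num))
  have hQ' : ∫⁻ v : Vel d, ENNReal.ofReal |inner ℝ v ξ * jap v ^ (-2 : ℝ)| ^ 2 *
      wtF γ (-η) v ≤ ENNReal.ofReal (‖ξ‖ ^ 2 * I₂.toReal) := by
    rw [ENNReal.ofReal_mul (by positivity), ENNReal.ofReal_toReal hI2.ne, hI₂,
      ← lintegral_const_mul _ (measurable_wtF _ _), ENNReal.ofReal_pow (norm_nonneg _)]
    refine lintegral_mono fun v => ?_
    gcongr
    exact abs_inner_mul_jap_le ξ v
  have hE : envInt γ β (fun v : Vel d => jap v ^ (-2 : ℝ)) ≤ ENNReal.ofReal I₁.toReal := by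
    rw [ENNReal.ofReal_toReal hI1.ne, envInt]
    refine lintegral_mono fun v => ?_
    refine mul_le_of_le_one_left' (pow_le_one₀ zero_le ?_)
    rw [ENNReal.ofReal_le_one]
    exact jap_rpow_le_one v (by norm_num)
  have key := h.exists_moment (ξ := ξ) (C := 1) hd hγ hη
    (continuous_jap_rpow (-2)).measurable (fun v => ?_) ?_ hQ'
    (A := 2 * (|K| * I₁.toReal + I₂.toReal) * (1 + ‖ξ‖ ^ 2)) ?_
  · have h0 : ∫ v : Vel d, ((inner ℝ v ξ * jap v ^ (-2 : ℝ) * equil γ v : ℝ) : ℂ) = 0 :=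
      integral_eq_zero_of_odd fun v => by
        rw [inner_neg_left, jap_neg, equil_neg]; push_cast; ring
    rw [integral_complex_ofReal] at h0
    rw [h0, mul_zero] at key
    exact key
  · rw [abs_of_pos (jap_rpow_pos v _)]
    exact jap_rpow_le_one v (by norm_num)
  · exact (integrable_equil hd hγ).bdd_mul (c := ‖ξ‖)
      ((continuous_id.inner continuous_const).mul (continuous_jap_rpow (-2))).aestronglyMeasurable
      (ae_of_all _ fun v => abs_inner_mul_jap_le ξ v)
  · calc _ ≤ 2 * (ENNReal.ofReal |K| * ENNReal.ofReal I₁.toReal +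
          ENNReal.ofReal (‖ξ‖ ^ 2 * I₂.toReal)) := by
          gcongr
          exact le_abs_self K
      _ = ENNReal.ofReal (2 * (|K| * I₁.toReal + ‖ξ‖ ^ 2 * I₂.toReal)) := by
          rw [← ENNReal.ofReal_mul (abs_nonneg K), ← ENNReal.ofReal_add (by positivity)
            (by positivity), ENNReal.ofReal_mul (p := 2) (by norm_num), ENNReal.ofReal_ofNat]
      _ ≤ _ := by
          refine ENNReal.ofReal_le_ofReal ?_
          have h1 : 0 ≤ |K| * I₁.toReal * ‖ξ‖ ^ 2 := by positivity
          have h2 : 0 ≤ I₂.toReal := ENNReal.toReal_nonneg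
          linarith

lemma lintegral_psi_sq_le (hd : 1 ≤ d) (hγ : 0 < γ) (hη : -η < γ) {ψ : Vel d → ℝ} {B : ℝ}
    (hB : 0 ≤ B) (hψ : ∀ v, ψ v ^ 2 ≤ B) :
    ∫⁻ v, ‖((ψ v : ℝ) : ℂ)‖ₑ ^ 2 * wtF γ (-η) v ≤
      ENNReal.ofReal ((∫⁻ v : Vel d, wtF γ (-η) v).toReal * B) := by
  have hI2 := lintegral_wtF_lt_top (d := d) (k := -η) hd hγ hη
  rw [mul_comm, ENNReal.ofReal_mul hB, ENNReal.ofReal_toReal hI2.ne,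
    ← lintegral_const_mul _ (measurable_wtF _ _)]
  refine lintegral_mono fun v => ?_
  gcongr
  rw [← ofReal_norm, Complex.norm_real, ← ENNReal.ofReal_pow (norm_nonneg _), Real.norm_eq_abs,
    sq_abs]
  exact ENNReal.ofReal_le_ofReal (hψ v)

lemma integral_jap_rpow_mul_equil_pos (hd : 1 ≤ d) (hγ : 0 < γ) {k : ℝ} (hk : k < γ) :
    0 < ∫ v : Vel d, jap v ^ k * equil γ v := by
  have hpos : ∀ v : Vel d, 0 < jap v ^ k * equil γ v := fun v =>
    mul_pos (jap_rpow_pos v _) (equil_pos hd hγ v)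
  rw [integral_pos_iff_support_of_nonneg (fun v => (hpos v).le)
    (integrable_jap_rpow_mul_equil hd hγ hk),
    show Function.support (fun v : Vel d => jap v ^ k * equil γ v) = univ from
      eq_univ_of_forall fun v => (hpos v).ne']
  exact Measure.measure_univ_pos.mpr (NeZero.ne _)

lemma toReal_lintegral_wtF_pos (hd : 1 ≤ d) (hγ : 0 < γ) {k : ℝ} (hk : k < γ) :
    0 < (∫⁻ v : Vel d, wtF γ k v).toReal := by
  have h := integral_jap_rpow_mul_equil_pos (d := d) hd hγ hk
  rw [integral_eq_lintegral_of_nonneg_ae (ae_of_all _ fun v =>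
    (mul_pos (jap_rpow_pos v _) (equil_pos hd hγ v)).le)
    (integrable_jap_rpow_mul_equil hd hγ hk).aestronglyMeasurable] at h
  exact h

lemma inner_mul_phi_sq_le (β : ℝ) (ξ v : Vel d) :
    (inner ℝ v ξ * phi β ξ v) ^ 2 ≤ 2 / (1 + ‖ξ‖ ^ 2) := by
  have hφ := phi_pos β ξ v
  have hj := jap_pos v
  have hle : (inner ℝ v ξ * phi β ξ v) ^ 2 ≤ (‖ξ‖ * jap v * phi β ξ v) ^ 2 := by
    rw [← sq_abs, abs_mul, abs_of_pos hφ]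
    gcongr
    rw [mul_comm]
    exact (abs_real_inner_le_norm v ξ).trans (by gcongr; exact norm_le_jap v)
  have h3 : (‖ξ‖ * jap v * phi β ξ v) ^ 2 ≤ 1 :=
    pow_le_one₀ (by positivity) (norm_mul_phi_le_one β ξ v)
  have h4 : (‖ξ‖ ^ 2 * jap v * phi β ξ v) ^ 2 ≤ 1 :=
    pow_le_one₀ (by positivity) (norm_sq_mul_jap_mul_phi_le_one β ξ v)
  have h5 : (‖ξ‖ ^ 2 * jap v * phi β ξ v) ^ 2 = (‖ξ‖ * jap v * phi β ξ v) ^ 2 * ‖ξ‖ ^ 2 := by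
    ring
  rw [le_div_iff₀ (by positivity)]
  nlinarith

set_option maxHeartbeats 1000000 in
/-- The dissipation estimate at a fixed time, in terms of the time derivatives of the moments. -/
lemma exists_dissipation (hd : 1 ≤ d) (hγ : 0 < γ) (hγβ : -β < γ) (hη' : -γ < η) (hη : η < γ)
    (hηβ : -β ≤ η) (hL : AssumptionH γ β L) : ∃ c K : ℝ, 0 < c ∧ 0 < K ∧ ∀ ξ : Vel d,
    ∃ w₁ w₂ : Vel d → ℂ,
      (AEStronglyMeasurable w₁ volume ∧ ∫⁻ v, ‖w₁ v‖ₑ ^ 2 * wtF γ (-η) v ≠ ⊤) ∧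
      (AEStronglyMeasurable w₂ volume ∧ ∫⁻ v, ‖w₂ v‖ₑ ^ 2 * wtF γ (-η) v ≠ ⊤) ∧
      MomentEquation γ η L ξ (fun v => inner ℝ v ξ * phi β ξ v) w₁ ∧
      MomentEquation γ η L ξ (fun v => jap v ^ (-2 : ℝ)) w₂ ∧
      ∀ g : Vel d → ℂ, AEStronglyMeasurable g volume → normSq γ η (micro γ g) ≠ ⊤ →
        c * (symbolL γ β ξ * (normSq γ 0 (proj γ g)).toReal -
            K * (normSq γ η (micro γ g)).toReal) ≤
          -((Complex.I * starRingEnd ℂ (∫ v, w₁ v * g v) *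
              ∫ v, ((jap v ^ (-2 : ℝ) : ℝ) : ℂ) * g v).re +
            (Complex.I * starRingEnd ℂ (∫ v, ((inner ℝ v ξ * phi β ξ v : ℝ) : ℂ) * g v) *
              ∫ v, w₂ v * g v).re) := by
  obtain ⟨A₁, hA₁, h₁⟩ := exists_moment_principal (d := d) hd hγ hγβ hη hηβ hL
  obtain ⟨A₂, hA₂, h₂⟩ := exists_moment_auxiliary (d := d) hd hγ hγβ hη' hη hηβ hL
  obtain ⟨S, hS, hS'⟩ := exists_symbolL_le_rate (d := d) (β := β) hd hγ hγβ
  set I := (∫⁻ v : Vel d, wtF γ (-η) v).toReal with hI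
  have hI0 : 0 ≤ I := ENNReal.toReal_nonneg
  set R := ∫ v : Vel d, jap v ^ (-β) * equil γ v with hR
  have hR0 : 0 ≤ R := integral_nonneg fun v =>
    mul_nonneg (jap_rpow_pos v _).le (equil_pos hd hγ v).le
  set A := A₁ + A₂ + 2 * I + R with hA
  have hA0 : 0 ≤ A := by positivity
  have hiF := integrable_equil (d := d) hd hγ
  set F₀ := (∫⁻ v : Vel d, wtF γ 0 v).toReal with hF₀
  have hJi := integrable_jap_rpow_mul_equil (d := d) (k := -2) hd hγ (by linarith)
  set c₂ := ∫ v : Vel d, jap v ^ (-2 : ℝ) * equil γ v with hc₂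
  have hc : 0 < c₂ := integral_jap_rpow_mul_equil_pos hd hγ (by linarith)
  have hF0 : 0 < F₀ := toReal_lintegral_wtF_pos hd hγ hγ
  set K₀ := A ^ 2 / c₂ + c₂ * A + (A ^ 2 + A) / 2 + A with hK₀
  have hK0 : 0 ≤ K₀ := by positivity
  set c := c₂ / 2 / (S * F₀) with hcdef
  have hc0 : 0 < c := by positivity
  refine ⟨c, (K₀ + 1) / c, hc0, by positivity, fun ξ => ?_⟩
  obtain ⟨w₁, m₁, b₁, z₁, e₁⟩ := h₁ ξ
  obtain ⟨w₂, m₂, b₂, z₂, e₂⟩ := h₂ ξ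
  refine ⟨w₁, w₂, ⟨m₁, (b₁.trans_lt ENNReal.ofReal_lt_top).ne⟩,
    ⟨m₂, (b₂.trans_lt ENNReal.ofReal_lt_top).ne⟩, e₁, e₂, fun g hg hX => ?_⟩
  have hr := rate_nonneg (β := β) hd hγ ξ
  have hrR : rate γ β ξ ≤ R := rate_le hd hγ hγβ ξ
  have he : 0 < 1 + ‖ξ‖ ^ 2 := by positivity
  set X := (normSq γ η (micro γ g)).toReal with hXdef
  have hX0 : 0 ≤ X := ENNReal.toReal_nonneg
  set ρ := ∫ v, g v with hρ
  have hψ₁ : Continuous fun v : Vel d => ((inner ℝ v ξ * phi β ξ v : ℝ) : ℂ) :=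
    Complex.continuous_ofReal.comp
      ((continuous_id.inner continuous_const).mul (continuous_phi β ξ))
  have hψ₂ : Continuous fun v : Vel d => ((jap v ^ (-2 : ℝ) : ℝ) : ℂ) :=
    Complex.continuous_ofReal.comp (continuous_jap_rpow (-2))
  obtain ⟨p, hp, hp'⟩ := exists_integral_mul_split hd hγ hη (by positivity) m₁ b₁ hg hX
  obtain ⟨q, hq, hq'⟩ := exists_integral_mul_split hd hγ hη (by positivity) m₂ b₂ hg hX
  have hb1 := inner_mul_phi_sq_le β ξ
  obtain ⟨m, hm, hm'⟩ := exists_integral_mul_split hd hγ hη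
    (W := I * (2 / (1 + ‖ξ‖ ^ 2))) (by positivity)
    hψ₁.aestronglyMeasurable (lintegral_psi_sq_le hd hγ (by linarith) (by positivity) hb1) hg hX
  obtain ⟨n, hn, hn'⟩ := exists_integral_mul_split hd hγ hη (W := I * 1) (by positivity)
    hψ₂.aestronglyMeasurable (lintegral_psi_sq_le hd hγ (by linarith) zero_le_one fun v =>
      pow_le_one₀ (jap_rpow_pos v _).le (jap_rpow_le_one v (by norm_num))) hg hX
  have hm0 : ∫ v : Vel d, ((inner ℝ v ξ * phi β ξ v : ℝ) : ℂ) * ((equil γ v : ℝ) : ℂ) = 0 :=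
    integral_eq_zero_of_odd fun v => by
      rw [inner_neg_left, phi_neg, equil_neg]; push_cast; ring
  have hn0 : ∫ v : Vel d, ((jap v ^ (-2 : ℝ) : ℝ) : ℂ) * ((equil γ v : ℝ) : ℂ) = c₂ := by
    rw [hc₂, ← integral_complex_ofReal]
    simp
  rw [z₁] at hp
  rw [z₂, mul_zero, zero_add] at hq
  rw [hm0, mul_zero, zero_add] at hm
  rw [hn0] at hn
  have hproj : (normSq γ 0 (proj γ g)).toReal = ‖ρ‖ ^ 2 * F₀ := by
    rw [normSq_proj hd hγ, ENNReal.toReal_mul, ENNReal.toReal_pow, toReal_enorm]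
  rw [hp, hq, hm, hn, hproj, ← hρ]
  rw [← hXdef] at hp' hq' hm' hn'
  clear_value X ρ F₀ c₂ I R
  clear_value A K₀
  clear_value c
  clear hp hq hm hn hm0 hn0 hψ₁ hψ₂ e₁ e₂ z₁ z₂ b₁ b₂ h₁ h₂
  have key := re_le_of_bounds (ρ := ρ) (n := n) (p := p) (m := m) (q := q) (c := c₂) (A := A)
    (X := X) (l := rate γ β ξ) (e := 1 + ‖ξ‖ ^ 2) hc hA0 hX0 hr (by linarith) he
    (hn'.trans (by gcongr; linarith))
    (hp'.trans (by gcongr; linarith))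
    (hm'.trans (by
      rw [mul_div_assoc']
      gcongr
      linarith))
    (hq'.trans (by gcongr; linarith))
  rw [← hK₀] at key
  have h6 : symbolL γ β ξ * (‖ρ‖ ^ 2 * F₀) ≤ S * rate γ β ξ * (‖ρ‖ ^ 2 * F₀) := by
    gcongr
    exact hS' ξ
  calc c * (symbolL γ β ξ * (‖ρ‖ ^ 2 * F₀) - (K₀ + 1) / c * X)
      ≤ c * (S * rate γ β ξ * (‖ρ‖ ^ 2 * F₀) - (K₀ + 1) / c * X) := by gcongr
    _ = c₂ / 2 * rate γ β ξ * ‖ρ‖ ^ 2 - (K₀ + 1) * X := by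
        rw [mul_sub, ← mul_assoc c ((K₀ + 1) / c), mul_div_cancel₀ _ hc0.ne', hcdef]
        field_simp
    _ ≤ c₂ / 2 * rate γ β ξ * ‖ρ‖ ^ 2 - K₀ * X := by nlinarith
    _ ≤ _ := by linarith

end Dissipation

section TimeRegularity

variable {d : ℕ} {γ β η : ℝ} {L : Collision d} {ξ : Vel d} {f : ℝ → Vel d → ℂ}

lemma normSq_micro_ne_top (hd : 1 ≤ d) (hγ : 0 < γ) (hη : η < γ) {g : Vel d → ℂ}
    (hg : AEStronglyMeasurable g volume) (h : normSq γ η g ≠ ⊤) : normSq γ η (micro γ g) ≠ ⊤ := by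
  have h1 := normSq_add_le γ η hg fun v => (-1) * proj γ g v
  rw [normSq_const_mul γ η (-1) (aestronglyMeasurable_proj γ g), normSq_proj hd hγ] at h1
  have h2 : micro γ g = fun v => g v + (-1) * proj γ g v := funext fun v => by rw [micro]; ring
  rw [h2]
  refine ne_top_of_le_ne_top (ENNReal.mul_ne_top (by simp) (ENNReal.add_ne_top.mpr ⟨h, ?_⟩)) h1
  exact ENNReal.mul_ne_top (by simp)
    (ENNReal.mul_ne_top (by simp) (lintegral_wtF_lt_top hd hγ hη).ne)

lemma normSq_ne_top_of_micro (hd : 1 ≤ d) (hγ : 0 < γ) (hη : η < γ) {g : Vel d → ℂ}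
    (h : normSq γ η (micro γ g) ≠ ⊤) : normSq γ η g ≠ ⊤ := by
  refine ne_top_of_le_ne_top (ENNReal.mul_ne_top (by simp) (ENNReal.add_ne_top.mpr ⟨?_, h⟩))
    (normSq_le_micro hd hγ η g)
  exact ENNReal.mul_ne_top (by simp) (lintegral_wtF_lt_top hd hγ hη).ne

namespace IsModeSolution

lemma lintegral_normSq_ne_top (hf : IsModeSolution γ L ξ f) (hd : 1 ≤ d) (hγ : 0 < γ) (hη : η < γ)
    {a b : ℝ} (ha : 0 ≤ a) (h : ∫⁻ t in Ioc a b, normSq γ η (micro γ (f t)) ≠ ⊤) :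
    ∫⁻ t in Ioc a b, normSq γ η (f t) ≠ ⊤ := by
  obtain ⟨C, hC⟩ := hf.locBdd b
  have hI := (lintegral_wtF_lt_top (d := d) hd hγ hη).ne
  have hI0 := (lintegral_wtF_lt_top (d := d) hd hγ hγ).ne
  set B : ℝ≥0∞ := (∫⁻ v : Vel d, wtF γ 0 v) * ENNReal.ofReal C * ∫⁻ v : Vel d, wtF γ η v with hB
  have hBt : B ≠ ⊤ := ENNReal.mul_ne_top (ENNReal.mul_ne_top hI0 ENNReal.ofReal_ne_top) hI
  have h1 : ∫⁻ t in Ioc a b, normSq γ η (f t) ≤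
      ∫⁻ t in Ioc a b, 2 * (B + normSq γ η (micro γ (f t))) := by
    refine lintegral_mono_ae ?_
    filter_upwards [ae_restrict_mem measurableSet_Ioc] with t ht
    have ht0 : 0 ≤ t := ha.trans ht.1.le
    refine (normSq_le_micro hd hγ η (f t)).trans ?_
    gcongr 2 * (?_ + _)
    rw [hB]
    gcongr
    refine (enorm_integral_sq_le hd hγ (hf.meas_at t ht0)).trans ?_
    gcongr
    exact hC t ht0 ht.2
  refine ne_top_of_le_ne_top ?_ h1
  rw [lintegral_const_mul' _ _ (by simp), lintegral_add_left measurable_const]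
  refine ENNReal.mul_ne_top (by simp) (ENNReal.add_ne_top.mpr ⟨?_, h⟩)
  rw [lintegral_const]
  exact ENNReal.mul_ne_top hBt (by simp)

lemma continuousAt_moment (hf : IsModeSolution γ L ξ f) (hd : 1 ≤ d) (hγ : 0 < γ) {t : ℝ}
    (ht : 0 < t) (hft : normSq γ η (f t) ≠ ⊤)
    (hc : Tendsto (fun s => normSq γ η (fun v => f s v - f t v)) (𝓝 t) (𝓝 0)) {w : Vel d → ℂ}
    (hw : AEStronglyMeasurable w volume) (hw' : ∫⁻ v, ‖w v‖ₑ ^ 2 * wtF γ (-η) v ≠ ⊤) :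
    ContinuousAt (fun r => ∫ v, w v * f r v) t := by
  set W := ∫⁻ v, ‖w v‖ₑ ^ 2 * wtF γ (-η) v with hW
  have h1 : Tendsto (fun s => (W * normSq γ η (fun v => f s v - f t v)) ^ (2⁻¹ : ℝ)) (𝓝 t)
      (𝓝 0) := by
    have h2 := ENNReal.Tendsto.const_mul hc (Or.inr hw')
    rw [mul_zero] at h2
    have h3 := (ENNReal.continuous_rpow_const (y := (2⁻¹ : ℝ))).tendsto 0 |>.comp h2
    rwa [ENNReal.zero_rpow_of_pos (by norm_num)] at h3
  rw [ContinuousAt, tendsto_iff_edist_tendsto_0]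
  refine tendsto_of_tendsto_of_tendsto_of_le_of_le' tendsto_const_nhds h1
    (Eventually.of_forall fun s => zero_le) ?_
  filter_upwards [Ioi_mem_nhds ht, hc.eventually (gt_mem_nhds (ENNReal.zero_lt_top))] with s hs hs'
  have hms := hf.meas_at s (le_of_lt hs)
  have hmt := hf.meas_at t ht.le
  have i1 := integrable_mul_of_normSq hd hγ hw hmt hw' hft
  have i2 : Integrable fun v => w v * (f s v - f t v) :=
    integrable_mul_of_normSq hd hγ hw (hms.sub hmt) hw' hs'.ne
  have e : (∫ v, w v * f s v) - ∫ v, w v * f t v = ∫ v, w v * (f s v - f t v) := by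
    have : ∀ v, w v * f s v = w v * f t v + w v * (f s v - f t v) := fun v => by ring
    simp_rw [this]
    rw [integral_add i1 i2, add_sub_cancel_left]
  rw [edist_eq_enorm_sub, e, ENNReal.le_rpow_inv_iff (by norm_num), ENNReal.rpow_two]
  exact enorm_integral_mul_sq_le hd hγ η hw (hms.sub hmt)

lemma exists_interval (hf : IsModeSolution γ L ξ f) {t : ℝ} (ht : 0 < t)
    (hft : normSq γ η (f t) ≠ ⊤)
    (hc : Tendsto (fun s => normSq γ η (fun v => f s v - f t v)) (𝓝 t) (𝓝 0)) :
    ∃ a b : ℝ, 0 ≤ a ∧ t ∈ Ioo a b ∧ ∫⁻ r in Ioc a b, normSq γ η (f r) ≠ ⊤ := by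
  obtain ⟨ε, hε, hball⟩ := Metric.eventually_nhds_iff.mp
    ((hc.eventually (gt_mem_nhds one_pos)).and (Ioi_mem_nhds ht))
  refine ⟨t - ε / 2, t + ε / 2, ?_, ⟨by linarith, by linarith⟩, ?_⟩
  · refine le_of_lt (hball (y := t - ε / 2) ?_).2
    rw [Real.dist_eq, abs_lt]
    constructor <;> linarith
  · refine ne_top_of_le_ne_top (b := ∫⁻ r in Ioc (t - ε / 2) (t + ε / 2),
      2 * (normSq γ η (f t) + 1)) ?_ (lintegral_mono_ae ?_)
    · rw [lintegral_const]
      exact ENNReal.mul_ne_top (ENNReal.mul_ne_top (by simp)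
        (ENNReal.add_ne_top.mpr ⟨hft, by simp⟩)) (by simp)
    · filter_upwards [ae_restrict_mem measurableSet_Ioc] with r hr
      have hr' := hball (y := r) (by
        rw [Real.dist_eq, abs_lt]
        constructor <;> linarith [hr.1, hr.2])
      have h1 := normSq_add_le γ η (hf.meas_at t ht.le) fun v => f r v - f t v
      simp only [add_sub_cancel] at h1
      refine h1.trans ?_
      gcongr
      exact hr'.1.le

end IsModeSolution

end TimeRegularity

end FracHypo

end

open FracHypo
theorem proposition3 (d : ℕ) (hd : 1 ≤ d) (γ β η : ℝ) (hγ : max 0 (-β) < γ)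
    (hη : -γ < η) (hη' : η < γ) (hηβ : -β ≤ η)
    (L : Collision d) (hL : AssumptionH γ β L) :
    ∃ c : ℝ, 0 < c ∧ ∃ K : Vel d → ℝ, (∀ ξ, 0 < K ξ) ∧ (∃ M : ℝ, ∀ ξ, K ξ ≤ M) ∧
      ∀ (ξ : Vel d) (f : ℝ → Vel d → ℂ), IsModeSolution γ L ξ f →
        -- on time intervals on which `(1 - Π) f` is square integrable with values in the
        -- weighted space, the correction term is absolutely continuous, and the estimate
        -- holds almost everywhere
        (∀ a b : ℝ, 0 ≤ a → a < b →
          (∫⁻ t in Ioo a b, normSq γ η (micro γ (f t))) ≠ ⊤ →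
          AbsolutelyContinuousOnInterval (fun t => corrector γ β ξ (f t)) a b ∧
          ∀ᵐ t : ℝ, t ∈ Ioo a b →
            DifferentiableAt ℝ (fun s => corrector γ β ξ (f s)) t ∧
            c * (symbolL γ β ξ * (normSq γ 0 (proj γ (f t))).toReal
              - K ξ * (normSq γ η (micro γ (f t))).toReal) ≤ corrDissip γ β ξ f t) ∧
        -- the estimate holds at every time at which `f` is continuous with values in the
        -- weighted space
        (∀ t : ℝ, 0 < t → normSq γ η (micro γ (f t)) ≠ ⊤ →
          Tendsto (fun s => normSq γ η (fun v => f s v - f t v)) (𝓝 t) (𝓝 0) →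
          DifferentiableAt ℝ (fun s => corrector γ β ξ (f s)) t ∧
            c * (symbolL γ β ξ * (normSq γ 0 (proj γ (f t))).toReal
              - K ξ * (normSq γ η (micro γ (f t))).toReal) ≤ corrDissip γ β ξ f t) := by
  obtain ⟨hγ0, hγβ⟩ := max_lt_iff.mp hγ
  obtain ⟨c, K, hc, hK, H⟩ := exists_dissipation (d := d) hd hγ0 hγβ hη hη' hηβ hL
  refine ⟨c, hc, fun _ => K, fun _ => hK, ⟨K, fun _ => le_rfl⟩, fun ξ f hf => ?_⟩
  obtain ⟨w₁, w₂, ⟨m₁, b₁⟩, ⟨m₂, b₂⟩, e₁, e₂, hest⟩ := H ξ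
  have hcor := fun t => corrector_eq hd hγ0 β ξ (f t)
  have pointwise : ∀ t, 0 ≤ t → normSq γ η (micro γ (f t)) ≠ ⊤ →
      HasDerivAt (fun s => ∫ v, ((inner ℝ v ξ * phi β ξ v : ℝ) : ℂ) * f s v)
        (∫ v, w₁ v * f t v) t →
      HasDerivAt (fun s => ∫ v, ((jap v ^ (-2 : ℝ) : ℝ) : ℂ) * f s v) (∫ v, w₂ v * f t v) t →
      DifferentiableAt ℝ (fun s => corrector γ β ξ (f s)) t ∧
        c * (symbolL γ β ξ * (normSq γ 0 (proj γ (f t))).toReal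
          - K * (normSq γ η (micro γ (f t))).toReal) ≤ corrDissip γ β ξ f t := by
    intro t ht hX h1 h2
    have h3 := hasDerivAt_im_mul_re_sub h1 h2
    simp_rw [← hcor] at h3
    refine ⟨h3.differentiableAt, ?_⟩
    rw [corrDissip, h3.deriv]
    exact hest (f t) (hf.meas_at t ht) hX
  refine ⟨fun a b ha hab hfin => ?_, fun t ht hX hcont => ?_⟩
  · rw [Measure.restrict_congr_set Ioo_ae_eq_Ioc] at hfin
    have hfin' := hf.lintegral_normSq_ne_top hd hγ0 hη' ha hfin
    obtain ⟨i₁, u₁⟩ := e₁ f hf a b ha hab.le hfin'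
    obtain ⟨i₂, u₂⟩ := e₂ f hf a b ha hab.le hfin'
    constructor
    · simp_rw [hcor]
      exact ((ac_im_of_integral hab i₁ u₁).fun_mul (ac_re_of_integral hab i₂ u₂)).fun_sub
        ((ac_re_of_integral hab i₁ u₁).fun_mul (ac_im_of_integral hab i₂ u₂))
    · have hae := (ae_restrict_iff' measurableSet_Ioc).mp
        (ae_lt_top' (hf.aemeasurable_normSq ha η) hfin')
      filter_upwards [ae_hasDerivAt_of_integral i₁ u₁, ae_hasDerivAt_of_integral i₂ u₂, hae]
        with t h1 h2 h3 ht
      have ht0 : 0 ≤ t := ha.trans ht.1.le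
      exact pointwise t ht0 (normSq_micro_ne_top hd hγ0 hη' (hf.meas_at t ht0)
        (h3 (Ioo_subset_Ioc_self ht)).ne) (h1 ht) (h2 ht)
  · have hft := normSq_ne_top_of_micro hd hγ0 hη' hX
    obtain ⟨a, b, ha, hab, hfin⟩ := hf.exists_interval ht hft hcont
    obtain ⟨i₁, u₁⟩ := e₁ f hf a b ha (hab.1.trans hab.2).le hfin
    obtain ⟨i₂, u₂⟩ := e₂ f hf a b ha (hab.1.trans hab.2).le hfin
    exact pointwise t ht.le hX
      (hasDerivAt_of_integral_of_continuousAt i₁ u₁ hab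
        (hf.continuousAt_moment hd hγ0 ht hft hcont m₁ b₁))
      (hasDerivAt_of_integral_of_continuousAt i₂ u₂ hab
        (hf.continuousAt_moment hd hγ0 ht hft hcont m₂ b₂))
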